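/- **Setting.** Let $d\in\{2,3\}$ and let $\Omega\subset\mathbb R^d$ be a (bounded, open, non-empty) convex polygonal/polyhedral domain. Let $\mathcal T_h$ be a conforming mesh of $\Omega$: finitely many pairwise disjoint open elements $\kappa=F_\kappa(\hat\kappa)$, with $\hat\kappa=(-1,1)^d$ and $F_\kappa$ affine and invertible, whose closures cover $\overline\Omega$, and such that the closures of two different elements are disjoint or meet in a common face (of some dimension) of both. Put $h_\kappa=\operatorname{diam}\kappa$. The mesh is shape-regular with constant $\gamma$ (each $\kappa$ contains a ball of radius $\rho_\kappa>0$ with $h_\kappa\le\gamma\rho_\kappa$) and quasi-uniform with constant $q$ ($h_\kappa\le q\,h_{\kappa'}$ for all $\kappa,\kappa'$). Let $\mathcal F_h$ be the set of its $(d-1)$-dimensional faces and $\mathcal F_h^I$ the set of the interior ones (shared by two elements $\kappa^\pm$). For $p\ge 2$ let $\mathbb Q^p$ be the polynomials of degree at most $p$ in each variable and $$V_{hp}=\{v\in L^2(\Omega): v|_\kappa\circ F_\kappa\in\mathbb Q^p\ \ \forall\kappa\in\mathcal T_h\}.$$ With outward unit normals $n^\pm$ of $\kappa^\pm$, put on interior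 faces $[v]=v^+n^++v^-n^-$, $[\tau]=\tau^+\cdot n^++\tau^-\cdot n^-$, $\{\tau\}=(\tau^++\tau^-)/2$, and on boundary faces $[v]=vn$, $\{\tau\}=\tau$. The liftings $r_F(\tau),l_F(\varphi)\in[V_{hp}]^d$ are given, for all $\eta\in[V_{hp}]^d$, by $$\int_\Omega r_F(\tau)\cdot\eta\,dx=-\int_F\tau\cdot\{\eta\}\,ds,\qquad \int_\Omega l_F(\varphi)\cdot\eta\,dx=-\int_F\varphi\,[\eta]\,ds .$$ Put $\mathcal R(\tau)=\sum_{F\in\mathcal F_h}r_F(\tau)$, $\mathcal L(\varphi)=\sum_{F\in\mathcal F_h^I}l_F(\varphi)$ and $\Lambda(v)=\mathcal R([v])+\mathcal L(\beta\cdot[v])$. For $\alpha\ge1$ let $\sigma|_F=\alpha p^2/\min(h_{\kappa^+},h_{\kappa^-})$ on interior faces, $\sigma|_F=\alpha p^2/h_\kappa$ on boundary faces, and $$\mathcal A(u,v)=\sum_\kappa\int_\kappa\big(\nabla u\cdot\nabla v+\nabla u\cdot \Lambda(v)+\Lambda(u)\cdot\nabla v\big)dx+\sum_{F\in\mathcal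 F_h}\int_F\sigma[u]\cdot[v]\,ds+\theta\int_\Omega \Lambda(u)\cdot \Lambda(v)\,dx .$$ The method is either SIPG ($\theta=0$, $\beta=0$) or LDG ($\theta=1$, $\beta$ a vector, constant on each face, with $|\beta|\le b$). **Jacobi solver.** The nodes of $\kappa$ are the images under $F_\kappa$ of the $(p+1)^d$ tensor-product Gauss–Legendre–Lobatto nodes of $[-1,1]^d$; a node is interior or a boundary node according to whether it lies in $\kappa$ or on $\partial\kappa$, and $\mathcal N_B(\kappa)$ is the set of boundary nodes. Nodes of different elements count as different degrees of freedom. Let $V^B_{hp}$ be the space of $v\in V_{hp}$ vanishing at all interior nodes of all elements. For $\xi\in\mathcal N_B(\kappa)$ let $V^\xi$ be the space of $v\in V^B_{hp}$ vanishing at all boundary nodes of all elements other than the node $\xi$ of $\kappa$. With $P_B$, $P^\xi$ the $\mathcal A$-elliptic projections onto $V^B_{hp}$, $V^\xi$ (for $W=V^B_{hp}$ or $V^\xi$, the projection of $v$ is the $w\in W$ with $\mathcal A(w,z)=\mathcal A(v,z)$ for all $z\in W$), put $$T_B=\Big[\sum_{\kappa\in\mathcal T_h}\sum_{\xi\in\mathcal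 N_B(\kappa)}P^\xi\Big]P_B ,$$ and let $T_B^{-1}$ be the inverse of $T_B|_{V^B_{hp}}:V^B_{hp}\to V^B_{hp}$. The Oswald operator $Q_h$ on $V_{hp}$ is given by the nodal values $Q_hv(\xi)=0$ if $\xi\in\partial\Omega$, and otherwise $Q_hv(\xi)=$ the arithmetic mean of $v|_{\kappa'}(\xi)$ over all elements $\kappa'$ with $\xi\in\overline{\kappa'}$. **Lemma.** For all $d$, $\Omega$, $\gamma$, $q$, $b$ as above there exist $\alpha_0\ge1$ and constants $C_1,C_2>0$, depending only on $d,\Omega,\gamma,q,b$ (hence independent of $h$, $p$ and $\alpha$), such that for every mesh as above, every $p\ge2$ and every $\alpha\ge1$, for the LDG method, and for the SIPG method provided $\alpha\ge\alpha_0$: $T_B$ maps $V^B_{hp}$ bijectively onto itself, $v-Q_hv\in V^B_{hp}$ for all $v\in V_{hp}$, and $$\mathcal A(T_B^{-1}v^B,v^B)\ \ge\ C_1\,\mathcal A(v^B,v^B)\qquad\forall v^B\in V^B_{hp},$$ $$\mathcal A(T_B^{-1}(v-Q_hv),v-Q_hv)\ \le\ C_2\,\mathcal A(v-Q_hv,v-Q_hv)\qquad\forall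 v\in V_{hp}.$$ -/

import Mathlib

open MeasureTheory Polynomial
open scoped RealInnerProductSpace

noncomputable section

namespace HpDG

/-- Points of `ℝ^d` with the Euclidean structure. -/
abbrev Pt (d : ℕ) : Type := EuclideanSpace ℝ (Fin d)

variable {d : ℕ}

/-- A (bounded, open, non-empty) convex polygonal / polyhedral domain. -/
def IsConvexPolytopalDomain (Ω : Set (Pt d)) : Prop :=
  IsOpen Ω ∧ Ω.Nonempty ∧ Convex ℝ Ω ∧
    ∃ S : Finset (Pt d), closure Ω = convexHull ℝ (S : Set (Pt d))

/-! ### The reference element -/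

/-- The open reference hypercube `(-1,1)^d`. -/
def refCube (d : ℕ) : Set (Pt d) := {x | ∀ i, x i ∈ Set.Ioo (-1 : ℝ) 1}

/-- The sign `+1` or `-1`, selecting one of the two opposite facets in a coordinate direction. -/
def sgn (b : Bool) : ℝ := if b then 1 else -1

/-- A closed face, of any dimension, of the reference hypercube: the coordinates `i` with
`s i = some b` are frozen at `sgn b`. -/
def refFace (s : Fin d → Option Bool) : Set (Pt d) :=
  {x | ∀ i, x i ∈ Set.Icc (-1 : ℝ) 1 ∧ ∀ b, s i = some b → x i = sgn b}

/-- The closed `(d-1)`-dimensional face `{x_j = ±1}` of the reference hypercube. -/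
def refFacet (j : Fin d) (b : Bool) : Set (Pt d) :=
  {x | (∀ i, x i ∈ Set.Icc (-1 : ℝ) 1) ∧ x j = sgn b}

/-! ### Conforming meshes of affinely mapped hypercubes -/

/-- A conforming partition of `Ω` into finitely many invertible affine images of the open
reference hypercube: the elements are disjoint, their closures cover the closure of `Ω`, and the
closures of two different elements either do not meet or meet in a common face (a vertex, an
edge, …, a facet) of both. -/
structure Mesh (Ω : Set (Pt d)) where
  /-- the number of elements -/
  N : ℕ
  /-- the affine maps from the reference element onto the elements -/
  map : Fin N → (Pt d ≃ᵃ[ℝ] Pt d)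
  disjoint : ∀ k l, k ≠ l → Disjoint (map k '' refCube d) (map l '' refCube d)
  cover : ⋃ k, closure (map k '' refCube d) = closure Ω
  conforming : ∀ k l, k ≠ l →
    Disjoint (closure (map k '' refCube d)) (closure (map l '' refCube d)) ∨
    ∃ s t : Fin d → Option Bool,
      closure (map k '' refCube d) ∩ closure (map l '' refCube d) = map k '' refFace s ∧
      closure (map k '' refCube d) ∩ closure (map l '' refCube d) = map l '' refFace t

namespace Mesh

variable {Ω : Set (Pt d)} (M : Mesh Ω)

/-- The open element `κ_k`. -/
def elem (k : Fin M.N) : Set (Pt d) := M.map k '' refCube d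

/-- The diameter `h_κ` of an element. -/
def diam (k : Fin M.N) : ℝ := Metric.diam (M.elem k)

/-- Shape regularity with constant `γ`: every element contains a ball of radius `ρ` with
`h_κ ≤ γ ρ`. -/
def ShapeRegular (γ : ℝ) : Prop :=
  ∀ k, ∃ (c : Pt d) (ρ : ℝ), 0 < ρ ∧ Metric.ball c ρ ⊆ M.elem k ∧ M.diam k ≤ γ * ρ

/-- Quasi-uniformity with constant `q`: the diameters of any two elements are comparable. -/
def QuasiUniform (q : ℝ) : Prop := ∀ k l, M.diam k ≤ q * M.diam l

/-- A side of the mesh: an element together with one of its `2d` facets. -/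
abbrev Side : Type := Fin M.N × Fin d × Bool

/-- The closed face, as a subset of `ℝ^d`, underlying a side. -/
def facet (σ : M.Side) : Set (Pt d) := M.map σ.1 '' refFacet σ.2.1 σ.2.2

/-- The unit normal on a side that points out of its element. With `x ↦ B x + c` the affine map of
the element this is `± B⁻ᵀ e_j / |B⁻ᵀ e_j|` on the image of `{x_j = ±1}`. -/
def normal (σ : M.Side) : Pt d :=
  let w : Pt d := LinearMap.adjoint ((M.map σ.1).symm.linear : Pt d →ₗ[ℝ] Pt d)
    (EuclideanSpace.single σ.2.1 1)
  sgn σ.2.2 • (‖w‖⁻¹ • w)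

open Classical in
/-- The set `F_h` of all faces of the mesh. -/
def faces : Finset (Set (Pt d)) := Finset.univ.image M.facet

open Classical in
/-- The sides lying on a given face: two for an interior face (one in each of the elements `κ⁺`
and `κ⁻`), one for a boundary face. -/
def sides (f : Set (Pt d)) : Finset M.Side := Finset.univ.filter fun σ => M.facet σ = f

open Classical in
/-- The interior faces, i.e. those shared by two different elements. -/
def interiorFaces : Finset (Set (Pt d)) :=
  M.faces.filter fun f => ∃ σ ∈ M.sides f, ∃ τ ∈ M.sides f, σ.1 ≠ τ.1

/-! ### The discontinuous finite element space -/

/-- Families of scalar functions, one for each element. A function on `Ω` that is polynomial on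
every element is represented by the family of its elementwise polynomials, each taken on all of
`ℝ^d`; traces from inside an element are then plain values. -/
abbrev BrokenFun : Type := Fin M.N → Pt d → ℝ

/-- Families of vector fields, one for each element. -/
abbrev BrokenField : Type := Fin M.N → Pt d → Pt d

end Mesh

/-- `ℚ^p`: polynomial functions of degree at most `p` in each coordinate. -/
def refQ (d p : ℕ) : Submodule ℝ (Pt d → ℝ) :=
  Submodule.span ℝ
    (Set.range fun (m : Fin d → Fin (p + 1)) (x : Pt d) => ∏ i, x i ^ (m i : ℕ))

namespace Mesh

variable {Ω : Set (Pt d)} (M : Mesh Ω)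

/-- The space `V_hp`: on each element, `v ∘ F_κ ∈ ℚ^p`. -/
def dgSpace (p : ℕ) : Submodule ℝ M.BrokenFun where
  carrier := {v | ∀ k, (fun x => v k (M.map k x)) ∈ refQ d p}
  zero_mem' := fun _ => (refQ d p).zero_mem
  add_mem' := fun hu hv k => (refQ d p).add_mem (hu k) (hv k)
  smul_mem' := fun c _ hv k => (refQ d p).smul_mem c (hv k)

/-- The space `[V_hp]^d` of vector fields with components in `V_hp`. -/
def dgFields (p : ℕ) : Set M.BrokenField :=
  {η | ∀ i, (fun k x => η k x i) ∈ M.dgSpace p}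

/-- The elementwise gradient. -/
def grad (v : M.BrokenFun) : M.BrokenField := fun k x => gradient (v k) x

/-- The jump `[v] = v⁺ n⁺ + v⁻ n⁻` on an interior face, `[v] = v n` on a boundary face. -/
def jump (v : M.BrokenFun) (f : Set (Pt d)) (x : Pt d) : Pt d :=
  ∑ σ ∈ M.sides f, v σ.1 x • M.normal σ

/-- The jump `τ⁺ · n⁺ + τ⁻ · n⁻` of a vector field across an interior face. -/
def fluxJump (η : M.BrokenField) (f : Set (Pt d)) (x : Pt d) : ℝ :=
  ∑ σ ∈ M.sides f, ⟪η σ.1 x, M.normal σ⟫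

/-- The average `(τ⁺ + τ⁻)/2` on an interior face, `τ` on a boundary face. -/
def avg (η : M.BrokenField) (f : Set (Pt d)) (x : Pt d) : Pt d :=
  ((M.sides f).card : ℝ)⁻¹ • ∑ σ ∈ M.sides f, η σ.1 x

/-- The surface integral `∫_F g ds`. -/
def faceIntegral (f : Set (Pt d)) (g : Pt d → ℝ) : ℝ := ∫ x in f, g x ∂μHE[d - 1]

/-- The `L²(Ω)` inner product of two broken vector fields. -/
def fieldInner (η ζ : M.BrokenField) : ℝ := ∑ k, ∫ x in M.elem k, ⟪η k x, ζ k x⟫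

/-! ### Lifting operators and the bilinear form -/

open Classical in
/-- The unique element `r` of `[V_hp]^d` with `∫_Ω r · η = ℓ η` for all `η ∈ [V_hp]^d`. It exists
for every functional `ℓ` that is linear on `[V_hp]^d`, hence in all the cases used below. -/
def represent (p : ℕ) (l : M.BrokenField → ℝ) : M.BrokenField :=
  if h : ∃ r ∈ M.dgFields p, ∀ η ∈ M.dgFields p, M.fieldInner r η = l η then h.choose else 0

/-- The local lifting `r_F`: `∫_Ω r_F(τ) · η = - ∫_F τ · {η}`. -/
def rLift (p : ℕ) (f : Set (Pt d)) (τ : Pt d → Pt d) : M.BrokenField :=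
  M.represent p fun η => -faceIntegral f fun x => ⟪τ x, M.avg η f x⟫

/-- The local lifting `l_F`: `∫_Ω l_F(φ) · η = - ∫_F φ [η]`. -/
def lLift (p : ℕ) (f : Set (Pt d)) (φ : Pt d → ℝ) : M.BrokenField :=
  M.represent p fun η => -faceIntegral f fun x => φ x * M.fluxJump η f x

/-- `R([u]) + L(β · [u])`, with `R` the sum of `r_F` over all faces and `L` the sum of `l_F` over
the interior faces; `β` is constant on each face. -/
def lifting (p : ℕ) (β : Set (Pt d) → Pt d) (u : M.BrokenFun) : M.BrokenField :=
  ∑ f ∈ M.faces, M.rLift p f (M.jump u f) +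
    ∑ f ∈ M.interiorFaces, M.lLift p f fun x => ⟪β f, M.jump u f x⟫

/-- The penalty `σ|_F = α p² / min(h_{κ⁺}, h_{κ⁻})`, resp. `α p² / h_κ` on a boundary face. -/
def penalty (p : ℕ) (α : ℝ) (f : Set (Pt d)) : ℝ :=
  α * (p : ℝ) ^ 2 / ⨅ σ : M.sides f, M.diam σ.1.1

/-- The DG bilinear form `A(u,v)`. -/
def dgForm (p : ℕ) (θ α : ℝ) (β : Set (Pt d) → Pt d) (u v : M.BrokenFun) : ℝ :=
  M.fieldInner (M.grad u) (M.grad v) +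
    M.fieldInner (M.grad u) (M.lifting p β v) +
    M.fieldInner (M.lifting p β u) (M.grad v) +
    ∑ f ∈ M.faces,
      faceIntegral f (fun x => M.penalty p α f * ⟪M.jump u f x, M.jump v f x⟫) +
    θ * M.fieldInner (M.lifting p β u) (M.lifting p β v)

end Mesh

/-! ### Gauss–Legendre–Lobatto nodes -/

/-- `(1 - X²) L_p'(X)` up to a non-zero factor, with `L_p` the Legendre polynomial, which by the
Rodrigues formula is a multiple of the `p`-th derivative of `(X² - 1)^p`. -/
def gllPoly (p : ℕ) : ℝ[X] :=
  (1 - X ^ 2) * (Polynomial.derivative^[p + 1] ((X ^ 2 - 1) ^ p))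

/-- The Gauss–Legendre–Lobatto nodes on `[-1,1]`: the points `±1` and the zeros of `L_p'`. -/
def gllNodes (p : ℕ) : Finset ℝ := (gllPoly p).roots.toFinset

/-- Indices of the tensor product GLL nodes of the reference element. -/
abbrev NodeIdx (d p : ℕ) : Type := Fin d → {t : ℝ // t ∈ gllNodes p}

/-- The node of the reference element with a given index. -/
def refNode {p : ℕ} (a : NodeIdx d p) : Pt d := WithLp.toLp 2 fun i => (a i : ℝ)

/-- The node lies on the boundary of the reference element (otherwise it is interior). -/
def IsBdryNode {p : ℕ} (a : NodeIdx d p) : Prop := ∃ i, (a i : ℝ) = 1 ∨ (a i : ℝ) = -1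

/-- The Lagrange basis function of `ℚ^p` attached to a tensor product GLL node. -/
def refBasis {p : ℕ} (a : NodeIdx d p) (x : Pt d) : ℝ :=
  ∏ i, (Lagrange.basis (gllNodes p) id (a i : ℝ)).eval (x i)

namespace Mesh

variable {Ω : Set (Pt d)} (M : Mesh Ω)

/-- The node of the element `k` with a given index. -/
def node {p : ℕ} (k : Fin M.N) (a : NodeIdx d p) : Pt d := M.map k (refNode a)

/-- The space `V_hp^B` of the functions in `V_hp` that vanish at all interior nodes. -/
def bdrySpace (p : ℕ) : Submodule ℝ M.BrokenFun where
  carrier := {v | v ∈ M.dgSpace p ∧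
    ∀ k, ∀ a : NodeIdx d p, ¬ IsBdryNode a → v k (M.node k a) = 0}
  zero_mem' := ⟨(M.dgSpace p).zero_mem, fun _ _ _ => rfl⟩
  add_mem' := fun hu hv => ⟨(M.dgSpace p).add_mem hu.1 hv.1, fun k a ha => by
    simp [hu.2 k a ha, hv.2 k a ha]⟩
  smul_mem' := fun c _ hv => ⟨(M.dgSpace p).smul_mem c hv.1, fun k a ha => by
    simp [hv.2 k a ha]⟩

/-- The one-dimensional space `V^ξ` of the functions in `V_hp^B` that vanish at every boundary
node of every element except the boundary node `a` of the element `k`. Nodes of different elements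
are different degrees of freedom, even where they are the same point. -/
def nodalSpace {p : ℕ} (k : Fin M.N) (a : NodeIdx d p) : Submodule ℝ M.BrokenFun where
  carrier := {v | v ∈ M.bdrySpace p ∧
    ∀ l, ∀ b : NodeIdx d p, IsBdryNode b → (l, b) ≠ (k, a) → v l (M.node l b) = 0}
  zero_mem' := ⟨(M.bdrySpace p).zero_mem, fun _ _ _ _ => rfl⟩
  add_mem' := fun hu hv => ⟨(M.bdrySpace p).add_mem hu.1 hv.1, fun l b hb h => by
    simp [hu.2 l b hb h, hv.2 l b hb h]⟩
  smul_mem' := fun c _ hv => ⟨(M.bdrySpace p).smul_mem c hv.1, fun l b hb h => by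
    simp [hv.2 l b hb h]⟩

open Classical in
/-- The elements whose closure contains the point `ξ`. -/
def elemsAt (ξ : Pt d) : Finset (Fin M.N) := Finset.univ.filter fun l => ξ ∈ closure (M.elem l)

open Classical in
/-- The value of `Q_h v` at a node: zero on `∂Ω`, otherwise the mean of the values of `v` from all
the elements that contain the node. -/
def oswaldValue (v : M.BrokenFun) (ξ : Pt d) : ℝ :=
  if ξ ∈ frontier Ω then 0
  else ((M.elemsAt ξ).card : ℝ)⁻¹ * ∑ l ∈ M.elemsAt ξ, v l ξ

/-- The Oswald operator `Q_h`, given by the nodal values `oswaldValue`. -/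
def oswald (p : ℕ) (v : M.BrokenFun) : M.BrokenFun := fun k x =>
  ∑ a : NodeIdx d p, M.oswaldValue v (M.node k a) * refBasis a ((M.map k).symm x)

end Mesh

/-! ### The Jacobi subspace solver -/

open Classical in
/-- The elliptic projection onto `W` for the form `A`: the unique `w ∈ W` with
`A(w,z) = A(v,z)` for all `z ∈ W`. -/
def ellipticProj {V : Type*} [AddCommGroup V] [Module ℝ V] (A : V → V → ℝ) (W : Submodule ℝ V)
    (v : V) : V :=
  if h : ∃ w ∈ W, ∀ z ∈ W, A w z = A v z then h.choose else 0

open Classical in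
/-- The Jacobi solver `T_B = (∑_κ ∑_{ξ ∈ N_B(κ)} P^ξ) P_B`. -/
def Mesh.jacobi {Ω : Set (Pt d)} (M : Mesh Ω) (p : ℕ) (θ α : ℝ) (β : Set (Pt d) → Pt d)
    (v : M.BrokenFun) : M.BrokenFun :=
  ∑ k, ∑ a ∈ Finset.univ.filter (fun a : NodeIdx d p => IsBdryNode a),
    ellipticProj (M.dgForm p θ α β) (M.nodalSpace k a)
      (ellipticProj (M.dgForm p θ α β) (M.bdrySpace p) v)

/-- `T_B⁻¹`, the inverse of the restriction of `T_B` to `V_hp^B`. -/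
def Mesh.jacobiInv {Ω : Set (Pt d)} (M : Mesh Ω) (p : ℕ) (θ α : ℝ) (β : Set (Pt d) → Pt d)
    (v : M.BrokenFun) : M.BrokenFun :=
  Function.invFunOn (M.jacobi p θ α β) (M.bdrySpace p : Set M.BrokenFun) v

end HpDG

end

/-!
The space `V_hp^B` has the basis of the nodal functions `φ_ξ` of the boundary nodes, and each `V^ξ` is
spanned by `φ_ξ`. So the Jacobi solver divides residuals by the diagonal entries of the stiffness
matrix, and its inverse has the form `A(T_B⁻¹ v, v) = ∑_ξ v(ξ)² A(φ_ξ, φ_ξ)` (`dgForm_jacobiInv`). Both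
bounds compare this diagonal form with `A(v, v)`.

*Energy.* A discrete trace inequality bounds the `L²` norm of the lifting by the penalty form
(`fieldInner_lifting_self_le`), so that `A` is equivalent to the broken gradient plus the penalty form
(`dgForm_equiv`), for LDG always and for SIPG once `α` is large.

*Nodal values.* The Gauss–Legendre–Lobatto rule overestimates the integral of the square of a
polynomial of degree `p` by at most a factor `3` (`polyInt_sq_le_gllSum`, `gllSum_sq_le`). Hence on
elements and facets the `L²` norm is equivalent, uniformly in `p`, to a sum of squares of nodal values
with tensor-product weights `w_ξ`, and the weight `2 / (p (p + 1))` of an end point yields the factor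
`p²` between a facet and its element. With the inverse inequality for the gradient, the energy of `v`
is at most a constant times `α p⁴ h^(d-2) ∑_ξ w_ξ v(ξ)²` (`energy_le`). Conversely the jump of `φ_ξ`
over a facet that contains `ξ` already has a penalty of at least a constant times `α p⁴ h^(d-2) w_ξ`
(`le_energy_hat`). So every diagonal entry is of this order, and the lower bound follows
(`jacobi_lower_bound`).

*Jumps.* For the upper bound the weighted nodal values of `v - Q_h v` have to be bounded by the jumps.
The nodal values of this function have mean zero at each node off `∂Ω` (`sum_sub_oswald`). The
elements around a node are connected through facets that contain it (`exists_common_facet`), because a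
generic segment between two of them avoids the faces of dimension at most `d - 2`; hence values from
different elements differ by jumps at the node. At a node on `∂Ω` there is a boundary facet
(`exists_boundary_facet`), where the jump is the value itself. This gives `sq_le_sum_jump_sq`. Since a
node of one element that lies on a facet of another is a node of that element too, with the same
weight, these bounds can be summed facet by facet (`sum_bdryNodes_le`), and `jacobi_upper_bound`
follows.

No Poincaré inequality is needed for positive definiteness on `V_hp^B`: an element of degree `p ≥ 2`
has an interior node, so a function with zero gradient vanishes (`energy_pos`). All constants depend
on the mesh only through `K` in `Scaled M K h`, which is controlled by shape regularity and
quasi-uniformity (`exists_scaled`).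
-/


noncomputable section

namespace HpDG

/-! ### Integration of polynomials over `[-1,1]` and Legendre polynomials -/

/-- The functional `q ↦ ∫_{-1}^{1} q`. -/
def polyInt : ℝ[X] →ₗ[ℝ] ℝ where
  toFun q := ∫ x in (-1 : ℝ)..1, q.eval x
  map_add' q r := by
    simp only [eval_add]
    exact intervalIntegral.integral_add (q.continuous.intervalIntegrable _ _)
      (r.continuous.intervalIntegrable _ _)
  map_smul' c q := by
    simp only [eval_smul, RingHom.id_apply, smul_eq_mul]
    exact intervalIntegral.integral_const_mul _ _

lemma polyInt_apply (q : ℝ[X]) : polyInt q = ∫ x in (-1 : ℝ)..1, q.eval x := rfl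

lemma polyInt_derivative (q : ℝ[X]) : polyInt (derivative q) = q.eval 1 - q.eval (-1) := by
  rw [polyInt_apply]
  exact intervalIntegral.integral_eq_sub_of_hasDerivAt (fun x _ => q.hasDerivAt x)
    ((derivative q).continuous.intervalIntegrable _ _)

lemma polyInt_C_mul (c : ℝ) (q : ℝ[X]) : polyInt (C c * q) = c * polyInt q := by
  rw [← smul_eq_C_mul, map_smul, smul_eq_mul]

/-- Integration by parts. -/
lemma polyInt_parts (f g : ℝ[X]) (h1 : f.eval 1 * g.eval 1 = 0)
    (h2 : f.eval (-1) * g.eval (-1) = 0) :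
    polyInt (derivative f * g) = -polyInt (f * derivative g) := by
  have := polyInt_derivative (f * g)
  rw [derivative_mul, map_add, eval_mul, eval_mul, h1, h2] at this
  linarith

lemma polyInt_nonneg (q : ℝ[X]) (h : ∀ x ∈ Set.Icc (-1 : ℝ) 1, 0 ≤ q.eval x) :
    0 ≤ polyInt q :=
  intervalIntegral.integral_nonneg (by norm_num) h

lemma polyInt_pos (q : ℝ[X]) (h : ∀ x ∈ Set.Icc (-1 : ℝ) 1, 0 ≤ q.eval x) (hq : q ≠ 0) :
    0 < polyInt q := by
  -- a non-zero polynomial has a point of `(-1,1)` at which it does not vanish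
  obtain ⟨c, hc, hne⟩ : ∃ c ∈ Set.Ioo (-1 : ℝ) 1, q.eval c ≠ 0 := by
    by_contra! hcon
    apply hq
    apply Polynomial.eq_zero_of_infinite_isRoot
    exact (Set.Ioo_infinite (by norm_num : (-1 : ℝ) < 1)).mono fun x hx => hcon x hx
  have hcI : c ∈ Set.Icc (-1 : ℝ) 1 := ⟨hc.1.le, hc.2.le⟩
  exact intervalIntegral.integral_pos (by norm_num) q.continuous.continuousOn
    (fun x hx => h x ⟨hx.1.le, hx.2⟩) ⟨c, hcI, lt_of_le_of_ne (h c hcI) (Ne.symm hne)⟩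

lemma polyInt_sq_nonneg (q : ℝ[X]) : 0 ≤ polyInt (q ^ 2) :=
  polyInt_nonneg _ fun x _ => by rw [eval_pow]; positivity

/-- Cauchy–Schwarz. -/
lemma polyInt_mul_sq_le (q r : ℝ[X]) :
    polyInt (q * r) ^ 2 ≤ polyInt (q ^ 2) * polyInt (r ^ 2) := by
  have key : ∀ t : ℝ, 0 ≤ polyInt (r ^ 2) * (t * t) + (2 * polyInt (q * r)) * t
      + polyInt (q ^ 2) := by
    intro t
    have h := polyInt_sq_nonneg (C t * r + q)
    have e : (C t * r + q) ^ 2 = C (t * t) * r ^ 2 + C (2 * t) * (q * r) + q ^ 2 := by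
      simp only [map_mul, map_ofNat]; ring
    rw [e, map_add, map_add, polyInt_C_mul, polyInt_C_mul] at h
    linarith
  have := discrim_le_zero key
  rw [discrim] at this
  nlinarith

lemma polyInt_comp_neg (q : ℝ[X]) : polyInt (q.comp (-X)) = polyInt q := by
  simp only [polyInt_apply, eval_comp, eval_neg, eval_X]
  rw [intervalIntegral.integral_comp_neg (fun x => q.eval x)]
  simp

/-- The Legendre polynomial of degree `p`, up to a non-zero factor (Rodrigues' formula). -/
def legendre (p : ℕ) : ℝ[X] := derivative^[p] ((X ^ 2 - 1) ^ p)

lemma monic_X_sq_sub_one : (X ^ 2 - 1 : ℝ[X]).Monic := by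
  simpa using monic_X_pow_sub_C (1 : ℝ) two_ne_zero

lemma natDegree_X_sq_sub_one : (X ^ 2 - 1 : ℝ[X]).natDegree = 2 := by
  simpa using natDegree_X_pow_sub_C (n := 2) (r := (1 : ℝ))

lemma natDegree_X_sq_sub_one_pow (p : ℕ) : ((X ^ 2 - 1 : ℝ[X]) ^ p).natDegree = 2 * p := by
  rw [monic_X_sq_sub_one.natDegree_pow, natDegree_X_sq_sub_one, mul_comm]

lemma natDegree_iterate_derivative_eq (q : ℝ[X]) (k : ℕ) :
    (derivative^[k] q).natDegree = q.natDegree - k := by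
  induction k with
  | zero => simp
  | succ k ih => rw [Function.iterate_succ_apply', natDegree_derivative, ih]; omega

lemma natDegree_legendre (p : ℕ) : (legendre p).natDegree = p := by
  rw [legendre, natDegree_iterate_derivative_eq, natDegree_X_sq_sub_one_pow]; omega

lemma legendre_ne_zero (p : ℕ) : legendre p ≠ 0 := by
  rcases Nat.eq_zero_or_pos p with rfl | hp
  · simp [legendre]
  · intro h
    have := natDegree_legendre p
    rw [h, natDegree_zero] at this
    omega

lemma eval_iterate_derivative_X_sq_sub_one_pow {p k : ℕ} (hk : k < p) {x : ℝ}
    (hx : x ^ 2 = 1) : (derivative^[k] ((X ^ 2 - 1 : ℝ[X]) ^ p)).eval x = 0 := by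
  obtain ⟨r, hr⟩ := pow_sub_dvd_iterate_derivative_pow (X ^ 2 - 1 : ℝ[X]) p k
  rw [hr, eval_mul, eval_pow]
  simp [hx, Nat.sub_ne_zero_of_lt hk]

/-- Orthogonality of the Legendre polynomials to lower degrees: in Rodrigues' formula all
derivatives are moved to the other factor, since those of `(X² - 1)^p` of order less than `p` vanish
at the end points. -/
lemma polyInt_legendre_mul {p : ℕ} {r : ℝ[X]} (hr : r.natDegree < p) :
    polyInt (legendre p * r) = 0 := by
  have key : ∀ k ≤ p, polyInt (derivative^[k] ((X ^ 2 - 1 : ℝ[X]) ^ p) *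
      derivative^[p - k] r) = 0 := by
    intro k
    induction k with
    | zero => intro _; simp [iterate_derivative_eq_zero hr]
    | succ k ih =>
      intro hk
      rw [Function.iterate_succ_apply', polyInt_parts, ← Function.iterate_succ_apply'
        (f := derivative), show (p - (k + 1)).succ = p - k by omega, ih (by omega), neg_zero]
      · rw [eval_iterate_derivative_X_sq_sub_one_pow (by omega) (by norm_num), zero_mul]
      · rw [eval_iterate_derivative_X_sq_sub_one_pow (by omega) (by norm_num), zero_mul]
  simpa [legendre] using key p le_rfl

lemma natDegree_lt_of_coeff_eq_zero {q : ℝ[X]} {n : ℕ} (hn : 0 < n) (h : q.natDegree ≤ n)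
    (h0 : q.coeff n = 0) : q.natDegree < n := by
  refine lt_of_le_of_ne h fun he => ?_
  have : q.leadingCoeff = 0 := by rw [leadingCoeff, he, h0]
  rw [leadingCoeff_eq_zero] at this
  simp [this] at he
  omega

/-! ### The interior Gauss–Legendre–Lobatto nodes -/

/-- The monic multiple of `L_p'`, whose roots are the interior Gauss–Legendre–Lobatto nodes. -/
def interiorPoly (p : ℕ) : ℝ[X] :=
  C (derivative (legendre p)).leadingCoeff⁻¹ * derivative (legendre p)

variable {p : ℕ}

lemma derivative_legendre_ne_zero (hp : 1 < p) : derivative (legendre p) ≠ 0 := by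
  intro h
  have := natDegree_derivative (legendre p)
  rw [h, natDegree_legendre, natDegree_zero] at this
  omega

lemma interiorPoly_monic (hp : 1 < p) : (interiorPoly p).Monic := by
  have : (derivative (legendre p)).leadingCoeff ≠ 0 :=
    leadingCoeff_ne_zero.2 (derivative_legendre_ne_zero hp)
  rw [Monic, interiorPoly, leadingCoeff_mul, leadingCoeff_C, inv_mul_cancel₀ this]

lemma natDegree_interiorPoly (hp : 1 < p) : (interiorPoly p).natDegree = p - 1 := by
  have : (derivative (legendre p)).leadingCoeff ≠ 0 :=
    leadingCoeff_ne_zero.2 (derivative_legendre_ne_zero hp)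
  rw [interiorPoly, natDegree_C_mul (inv_ne_zero this), natDegree_derivative, natDegree_legendre]

/-- `L_p'` is orthogonal to the polynomials of degree at most `p - 2` for the weight `1 - x²`. -/
lemma polyInt_weight_interiorPoly_mul {s : ℝ[X]} (hs : s.natDegree + 1 < p) :
    polyInt ((1 - X ^ 2) * interiorPoly p * s) = 0 := by
  have hdeg : ((1 - X ^ 2 : ℝ[X]) * s).natDegree ≤ p := by
    refine natDegree_mul_le.trans ?_
    have : (1 - X ^ 2 : ℝ[X]).natDegree ≤ 2 := by compute_degree
    omega
  have h : polyInt (derivative (legendre p) * ((1 - X ^ 2) * s)) = 0 := by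
    rw [polyInt_parts _ _ (by simp) (by simp), polyInt_legendre_mul, neg_zero]
    rw [natDegree_derivative]
    omega
  have e : (1 - X ^ 2) * interiorPoly p * s =
      C (derivative (legendre p)).leadingCoeff⁻¹ *
        (derivative (legendre p) * ((1 - X ^ 2) * s)) := by
    rw [interiorPoly]; ring
  rw [e, polyInt_C_mul, h, mul_zero]

lemma one_sub_sq_nonneg {x : ℝ} (hx : x ∈ Set.Icc (-1 : ℝ) 1) : 0 ≤ 1 - x ^ 2 := by
  nlinarith [hx.1, hx.2]

lemma one_sub_X_sq_ne_zero : (1 - X ^ 2 : ℝ[X]) ≠ 0 := by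
  intro h
  have := congrArg (eval 0) h
  simp at this

/-- The interior nodes lie in `(-1,1)`: a root `c` outside would make the weighted integral of
`(x - c) g²` non-zero, against orthogonality. -/
lemma interiorPoly_root_mem (hp : 1 < p) {c : ℝ} (hc : (interiorPoly p).IsRoot c) :
    c ∈ Set.Ioo (-1 : ℝ) 1 := by
  obtain ⟨g, hg⟩ := dvd_iff_isRoot.2 hc
  have hm := (interiorPoly_monic hp).ne_zero
  have hg0 : g ≠ 0 := by rintro rfl; simp [hg] at hm
  have hgd : g.natDegree + 1 < p := by
    have := natDegree_interiorPoly hp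
    rw [hg, natDegree_mul (X_sub_C_ne_zero c) hg0, natDegree_X_sub_C] at this
    omega
  have h0 := polyInt_weight_interiorPoly_mul hgd
  rw [hg] at h0
  -- otherwise `x - c` has a constant sign on `[-1,1]`
  by_contra hcon
  rw [Set.mem_Ioo, not_and_or, not_lt, not_lt] at hcon
  have hne : (1 - X ^ 2) * ((X - C c) * g) * g ≠ 0 :=
    mul_ne_zero (mul_ne_zero one_sub_X_sq_ne_zero (mul_ne_zero (X_sub_C_ne_zero c) hg0)) hg0
  rcases hcon with h | h
  · refine (polyInt_pos _ (fun x hx => ?_) hne).ne' h0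
    have h1 := one_sub_sq_nonneg hx
    have h2 : 0 ≤ x - c := by linarith [hx.1]
    simp only [eval_mul, eval_sub, eval_one, eval_pow, eval_X, eval_C]
    have : (1 - x ^ 2) * ((x - c) * eval x g) * eval x g = (1 - x ^ 2) * (x - c) * eval x g ^ 2 := by
      ring
    rw [this]; positivity
  · refine (polyInt_pos (-((1 - X ^ 2) * ((X - C c) * g) * g)) (fun x hx => ?_)
      (neg_ne_zero.2 hne)).ne' (by rw [map_neg, h0, neg_zero])
    have h1 := one_sub_sq_nonneg hx
    have h2 : 0 ≤ c - x := by linarith [hx.2]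
    simp only [eval_neg, eval_mul, eval_sub, eval_one, eval_pow, eval_X, eval_C]
    have : -((1 - x ^ 2) * ((x - c) * eval x g) * eval x g)
        = (1 - x ^ 2) * (c - x) * eval x g ^ 2 := by ring
    rw [this]; positivity

/-- The interior nodes are simple: a double root `c` would make the weighted integral of
`(x - c)² g²` positive, against orthogonality. -/
lemma interiorPoly_nodup_roots (hp : 1 < p) : (interiorPoly p).roots.Nodup := by
  have hm := (interiorPoly_monic hp).ne_zero
  rw [Multiset.nodup_iff_count_le_one]
  intro c
  rw [count_roots, rootMultiplicity_le_iff hm]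
  rintro ⟨g, hg⟩
  have hg0 : g ≠ 0 := by rintro rfl; simp [hg] at hm
  have hX : (X - C c) ^ (1 + 1) ≠ 0 := pow_ne_zero _ (X_sub_C_ne_zero c)
  have hgd : g.natDegree + 1 < p := by
    have := natDegree_interiorPoly hp
    rw [hg, natDegree_mul hX hg0, natDegree_pow, natDegree_X_sub_C] at this
    omega
  have h0 := polyInt_weight_interiorPoly_mul hgd
  rw [hg] at h0
  refine (polyInt_pos _ (fun x hx => ?_) (mul_ne_zero (mul_ne_zero one_sub_X_sq_ne_zero
    (mul_ne_zero hX hg0)) hg0)).ne' h0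
  have h1 := one_sub_sq_nonneg hx
  simp only [eval_mul, eval_sub, eval_one, eval_pow, eval_X, eval_C]
  have : (1 - x ^ 2) * ((x - c) ^ (1 + 1) * eval x g) * eval x g
      = (1 - x ^ 2) * ((x - c) * eval x g) ^ 2 := by ring
  rw [this]; positivity

/-- All roots of `L_p'` are real, by Rolle's theorem applied repeatedly to `(X² - 1)^p`. -/
lemma card_roots_interiorPoly (hp : 1 < p) : (interiorPoly p).roots.card = p - 1 := by
  have hlow : ∀ k, 2 * p - k ≤ (derivative^[k] ((X ^ 2 - 1 : ℝ[X]) ^ p)).roots.card := by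
    intro k
    induction k with
    | zero =>
      have e : (X ^ 2 - 1 : ℝ[X]) = (X - C 1) * (X - C (-1)) := by
        simp only [map_one, map_neg]; ring
      have hne : (X - C 1 : ℝ[X]) * (X - C (-1)) ≠ 0 :=
        mul_ne_zero (X_sub_C_ne_zero _) (X_sub_C_ne_zero _)
      simp only [Function.iterate_zero, id]
      rw [e, roots_pow, roots_mul hne, roots_X_sub_C, roots_X_sub_C]
      simp
      omega
    | succ k ih =>
      have := card_roots_le_derivative (derivative^[k] ((X ^ 2 - 1 : ℝ[X]) ^ p))
      rw [Function.iterate_succ_apply']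
      omega
  have h := hlow (p + 1)
  have hc : (derivative (legendre p)).leadingCoeff ≠ 0 :=
    leadingCoeff_ne_zero.2 (derivative_legendre_ne_zero hp)
  have e : (interiorPoly p).roots = (derivative^[p + 1] ((X ^ 2 - 1 : ℝ[X]) ^ p)).roots := by
    rw [interiorPoly, roots_C_mul _ (inv_ne_zero hc), legendre, Function.iterate_succ_apply']
  refine le_antisymm ((card_roots' _).trans (natDegree_interiorPoly hp).le) ?_
  rw [e]; omega

lemma gllPoly_eq (hp : 1 < p) :
    gllPoly p = C (derivative (legendre p)).leadingCoeff * ((1 - X ^ 2) * interiorPoly p) := by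
  have hc : (derivative (legendre p)).leadingCoeff ≠ 0 :=
    leadingCoeff_ne_zero.2 (derivative_legendre_ne_zero hp)
  have : C (derivative (legendre p)).leadingCoeff * interiorPoly p = derivative (legendre p) := by
    rw [interiorPoly, ← mul_assoc, ← C_mul, mul_inv_cancel₀ hc, C_1, one_mul]
  rw [gllPoly, Function.iterate_succ_apply', mul_left_comm, this]
  rfl

lemma gllPoly_ne_zero (hp : 1 < p) : gllPoly p ≠ 0 := by
  have hc : (derivative (legendre p)).leadingCoeff ≠ 0 :=
    leadingCoeff_ne_zero.2 (derivative_legendre_ne_zero hp)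
  rw [gllPoly_eq hp]
  exact mul_ne_zero (C_ne_zero.2 hc)
    (mul_ne_zero one_sub_X_sq_ne_zero (interiorPoly_monic hp).ne_zero)

lemma mem_gllNodes (hp : 1 < p) {t : ℝ} :
    t ∈ gllNodes p ↔ (t = 1 ∨ t = -1) ∨ (interiorPoly p).IsRoot t := by
  have hc : (derivative (legendre p)).leadingCoeff ≠ 0 :=
    leadingCoeff_ne_zero.2 (derivative_legendre_ne_zero hp)
  rw [gllNodes, Multiset.mem_toFinset, mem_roots (gllPoly_ne_zero hp), gllPoly_eq hp]
  simp only [IsRoot.def, eval_mul, eval_C, mul_eq_zero, hc, false_or, eval_sub, eval_one, eval_pow,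
    eval_X]
  rw [sub_eq_zero, eq_comm, sq, mul_self_eq_one_iff]

lemma one_mem_gllNodes (hp : 1 < p) : (1 : ℝ) ∈ gllNodes p := (mem_gllNodes hp).2 (Or.inl (Or.inl rfl))

lemma neg_one_mem_gllNodes (hp : 1 < p) : (-1 : ℝ) ∈ gllNodes p :=
  (mem_gllNodes hp).2 (Or.inl (Or.inr rfl))

lemma gllNodes_subset_Icc (hp : 1 < p) {t : ℝ} (ht : t ∈ gllNodes p) :
    t ∈ Set.Icc (-1 : ℝ) 1 := by
  rcases (mem_gllNodes hp).1 ht with (rfl | rfl) | h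
  · norm_num
  · norm_num
  · exact Set.Ioo_subset_Icc_self (interiorPoly_root_mem hp h)

lemma card_gllNodes (hp : 1 < p) : (gllNodes p).card = p + 1 := by
  have hm := (interiorPoly_monic hp).ne_zero
  have e : gllNodes p = insert 1 (insert (-1) (interiorPoly p).roots.toFinset) := by
    ext t
    rw [mem_gllNodes hp]
    simp only [Finset.mem_insert, Multiset.mem_toFinset, mem_roots hm, or_assoc]
  have h1 : (-1 : ℝ) ∉ (interiorPoly p).roots.toFinset := by
    rw [Multiset.mem_toFinset, mem_roots hm]
    intro h
    exact lt_irrefl _ (interiorPoly_root_mem hp h).1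
  have h2 : (1 : ℝ) ∉ insert (-1) (interiorPoly p).roots.toFinset := by
    rw [Finset.mem_insert, not_or, Multiset.mem_toFinset, mem_roots hm]
    exact ⟨by norm_num, fun h => lt_irrefl _ (interiorPoly_root_mem hp h).2⟩
  rw [e, Finset.card_insert_of_notMem h2, Finset.card_insert_of_notMem h1,
    Multiset.toFinset_card_of_nodup (interiorPoly_nodup_roots hp), card_roots_interiorPoly hp]
  omega

lemma iterate_derivative_comp_neg (q : ℝ[X]) (hq : q.comp (-X) = q) (k : ℕ) :
    (derivative^[k] q).comp (-X) = (-1) ^ k * derivative^[k] q := by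
  induction k with
  | zero => simpa using hq
  | succ k ih =>
    have h := congrArg derivative ih
    rw [derivative_comp, derivative_mul] at h
    simp only [derivative_neg, derivative_X] at h
    rw [show ((-1 : ℝ[X]) ^ k) = C ((-1) ^ k) by simp, derivative_C] at h
    rw [Function.iterate_succ_apply', pow_succ, show ((-1 : ℝ[X]) ^ k) = C ((-1) ^ k) by simp]
    linear_combination -h

lemma neg_mem_gllNodes (hp : 1 < p) {t : ℝ} (ht : t ∈ gllNodes p) : -t ∈ gllNodes p := by
  have hq : ((X ^ 2 - 1 : ℝ[X]) ^ p).comp (-X) = (X ^ 2 - 1) ^ p := by simp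
  have h := iterate_derivative_comp_neg _ hq (p + 1)
  rw [gllNodes, Multiset.mem_toFinset, mem_roots (gllPoly_ne_zero hp)] at ht ⊢
  simp only [gllPoly, IsRoot.def, eval_mul, eval_sub, eval_one, eval_pow, eval_X, mul_eq_zero,
    even_two, Even.neg_pow] at ht ⊢
  refine ht.imp id fun h0 => ?_
  have := congrArg (eval t) h
  simpa only [eval_comp, eval_neg, eval_X, eval_mul, h0, mul_zero] using this

/-! ### Gauss–Legendre–Lobatto quadrature -/

/-- The weights of the Gauss–Legendre–Lobatto quadrature rule on `[-1,1]`. -/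
def gllWeight (p : ℕ) (t : ℝ) : ℝ := polyInt (Lagrange.basis (gllNodes p) id t)

/-- The value of the Gauss–Legendre–Lobatto quadrature rule. -/
def gllSum (p : ℕ) (q : ℝ[X]) : ℝ := ∑ t ∈ gllNodes p, gllWeight p t * q.eval t

lemma gllSum_eq_polyInt_of_natDegree_le (hp : 1 < p) {q : ℝ[X]} (hq : q.natDegree ≤ p) :
    gllSum p q = polyInt q := by
  have hd : q.degree < ((gllNodes p).card : ℕ) := by
    rw [card_gllNodes hp]
    exact lt_of_le_of_lt degree_le_natDegree (by exact_mod_cast Nat.lt_succ_of_le hq)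
  conv_rhs => rw [Lagrange.eq_interpolate (v := id) Function.injective_id.injOn hd,
    Lagrange.interpolate_apply, map_sum]
  refine Finset.sum_congr rfl fun t _ => ?_
  rw [polyInt_C_mul, gllWeight, mul_comm]
  rfl

/-- The Gauss–Legendre–Lobatto rule is exact up to the degree `2p - 1`. -/
lemma gllSum_eq_polyInt (hp : 1 < p) {q : ℝ[X]} (hq : q.natDegree < 2 * p) :
    gllSum p q = polyInt q := by
  set g : ℝ[X] := (1 - X ^ 2) * interiorPoly p with hg
  have hm := interiorPoly_monic hp
  have hgd : g.natDegree = p + 1 := by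
    rw [hg, natDegree_mul one_sub_X_sq_ne_zero hm.ne_zero, natDegree_interiorPoly hp]
    have : (1 - X ^ 2 : ℝ[X]).natDegree = 2 := by compute_degree!
    omega
  have hg0 : g ≠ 0 := by intro h; rw [h] at hgd; simp at hgd
  have hdm := EuclideanDomain.div_add_mod q g
  have hr : (q % g).natDegree < p + 1 := hgd ▸ natDegree_mod_lt q (by omega)
  have hs : (q / g).natDegree + 1 < p := by
    rcases eq_or_ne (q / g) 0 with h0 | h0
    · rw [h0, natDegree_zero]; omega
    · have h1 := natDegree_mul hg0 h0
      have h2 : g * (q / g) = q - q % g := eq_sub_of_add_eq hdm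
      have h3 : (q - q % g).natDegree ≤ 2 * p - 1 :=
        (natDegree_sub_le _ _).trans (max_le (by omega) (by omega))
      rw [← h2] at h3
      omega
  have hz : ∀ t ∈ gllNodes p, g.eval t = 0 := by
    intro t ht
    rw [hg, eval_mul]
    rcases (mem_gllNodes hp).1 ht with (rfl | rfl) | h
    · simp
    · simp
    · rw [h.eq_zero, mul_zero]
  have h1 : gllSum p q = gllSum p (q % g) := by
    refine Finset.sum_congr rfl fun t ht => ?_
    conv_lhs => rw [← hdm, eval_add, eval_mul, hz t ht, zero_mul, zero_add]
  have h2 : polyInt q = polyInt (q % g) := by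
    conv_lhs => rw [← hdm, map_add, hg, polyInt_weight_interiorPoly_mul hs, zero_add]
  rw [h1, h2, gllSum_eq_polyInt_of_natDegree_le hp (by omega)]

lemma polyInt_weight_interiorPoly_sq_pos (hp : 1 < p) :
    0 < polyInt ((1 - X ^ 2) * interiorPoly p ^ 2) := by
  refine polyInt_pos _ (fun x hx => ?_) (mul_ne_zero one_sub_X_sq_ne_zero
    (pow_ne_zero 2 (interiorPoly_monic hp).ne_zero))
  have := one_sub_sq_nonneg hx
  simp only [eval_mul, eval_sub, eval_one, eval_pow, eval_X]
  positivity

/-- The quadrature error for a square is carried by its leading coefficient. -/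
lemma gllSum_sq (hp : 1 < p) {q : ℝ[X]} (hq : q.natDegree ≤ p) :
    gllSum p (q ^ 2) =
      polyInt (q ^ 2) + q.coeff p ^ 2 * polyInt ((1 - X ^ 2) * interiorPoly p ^ 2) := by
  set m := interiorPoly p
  have hm : m.Monic := interiorPoly_monic hp
  have hmd : m.natDegree = p - 1 := natDegree_interiorPoly hp
  -- the square of `q` minus a polynomial of degree `2p` that vanishes at all nodes
  set r : ℝ[X] := q ^ 2 - C (q.coeff p ^ 2) * ((X ^ 2 - 1) * m ^ 2) with hr
  have hM : ((X ^ 2 - 1 : ℝ[X]) * m ^ 2).Monic := monic_X_sq_sub_one.mul (hm.pow 2)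
  have hMd : ((X ^ 2 - 1 : ℝ[X]) * m ^ 2).natDegree = 2 * p := by
    rw [monic_X_sq_sub_one.natDegree_mul (hm.pow 2), natDegree_X_sq_sub_one, hm.natDegree_pow, hmd]
    omega
  have hrd : r.natDegree < 2 * p := by
    refine natDegree_lt_of_coeff_eq_zero (by omega) ?_ ?_
    · refine (natDegree_sub_le _ _).trans (max_le ?_ ?_)
      · exact natDegree_pow_le.trans (Nat.mul_le_mul le_rfl hq)
      · exact (natDegree_C_mul_le _ _).trans hMd.le
    · have h1 : (q ^ 2).coeff (2 * p) = q.coeff p ^ 2 := coeff_pow_of_natDegree_le hq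
      have h2 : ((X ^ 2 - 1 : ℝ[X]) * m ^ 2).coeff (2 * p) = 1 := hMd ▸ hM.coeff_natDegree
      rw [hr, coeff_sub, coeff_C_mul, h1, h2]; ring
  have h1 : gllSum p (q ^ 2) = gllSum p r := by
    refine Finset.sum_congr rfl fun t ht => ?_
    have : ((X ^ 2 - 1 : ℝ[X]) * m ^ 2).eval t = 0 := by
      rcases (mem_gllNodes hp).1 ht with (rfl | rfl) | h
      · simp
      · simp
      · rw [eval_mul, eval_pow, h.eq_zero]; simp
    rw [hr, eval_sub, eval_mul, this]; ring
  have h2 : (X ^ 2 - 1) * m ^ 2 = -((1 - X ^ 2) * m ^ 2) := by ring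
  rw [h1, gllSum_eq_polyInt hp hrd, hr, map_sub, polyInt_C_mul, h2, map_neg]
  ring

/-- The quadrature overestimates the integral of a square. -/
lemma polyInt_sq_le_gllSum (hp : 1 < p) {q : ℝ[X]} (hq : q.natDegree ≤ p) :
    polyInt (q ^ 2) ≤ gllSum p (q ^ 2) := by
  rw [gllSum_sq hp hq]
  have := polyInt_weight_interiorPoly_sq_pos hp
  nlinarith [sq_nonneg (q.coeff p)]

/-- The overestimate is at most by a factor `3`, uniformly in the degree. With `m` the monic
multiple of `L_p'`, the leading coefficient of `q` is read off from `∫ (1 - x²) m q'`, that is, from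
`∫ ((1 - x²) m)' q`, and the Cauchy–Schwarz inequality applies. -/
lemma gllSum_sq_le (hp : 1 < p) {q : ℝ[X]} (hq : q.natDegree ≤ p) :
    gllSum p (q ^ 2) ≤ 3 * polyInt (q ^ 2) := by
  set m := interiorPoly p with hmdef
  have hm : m.Monic := interiorPoly_monic hp
  have hmd : m.natDegree = p - 1 := natDegree_interiorPoly hp
  have hK := polyInt_weight_interiorPoly_sq_pos hp
  rw [gllSum_sq hp hq]
  set K := polyInt ((1 - X ^ 2) * m ^ 2) with hKdef
  have hp0 : (0 : ℝ) < p := by exact_mod_cast (by omega : 0 < p)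
  have horth : ∀ (r : ℝ[X]), r.natDegree ≤ p - 1 →
      polyInt ((1 - X ^ 2) * m * r) = r.coeff (p - 1) * K := by
    intro r hr
    have hmc : m.coeff (p - 1) = 1 := hmd ▸ hm.coeff_natDegree
    have hd : (r - C (r.coeff (p - 1)) * m).natDegree < p - 1 := by
      refine natDegree_lt_of_coeff_eq_zero (by omega) ?_ ?_
      · exact (natDegree_sub_le _ _).trans
          (max_le hr ((natDegree_C_mul_le _ _).trans hmd.le))
      · rw [coeff_sub, coeff_C_mul, hmc]; ring
    have h0 := polyInt_weight_interiorPoly_mul (s := r - C (r.coeff (p - 1)) * m)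
      (p := p) (by omega)
    have e : (1 - X ^ 2) * m * r = (1 - X ^ 2) * m * (r - C (r.coeff (p - 1)) * m) +
        C (r.coeff (p - 1)) * ((1 - X ^ 2) * m ^ 2) := by ring
    rw [e, map_add, h0, polyInt_C_mul, zero_add]
  -- `G = (1 - x²) m` vanishes at the end points, so derivatives can be moved off it
  set G : ℝ[X] := (1 - X ^ 2) * m with hG
  set u := derivative G with hu
  have hGd : G.natDegree ≤ p + 1 := by
    refine natDegree_mul_le.trans ?_
    have : (1 - X ^ 2 : ℝ[X]).natDegree ≤ 2 := by compute_degree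
    omega
  have hGc : G.coeff (p + 1) = -1 := by
    have : G = -((X ^ 2 - 1) * m) := by rw [hG]; ring
    rw [this, coeff_neg]
    have h1 : ((X ^ 2 - 1 : ℝ[X]) * m).natDegree = p + 1 := by
      rw [monic_X_sq_sub_one.natDegree_mul hm, natDegree_X_sq_sub_one, hmd]; omega
    rw [← h1, (monic_X_sq_sub_one.mul hm).coeff_natDegree]
  have hcast : ((p - 1 : ℕ) : ℝ) + 1 = p := by
    rw [Nat.cast_sub hp.le]; push_cast; ring
  have hpp : p - 1 + 1 = p := by omega
  have hq' : polyInt (G * derivative q) = q.coeff p * p * K := by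
    rw [horth _ (by rw [natDegree_derivative]; omega), coeff_derivative, hpp, hcast]
  have hGu : polyInt (u ^ 2) = p * (p + 1) * K := by
    have h1 : polyInt (u * u) = -polyInt (G * derivative u) := by
      rw [hu, polyInt_parts _ _ (by simp [hG]) (by simp [hG])]
    rw [sq, h1, horth _ (by rw [natDegree_derivative, hu, natDegree_derivative]; omega),
      coeff_derivative, hpp, hcast, hu, coeff_derivative, hGc]
    ring
  have hCS := polyInt_mul_sq_le q u
  have hparts : polyInt (q * u) = -polyInt (G * derivative q) := by
    rw [mul_comm, hu, polyInt_parts _ _ (by simp [hG]) (by simp [hG])]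
  rw [hparts, hq', hGu] at hCS
  have hI := polyInt_sq_nonneg q
  have h1 : q.coeff p ^ 2 * (p ^ 2 * K) ≤ polyInt (q ^ 2) * (p * (p + 1)) := by
    have : (q.coeff p ^ 2 * (p ^ 2 * K)) * K ≤ (polyInt (q ^ 2) * (p * (p + 1))) * K := by
      linarith
    exact le_of_mul_le_mul_right this hK
  have h2 : q.coeff p ^ 2 * K * (p ^ 2 : ℝ) ≤ 2 * polyInt (q ^ 2) * (p ^ 2 : ℝ) := by
    have hp1 : (1 : ℝ) ≤ p := by exact_mod_cast hp.le
    nlinarith [mul_nonneg hI (mul_nonneg hp0.le (sub_nonneg.2 hp1))]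
  have h3 := le_of_mul_le_mul_right h2 (by positivity)
  linarith

lemma eval_one_interiorPoly_ne_zero (hp : 1 < p) : (interiorPoly p).eval 1 ≠ 0 := fun h =>
  lt_irrefl _ (interiorPoly_root_mem hp h).2

/-- The differential equation of the interior node polynomial. -/
lemma derivative_derivative_interiorPoly (hp : 1 < p) :
    derivative (derivative ((1 - X ^ 2) * interiorPoly p)) =
      C (-((p : ℝ) * (p + 1))) * interiorPoly p := by
  set m := interiorPoly p with hmdef
  have hm : m.Monic := interiorPoly_monic hp
  have hmd : m.natDegree = p - 1 := natDegree_interiorPoly hp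
  set G : ℝ[X] := (1 - X ^ 2) * m with hG
  have hGd : G.natDegree ≤ p + 1 := by
    refine natDegree_mul_le.trans ?_
    have : (1 - X ^ 2 : ℝ[X]).natDegree ≤ 2 := by compute_degree
    omega
  have hGc : G.coeff (p + 1) = -1 := by
    have : G = -((X ^ 2 - 1) * m) := by rw [hG]; ring
    rw [this, coeff_neg]
    have h1 : ((X ^ 2 - 1 : ℝ[X]) * m).natDegree = p + 1 := by
      rw [monic_X_sq_sub_one.natDegree_mul hm, natDegree_X_sq_sub_one, hmd]; omega
    rw [← h1, (monic_X_sq_sub_one.mul hm).coeff_natDegree]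
  have hcast : ((p - 1 : ℕ) : ℝ) + 1 = p := by
    rw [Nat.cast_sub hp.le]; push_cast; ring
  have hpp : p - 1 + 1 = p := by omega
  have hmc : m.coeff (p - 1) = 1 := hmd ▸ hm.coeff_natDegree
  set r : ℝ[X] := derivative (derivative G) + C ((p : ℝ) * (p + 1)) * m with hr
  have hrd : r.natDegree < p - 1 := by
    refine natDegree_lt_of_coeff_eq_zero (by omega) ?_ ?_
    · refine (natDegree_add_le _ _).trans (max_le ?_ ((natDegree_C_mul_le _ _).trans hmd.le))
      rw [natDegree_derivative, natDegree_derivative]; omega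
    · rw [hr, coeff_add, coeff_C_mul, hmc, coeff_derivative, hpp, coeff_derivative, hGc, hcast]
      ring
  -- `r` has lower degree and is orthogonal to itself
  have h0 : polyInt ((1 - X ^ 2) * r ^ 2) = 0 := by
    have e : (1 - X ^ 2) * r ^ 2 = derivative (derivative G) * ((1 - X ^ 2) * r) +
        C ((p : ℝ) * (p + 1)) * ((1 - X ^ 2) * m * r) := by
      rw [sq]; nth_rewrite 1 [hr]; ring
    have h2 : (derivative (derivative ((1 - X ^ 2) * r))).natDegree + 1 < p := by
      have h3 : (1 - X ^ 2 : ℝ[X]).natDegree ≤ 2 := by compute_degree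
      have h4 := natDegree_mul_le (p := (1 - X ^ 2 : ℝ[X])) (q := r)
      rw [natDegree_derivative, natDegree_derivative]; omega
    rw [e, map_add, polyInt_C_mul, polyInt_weight_interiorPoly_mul (by omega),
      polyInt_parts _ _ (by simp) (by simp), polyInt_parts _ _ (by simp [hG]) (by simp [hG]), hG,
      polyInt_weight_interiorPoly_mul h2]
    simp
  have hr0 : r = 0 := by
    by_contra hne
    refine (polyInt_pos _ (fun x hx => ?_) (mul_ne_zero one_sub_X_sq_ne_zero
      (pow_ne_zero 2 hne))).ne' h0
    have := one_sub_sq_nonneg hx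
    simp only [eval_mul, eval_sub, eval_one, eval_pow, eval_X]
    positivity
  rw [map_neg, neg_mul]
  exact eq_neg_of_add_eq_zero_left hr0

/-- A weight is the quadrature of the square of its Lagrange polynomial, which is at least the
integral of that square. -/
lemma gllWeight_pos (hp : 1 < p) {t : ℝ} (ht : t ∈ gllNodes p) : 0 < gllWeight p t := by
  have hd : (Lagrange.basis (gllNodes p) id t).natDegree ≤ p := by
    have := Lagrange.degree_basis (v := id) Function.injective_id.injOn ht
    rw [card_gllNodes hp] at this
    exact natDegree_le_of_degree_le this.le
  have h1 := polyInt_sq_le_gllSum hp hd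
  have h2 : gllSum p (Lagrange.basis (gllNodes p) id t ^ 2) = gllWeight p t := by
    rw [gllSum, Finset.sum_eq_single t]
    · have : eval t (Lagrange.basis (gllNodes p) id t) = 1 :=
        Lagrange.eval_basis_self (v := id) Function.injective_id.injOn ht
      rw [eval_pow, this]; ring
    · intro s hs hst
      have : eval s (Lagrange.basis (gllNodes p) id t) = 0 :=
        Lagrange.eval_basis_of_ne (v := id) hst.symm hs
      rw [eval_pow, this]; ring
    · exact fun h => absurd ht h
  have hne : Lagrange.basis (gllNodes p) id t ≠ 0 :=
    Lagrange.basis_ne_zero Function.injective_id.injOn ht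
  rw [h2] at h1
  refine lt_of_lt_of_le (polyInt_pos _ (fun x _ => ?_) (pow_ne_zero 2 hne)) h1
  rw [eval_pow]; positivity

lemma gllWeight_neg (hp : 1 < p) {t : ℝ} (ht : t ∈ gllNodes p) :
    gllWeight p (-t) = gllWeight p t := by
  have ht' := neg_mem_gllNodes hp ht
  have hd : ((Lagrange.basis (gllNodes p) id t).comp (-X)).natDegree ≤ p := by
    rw [natDegree_comp, natDegree_neg, natDegree_X, mul_one]
    have := Lagrange.degree_basis (v := id) Function.injective_id.injOn ht
    rw [card_gllNodes hp] at this
    exact natDegree_le_of_degree_le this.le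
  have h := gllSum_eq_polyInt_of_natDegree_le hp hd
  rw [polyInt_comp_neg, gllSum, Finset.sum_eq_single (-t)] at h
  · have : eval t (Lagrange.basis (gllNodes p) id t) = 1 :=
      Lagrange.eval_basis_self (v := id) Function.injective_id.injOn ht
    rw [eval_comp, eval_neg, eval_X, neg_neg, this, mul_one] at h
    exact h
  · intro s hs hst
    have hs' := neg_mem_gllNodes hp hs
    have : eval (-s) (Lagrange.basis (gllNodes p) id t) = 0 :=
      Lagrange.eval_basis_of_ne (v := id) (fun he => hst (by rw [he, neg_neg])) hs'
    rw [eval_comp, eval_neg, eval_X, this, mul_zero]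
  · exact fun h => absurd ht' h

/-- The weights of the two end points. -/
lemma gllWeight_one (hp : 1 < p) : gllWeight p 1 = 2 / (p * (p + 1)) := by
  have hm1 := eval_one_interiorPoly_ne_zero hp
  have hode := derivative_derivative_interiorPoly hp
  set m := interiorPoly p with hmdef
  have hmd : m.natDegree = p - 1 := natDegree_interiorPoly hp
  have hp0 : (0 : ℝ) < p := by exact_mod_cast (by omega : 0 < p)
  have h1 : gllSum p ((1 + X) * m) = gllWeight p 1 * (2 * m.eval 1) := by
    rw [gllSum, Finset.sum_eq_single 1]
    · simp; norm_num
    · intro t ht h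
      rcases (mem_gllNodes hp).1 ht with (rfl | rfl) | h'
      · exact absurd rfl h
      · simp
      · rw [eval_mul, h'.eq_zero]; simp
    · exact fun h => absurd (one_mem_gllNodes hp) h
  have hd : ((1 + X) * m).natDegree ≤ p := by
    refine natDegree_mul_le.trans ?_
    have : (1 + X : ℝ[X]).natDegree ≤ 1 := by compute_degree
    omega
  rw [gllSum_eq_polyInt_of_natDegree_le hp hd] at h1
  have h2 := polyInt_derivative ((1 + X) * derivative ((1 - X ^ 2) * m))
  rw [derivative_mul, hode, map_add,
    show (1 + X) * (C (-((p : ℝ) * (p + 1))) * m) = C (-((p : ℝ) * (p + 1))) * ((1 + X) * m) by ring,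
    polyInt_C_mul, h1] at h2
  have h3 : polyInt (derivative (1 + X) * derivative ((1 - X ^ 2) * m)) = 0 := by
    rw [show derivative (1 + X : ℝ[X]) = 1 by simp, one_mul, polyInt_derivative]; simp
  rw [h3] at h2
  simp only [derivative_mul, eval_mul, eval_add, eval_one, eval_X] at h2
  simp at h2
  have h4 : (gllWeight p 1 * (p * (p + 1)) - 2) * (2 * m.eval 1) = 0 := by linarith
  have h5 := (mul_eq_zero.1 h4).resolve_right (by simpa using hm1)
  rw [eq_div_iff (by positivity)]
  linarith

/-! ### Inverse inequalities on `[-1,1]` -/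

/-- The inverse trace inequality in one variable: the weight of the node `1` is of order `p⁻²`. -/
lemma eval_one_sq_le (hp : 1 < p) {q : ℝ[X]} (hq : q.natDegree ≤ p) :
    q.eval 1 ^ 2 ≤ 3 * p ^ 2 * polyInt (q ^ 2) := by
  have h1 : gllWeight p 1 * q.eval 1 ^ 2 ≤ gllSum p (q ^ 2) := by
    have := Finset.single_le_sum (f := fun t => gllWeight p t * (q ^ 2).eval t)
      (fun t ht => mul_nonneg (gllWeight_pos hp ht).le (by rw [eval_pow]; positivity))
      (one_mem_gllNodes hp)
    simpa [gllSum] using this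
  have h2 := gllSum_sq_le hp hq
  have hp1 : (1 : ℝ) < p := by exact_mod_cast hp
  rw [gllWeight_one hp] at h1
  have h3 : 2 / ((p : ℝ) * (p + 1)) * q.eval 1 ^ 2 ≤ 3 * polyInt (q ^ 2) := h1.trans h2
  rw [div_mul_eq_mul_div, div_le_iff₀ (by positivity)] at h3
  have hI := polyInt_sq_nonneg q
  nlinarith [mul_nonneg hI (mul_nonneg (by linarith : (0:ℝ) ≤ p) (by linarith : (0:ℝ) ≤ p - 1))]

/-- A bound for the value of a polynomial in `[-1,1]` by its `L²` norm. -/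
lemma eval_sq_le (hp : 1 < p) {q : ℝ[X]} (hq : q.natDegree ≤ p) {x : ℝ}
    (hx : x ∈ Set.Icc (-1 : ℝ) 1) : q.eval x ^ 2 ≤ 6 * p ^ 2 * polyInt (q ^ 2) := by
  -- by reflection it suffices to treat `0 ≤ x`, where `[-1,x]` has length at least one
  wlog h0 : 0 ≤ x generalizing q x
  · have := this (q := q.comp (-X)) (by rwa [natDegree_comp, natDegree_neg, natDegree_X, mul_one])
      (x := -x) ⟨by linarith [hx.2], by linarith [hx.1]⟩ (by linarith)
    rw [show q.comp (-X) ^ 2 = (q ^ 2).comp (-X) by simp, polyInt_comp_neg] at this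
    simpa using this
  set c := (x + 1) / 2 with hc
  have hc0 : 0 < c := by rw [hc]; linarith
  set r := q.comp (C c * X + C (x - c)) with hr
  have hrd : r.natDegree ≤ p := by
    rw [hr, natDegree_comp]
    have : (C c * X + C (x - c)).natDegree ≤ 1 := by compute_degree
    nlinarith
  have h1 := eval_one_sq_le hp hrd
  have h2 : r.eval 1 = q.eval x := by simp [hr]
  have h3 : polyInt (r ^ 2) = c⁻¹ * ∫ y in (-1 : ℝ)..x, (q ^ 2).eval y := by
    rw [polyInt_apply]
    have : ∀ y, (r ^ 2).eval y = (fun z => (q ^ 2).eval z) (c * y + (x - c)) := by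
      intro y; simp [hr]
    simp only [this]
    rw [intervalIntegral.integral_comp_mul_add (fun z => (q ^ 2).eval z) hc0.ne']
    rw [show c * -1 + (x - c) = -1 by rw [hc]; ring, show c * 1 + (x - c) = x by ring, smul_eq_mul]
  have h4 : ∫ y in (-1 : ℝ)..x, (q ^ 2).eval y ≤ polyInt (q ^ 2) := by
    have h5 := intervalIntegral.integral_add_adjacent_intervals
      ((q ^ 2).continuous.intervalIntegrable (μ := volume) (-1) x)
      ((q ^ 2).continuous.intervalIntegrable x 1)
    have h6 : 0 ≤ ∫ y in x..1, (q ^ 2).eval y :=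
      intervalIntegral.integral_nonneg hx.2 fun y _ => by rw [eval_pow]; positivity
    rw [polyInt_apply]; linarith
  have h7 : c⁻¹ ≤ 2 := by
    rw [inv_le_comm₀ hc0 two_pos]; rw [hc]; linarith
  have h8 : polyInt (r ^ 2) ≤ 2 * polyInt (q ^ 2) := by
    rw [h3]
    exact mul_le_mul h7 h4 (intervalIntegral.integral_nonneg hx.1 fun y _ => by
      rw [eval_pow]; positivity) (by norm_num)
  rw [h2] at h1
  nlinarith [sq_nonneg (p : ℝ)]

/-- The weight `1 - x²` costs a factor `p²` on polynomials of degree `p`. -/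
lemma polyInt_sq_le_weighted (hp : 1 < p) {q : ℝ[X]} (hq : q.natDegree ≤ p) :
    polyInt (q ^ 2) ≤ 48 * p ^ 2 * polyInt ((1 - X ^ 2) * q ^ 2) := by
  have hp1 : (1 : ℝ) < p := by exact_mod_cast hp
  have hI := polyInt_sq_nonneg q
  -- by the pointwise bound, the end intervals of length `δ` carry at most half of the integral
  set S := 6 * (p : ℝ) ^ 2 * polyInt (q ^ 2) with hS
  set δ : ℝ := 1 / (24 * p ^ 2) with hδ
  have hδ0 : 0 < δ := by positivity
  have hδ1 : δ < 1 := by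
    rw [hδ, div_lt_one (by positivity)]; nlinarith
  have hint : ∀ (r : ℝ[X]) (a b : ℝ), IntervalIntegrable (fun x => r.eval x) volume a b :=
    fun r a b => r.continuous.intervalIntegrable a b
  have hsplit : ∀ r : ℝ[X], polyInt r = (∫ x in (-1 : ℝ)..(-1 + δ), r.eval x) +
      (∫ x in (-1 + δ)..(1 - δ), r.eval x) + ∫ x in (1 - δ)..1, r.eval x := by
    intro r
    rw [polyInt_apply, intervalIntegral.integral_add_adjacent_intervals (hint _ _ _) (hint _ _ _),
      intervalIntegral.integral_add_adjacent_intervals (hint _ _ _) (hint _ _ _)]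
  have hend : ∀ a b : ℝ, -1 ≤ a → b ≤ 1 → a ≤ b → b - a = δ →
      ∫ x in a..b, (q ^ 2).eval x ≤ δ * S := by
    intro a b ha hb hab hd
    calc ∫ x in a..b, (q ^ 2).eval x ≤ ∫ _ in a..b, S := by
          refine intervalIntegral.integral_mono_on hab (hint _ _ _) (by simp) fun x hx => ?_
          rw [eval_pow]
          exact eval_sq_le hp hq ⟨ha.trans hx.1, hx.2.trans hb⟩
      _ = δ * S := by simp [hd]
  have h1 := hend (-1) (-1 + δ) le_rfl (by linarith) (by linarith) (by ring)
  have h2 := hend (1 - δ) 1 (by linarith) le_rfl (by linarith) (by ring)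
  have hw : ∀ a b : ℝ, -1 ≤ a → b ≤ 1 → a ≤ b →
      0 ≤ ∫ x in a..b, ((1 - X ^ 2) * q ^ 2).eval x := by
    intro a b ha hb hab
    refine intervalIntegral.integral_nonneg hab fun x hx => ?_
    have := one_sub_sq_nonneg (x := x) ⟨ha.trans hx.1, hx.2.trans hb⟩
    simp only [eval_mul, eval_sub, eval_one, eval_pow, eval_X]
    positivity
  have h3 : δ * ∫ x in (-1 + δ)..(1 - δ), (q ^ 2).eval x ≤
      ∫ x in (-1 + δ)..(1 - δ), ((1 - X ^ 2) * q ^ 2).eval x := by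
    rw [← intervalIntegral.integral_const_mul]
    have hle : -1 + δ ≤ 1 - δ := by
      have : δ ≤ 1 := hδ1.le
      linarith
    refine intervalIntegral.integral_mono_on hle
      ((hint _ _ _).const_mul δ) (hint _ _ _) fun x hx => ?_
    simp only [eval_mul, eval_sub, eval_one, eval_pow, eval_X]
    refine mul_le_mul_of_nonneg_right ?_ (sq_nonneg _)
    nlinarith [hx.1, hx.2]
  have h4 : polyInt (q ^ 2) ≤ 2 * δ * S +
      ∫ x in (-1 + δ)..(1 - δ), (q ^ 2).eval x := by rw [hsplit]; linarith
  have h5 : ∫ x in (-1 + δ)..(1 - δ), ((1 - X ^ 2) * q ^ 2).eval x ≤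
      polyInt ((1 - X ^ 2) * q ^ 2) := by
    rw [hsplit]
    linarith [hw (-1) (-1 + δ) le_rfl (by linarith) (by linarith),
      hw (1 - δ) 1 (by linarith) le_rfl (by linarith)]
  have h6 : 2 * δ * S = polyInt (q ^ 2) / 2 := by
    rw [hδ, hS]; field_simp; ring
  have h7 : ∫ x in (-1 + δ)..(1 - δ), (q ^ 2).eval x ≤
      24 * p ^ 2 * polyInt ((1 - X ^ 2) * q ^ 2) := by
    have h8 := h3.trans h5
    rw [hδ, div_mul_eq_mul_div, one_mul, div_le_iff₀ (by positivity)] at h8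
    linarith
  linarith

/-- A weighted inverse inequality. The Legendre polynomials are orthogonal for both forms, as
eigenfunctions of `q ↦ -((1 - x²) q')'` with the eigenvalues `n (n + 1)`; the induction splits them
off one at a time. -/
lemma polyInt_weighted_derivative_le (k : ℕ) {q : ℝ[X]} (hq : q.natDegree ≤ k) :
    polyInt ((1 - X ^ 2) * derivative q ^ 2) ≤ k * (k + 1) * polyInt (q ^ 2) := by
  induction k generalizing q with
  | zero =>
    rw [derivative_of_natDegree_zero (by omega)]
    simp
  | succ k ih =>
    set n := k + 1 with hn
    set L := legendre n with hL
    have hLd : L.natDegree = n := natDegree_legendre n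
    have hLc : L.coeff n ≠ 0 := by
      rw [← hLd]
      exact leadingCoeff_ne_zero.2 (legendre_ne_zero n)
    set a := q.coeff n / L.coeff n with ha
    set r := q - C a * L with hr
    have hrd : r.natDegree < n := by
      refine natDegree_lt_of_coeff_eq_zero (by omega) ?_ ?_
      · exact (natDegree_sub_le _ _).trans
          (max_le hq ((natDegree_C_mul_le _ _).trans hLd.le))
      · rw [hr, coeff_sub, coeff_C_mul, ha, div_mul_cancel₀ _ hLc, sub_self]
    have hqe : q = C a * L + r := by rw [hr]; ring
    have hw2 : (1 - X ^ 2 : ℝ[X]).natDegree ≤ 2 := by compute_degree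
    -- orthogonality in the energy product
    have hpart : ∀ s : ℝ[X], polyInt ((1 - X ^ 2) * derivative L * derivative s) =
        -polyInt (L * derivative ((1 - X ^ 2) * derivative s)) := by
      intro s
      rw [show (1 - X ^ 2) * derivative L * derivative s =
        derivative L * ((1 - X ^ 2) * derivative s) by ring,
        polyInt_parts _ _ (by simp) (by simp)]
    have hcross : polyInt ((1 - X ^ 2) * derivative L * derivative r) = 0 := by
      rw [hpart, polyInt_legendre_mul, neg_zero]
      by_cases hr0 : r.natDegree = 0
      · rw [derivative_of_natDegree_zero hr0]; simp; omega
      have := natDegree_mul_le (p := (1 - X ^ 2 : ℝ[X])) (q := derivative r)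
      rw [natDegree_derivative] at this ⊢
      omega
    -- `L` is an eigenfunction up to a polynomial `s` of lower degree, which is orthogonal to `L`
    have hdiag : polyInt ((1 - X ^ 2) * derivative L * derivative L) =
        n * (n + 1) * polyInt (L ^ 2) := by
      set s := derivative ((1 - X ^ 2) * derivative L) + C ((n : ℝ) * (n + 1)) * L with hs
      have hsd : s.natDegree < n := by
        refine natDegree_lt_of_coeff_eq_zero (by omega) ?_ ?_
        · refine (natDegree_add_le _ _).trans (max_le ?_ ((natDegree_C_mul_le _ _).trans hLd.le))
          have := natDegree_mul_le (p := (1 - X ^ 2 : ℝ[X])) (q := derivative L)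
          rw [natDegree_derivative] at this ⊢
          omega
        · rw [hs, coeff_add, coeff_C_mul, coeff_derivative,
            show (1 - X ^ 2 : ℝ[X]) * derivative L = derivative L - derivative L * X ^ 2 by ring,
            coeff_sub, hn, show k + 1 + 1 = k + 2 by ring, coeff_mul_X_pow, ← hn,
            coeff_eq_zero_of_natDegree_lt (by rw [natDegree_derivative]; omega),
            coeff_derivative, ← hn, hn]
          push_cast; ring
      rw [hpart, show derivative ((1 - X ^ 2) * derivative L) = s - C ((n : ℝ) * (n + 1)) * L by
          rw [hs]; ring,
        show L * (s - C ((n : ℝ) * (n + 1)) * L) = L * s - C ((n : ℝ) * (n + 1)) * L ^ 2 by ring,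
        map_sub, polyInt_C_mul, polyInt_legendre_mul hsd]
      ring
    have hLr : polyInt (L * r) = 0 := polyInt_legendre_mul hrd
    have e1 : (1 - X ^ 2) * derivative q ^ 2 =
        C (a ^ 2) * ((1 - X ^ 2) * derivative L * derivative L) +
        C (2 * a) * ((1 - X ^ 2) * derivative L * derivative r) +
        (1 - X ^ 2) * derivative r ^ 2 := by
      rw [hqe, derivative_add, derivative_C_mul]; simp only [map_pow, map_mul, map_ofNat]; ring
    have e2 : q ^ 2 = C (a ^ 2) * L ^ 2 + C (2 * a) * (L * r) + r ^ 2 := by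
      rw [hqe]; simp only [map_pow, map_mul, map_ofNat]; ring
    have h1 := ih (q := r) (by omega)
    have h2 := polyInt_sq_nonneg r
    rw [e1, e2, map_add, map_add, map_add, map_add, polyInt_C_mul, polyInt_C_mul, polyInt_C_mul,
      polyInt_C_mul, hcross, hdiag, hLr]
    have h3 : (k : ℝ) * (k + 1) ≤ n * (n + 1) := by rw [hn]; push_cast; nlinarith
    nlinarith [mul_le_mul_of_nonneg_right h3 h2]

/-- The inverse inequality in one variable. -/
lemma polyInt_derivative_sq_le (hp : 1 < p) {q : ℝ[X]} (hq : q.natDegree ≤ p) :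
    polyInt (derivative q ^ 2) ≤ 96 * p ^ 4 * polyInt (q ^ 2) := by
  have hp1 : (1 : ℝ) < p := by exact_mod_cast hp
  have h1 := polyInt_sq_le_weighted hp (q := derivative q)
    (by rw [natDegree_derivative]; omega)
  have h2 := polyInt_weighted_derivative_le p hq
  have h3 := polyInt_sq_nonneg q
  have h4 : (p : ℝ) * (p + 1) * polyInt (q ^ 2) ≤ 2 * p ^ 2 * polyInt (q ^ 2) :=
    mul_le_mul_of_nonneg_right (by nlinarith) h3
  have h5 := mul_le_mul_of_nonneg_left (h2.trans h4) (by positivity : (0 : ℝ) ≤ 48 * p ^ 2)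
  linarith

variable {d : ℕ}

/-! ### Polynomials in several variables and their nodal values -/

lemma continuous_refQ {f : Pt d → ℝ} (hf : f ∈ refQ d p) : Continuous f := by
  induction hf using Submodule.span_induction with
  | mem f hf =>
    obtain ⟨m, rfl⟩ := hf
    fun_prop
  | zero => exact continuous_const
  | add f g _ _ hf hg => exact hf.add hg
  | smul c f _ hf => exact hf.const_smul c

lemma differentiable_refQ {f : Pt d → ℝ} (hf : f ∈ refQ d p) : Differentiable ℝ f := by
  induction hf using Submodule.span_induction with
  | mem f hf =>
    obtain ⟨m, rfl⟩ := hf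
    fun_prop
  | zero => exact differentiable_const 0
  | add f g _ _ hf hg => exact hf.add hg
  | smul c f _ hf => exact hf.const_smul c

/-- A polynomial of coordinate degree at most `p` is a polynomial of degree at most `p` in each
single variable. -/
lemma exists_polynomial_update {f : Pt d → ℝ} (hf : f ∈ refQ d p) (j : Fin d) (x : Fin d → ℝ) :
    ∃ q : ℝ[X], q.natDegree ≤ p ∧
      ∀ t, f (WithLp.toLp 2 (Function.update x j t)) = q.eval t := by
  induction hf using Submodule.span_induction with
  | mem f hf =>
    obtain ⟨m, rfl⟩ := hf
    refine ⟨C (∏ i ∈ Finset.univ.erase j, x i ^ (m i : ℕ)) * X ^ (m j : ℕ), ?_, fun t => ?_⟩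
    · exact (natDegree_C_mul_X_pow_le _ _).trans (Nat.lt_succ_iff.1 (m j).2)
    · beta_reduce
      rw [← Finset.mul_prod_erase _ _ (Finset.mem_univ j)]
      simp only [Function.update_self, eval_mul, eval_C, eval_pow, eval_X]
      rw [mul_comm]
      congr 1
      refine Finset.prod_congr rfl fun i hi => ?_
      rw [Function.update_of_ne (Finset.ne_of_mem_erase hi)]
  | zero => exact ⟨0, by simp, by simp⟩
  | add f g _ _ hf hg =>
    obtain ⟨q, hq, hq'⟩ := hf
    obtain ⟨r, hr, hr'⟩ := hg
    exact ⟨q + r, (natDegree_add_le _ _).trans (max_le hq hr), fun t => by simp [hq', hr']⟩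
  | smul c f _ hf =>
    obtain ⟨q, hq, hq'⟩ := hf
    exact ⟨C c * q, (natDegree_C_mul_le _ _).trans hq, fun t => by simp [hq']⟩

/-- The partial derivatives of a function in `ℚ^p` are in `ℚ^p`. -/
lemma exists_partialDeriv {f : Pt d → ℝ} (hf : f ∈ refQ d p) (j : Fin d) :
    ∃ g ∈ refQ d p, ∀ x : Fin d → ℝ,
      HasDerivAt (fun t => f (WithLp.toLp 2 (Function.update x j t))) (g (WithLp.toLp 2 x))
        (x j) := by
  induction hf using Submodule.span_induction with
  | mem f hf =>
    obtain ⟨m, rfl⟩ := hf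
    refine ⟨(m j : ℝ) • fun x => ∏ i, x i ^ (Function.update m j
      ⟨(m j : ℕ) - 1, by have := (m j).2; omega⟩ i : ℕ), Submodule.smul_mem _ _
        (Submodule.subset_span ⟨_, rfl⟩), fun x => ?_⟩
    have e : ∀ t, (∏ i, (WithLp.toLp 2 (Function.update x j t) : Pt d) i ^ (m i : ℕ)) =
        t ^ (m j : ℕ) * ∏ i ∈ Finset.univ.erase j, x i ^ (m i : ℕ) := by
      intro t
      rw [← Finset.mul_prod_erase _ _ (Finset.mem_univ j)]
      simp only [Function.update_self]
      congr 1
      refine Finset.prod_congr rfl fun i hi => ?_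
      rw [Function.update_of_ne (Finset.ne_of_mem_erase hi)]
    refine HasDerivAt.congr_deriv (f := fun t => _) (by
      simp only [e]
      exact (hasDerivAt_pow (m j : ℕ) (x j)).mul_const
        (∏ i ∈ Finset.univ.erase j, x i ^ (m i : ℕ))) ?_
    simp only [Pi.smul_apply, smul_eq_mul]
    rw [← Finset.mul_prod_erase _ _ (Finset.mem_univ j), Function.update_self, mul_assoc]
    congr 2
    refine Finset.prod_congr rfl fun i hi => ?_
    rw [Function.update_of_ne (Finset.ne_of_mem_erase hi)]
  | zero => exact ⟨0, Submodule.zero_mem _, fun x => hasDerivAt_const _ _⟩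
  | add f g _ _ hf hg =>
    obtain ⟨q, hq, hq'⟩ := hf
    obtain ⟨r, hr, hr'⟩ := hg
    exact ⟨q + r, Submodule.add_mem _ hq hr, fun x => (hq' x).add (hr' x)⟩
  | smul c f _ hf =>
    obtain ⟨q, hq, hq'⟩ := hf
    exact ⟨c • q, Submodule.smul_mem _ _ hq, fun x => (hq' x).const_smul c⟩

/-- Products of univariate polynomials of degree at most `p` are in `ℚ^p`. -/
lemma prod_eval_mem_refQ (q : Fin d → ℝ[X]) (hq : ∀ i, (q i).natDegree ≤ p) :
    (fun x : Pt d => ∏ i, (q i).eval (x i)) ∈ refQ d p := by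
  have e : (fun x : Pt d => ∏ i, (q i).eval (x i)) =
      ∑ m : Fin d → Fin (p + 1), (∏ i, (q i).coeff (m i)) •
        fun x : Pt d => ∏ i, x i ^ (m i : ℕ) := by
    funext x
    rw [Finset.sum_apply]
    have h : ∀ i, (q i).eval (x i) = ∑ k : Fin (p + 1), (q i).coeff k * x i ^ (k : ℕ) := by
      intro i
      rw [eval_eq_sum_range' (Nat.lt_succ_of_le (hq i)), Finset.sum_range]
    simp only [h, Finset.prod_univ_sum, Fintype.piFinset_univ, Pi.smul_apply, smul_eq_mul,
      Finset.prod_mul_distrib]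
  rw [e]
  exact Submodule.sum_mem _ fun m _ => Submodule.smul_mem _ _ (Submodule.subset_span ⟨m, rfl⟩)

lemma natDegree_lagrange_le (hp : 1 < p) {t : ℝ} (ht : t ∈ gllNodes p) :
    (Lagrange.basis (gllNodes p) id t).natDegree ≤ p := by
  have := Lagrange.degree_basis (v := id) Function.injective_id.injOn ht
  rw [card_gllNodes hp] at this
  exact natDegree_le_of_degree_le this.le

lemma refBasis_mem_refQ (hp : 1 < p) (a : NodeIdx d p) : refBasis a ∈ refQ d p :=
  prod_eval_mem_refQ _ fun i => natDegree_lagrange_le hp (a i).2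

lemma refBasis_refNode (a b : NodeIdx d p) :
    refBasis a (refNode b) = if a = b then 1 else 0 := by
  split_ifs with h
  · subst h
    refine Finset.prod_eq_one fun i _ => ?_
    exact Lagrange.eval_basis_self (v := id) Function.injective_id.injOn (a i).2
  · obtain ⟨i, hi⟩ := Function.ne_iff.1 h
    refine Finset.prod_eq_zero (Finset.mem_univ i) ?_
    exact Lagrange.eval_basis_of_ne (v := id) (fun h' => hi (Subtype.ext h')) (b i).2

/-- Interpolation at the tensor-product nodes reproduces the polynomials of coordinate degree
at most `p`. -/
lemma refQ_eq_sum_refBasis (hp : 1 < p) {f : Pt d → ℝ} (hf : f ∈ refQ d p) (x : Pt d) :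
    f x = ∑ a : NodeIdx d p, f (refNode a) * refBasis a x := by
  induction hf using Submodule.span_induction with
  | mem f hf =>
    obtain ⟨m, rfl⟩ := hf
    have h : ∀ i, x i ^ (m i : ℕ) = ∑ t : {t : ℝ // t ∈ gllNodes p},
        (t : ℝ) ^ (m i : ℕ) * (Lagrange.basis (gllNodes p) id (t : ℝ)).eval (x i) := by
      intro i
      have hd : (X ^ (m i : ℕ) : ℝ[X]).degree < ((gllNodes p).card : ℕ) := by
        rw [card_gllNodes hp, degree_X_pow]
        exact_mod_cast (m i).2
      have := congrArg (eval (x i))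
        (Lagrange.eq_interpolate (v := id) Function.injective_id.injOn hd)
      rw [Lagrange.interpolate_apply, eval_finsetSum] at this
      simp only [eval_pow, eval_X, eval_mul, eval_C, id] at this
      rw [this, ← Finset.sum_coe_sort (gllNodes p)]
    simp only [h, Finset.prod_univ_sum, Fintype.piFinset_univ, refBasis, refNode,
      Finset.prod_mul_distrib]
  | zero => simp
  | add f g _ _ hf hg => simp only [Pi.add_apply, add_mul, Finset.sum_add_distrib, ← hf, ← hg]
  | smul c f _ hf =>
    simp only [Pi.smul_apply, smul_eq_mul, mul_assoc, ← Finset.mul_sum, ← hf]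

/-- `ℚ^p` is invariant under signed permutations of the coordinates. -/
lemma refQ_comp_signedPerm {f : Pt d → ℝ} (hf : f ∈ refQ d p) (π : Equiv.Perm (Fin d))
    (ε : Fin d → ℝ) : (fun x : Pt d => f (WithLp.toLp 2 fun i => ε i * x (π i))) ∈ refQ d p := by
  induction hf using Submodule.span_induction with
  | mem f hf =>
    obtain ⟨m, rfl⟩ := hf
    have e : (fun x : Pt d => ∏ i, (WithLp.toLp 2 (fun i => ε i * x (π i)) : Pt d) i ^ (m i : ℕ)) =
        (∏ i, ε i ^ (m i : ℕ)) • fun x : Pt d => ∏ i, x i ^ (m (π.symm i) : ℕ) := by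
      funext x
      simp only [mul_pow, Finset.prod_mul_distrib, Pi.smul_apply, smul_eq_mul]
      congr 1
      exact Fintype.prod_equiv π _ _ fun i => by simp
    rw [e]
    exact Submodule.smul_mem _ _ (Submodule.subset_span ⟨fun i => m (π.symm i), rfl⟩)
  | zero => exact Submodule.zero_mem _
  | add f g _ _ hf hg => exact Submodule.add_mem _ hf hg
  | smul c f _ hf => exact Submodule.smul_mem _ _ hf

/-! ### Tensor products of one-dimensional measures -/

/-- Replacing one factor of a product measure. -/
lemma lintegral_pi_le_update (μ : Fin d → Measure ℝ) [∀ i, SigmaFinite (μ i)] (j : Fin d)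
    (ν : Fin d → Measure ℝ) [∀ i, SigmaFinite (ν i)] (hν : ∀ i, i ≠ j → ν i = μ i)
    {f g : (Fin d → ℝ) → ENNReal}
    (hf : Measurable f) (hg : Measurable g) (c : ENNReal) (hc : c ≠ ⊤)
    (h : ∀ x, ∫⁻ t, f (Function.update x j t) ∂μ j ≤
      c * ∫⁻ t, g (Function.update x j t) ∂ν j) :
    ∫⁻ x, f x ∂Measure.pi μ ≤ c * ∫⁻ x, g x ∂Measure.pi ν := by
  rw [lintegral_eq_lmarginal_univ (0 : Fin d → ℝ), lintegral_eq_lmarginal_univ (0 : Fin d → ℝ),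
    lmarginal_erase' f hf (Finset.mem_univ j), lmarginal_erase' g hg (Finset.mem_univ j)]
  have e : (fun i : {i // i ∈ Finset.univ.erase j} => ν i) =
      fun i : {i // i ∈ Finset.univ.erase j} => μ i := by
    funext i
    exact hν i (Finset.ne_of_mem_erase i.2)
  unfold lmarginal
  rw [e, ← lintegral_const_mul' _ _ hc]
  exact lintegral_mono fun y => h _

/-- One-dimensional comparisons of the squares of polynomials tensorize. -/
lemma lintegral_pi_sq_le (μ ν : Fin d → Measure ℝ) [∀ i, SigmaFinite (μ i)]
    [∀ i, SigmaFinite (ν i)] (c : ENNReal) (hc : c ≠ ⊤)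
    (h : ∀ i, ∀ q : ℝ[X], q.natDegree ≤ p →
      ∫⁻ t, ENNReal.ofReal (q.eval t ^ 2) ∂μ i ≤ c * ∫⁻ t, ENNReal.ofReal (q.eval t ^ 2) ∂ν i)
    {f : Pt d → ℝ} (hf : f ∈ refQ d p) :
    ∫⁻ x, ENNReal.ofReal (f (WithLp.toLp 2 x) ^ 2) ∂Measure.pi μ ≤
      c ^ d * ∫⁻ x, ENNReal.ofReal (f (WithLp.toLp 2 x) ^ 2) ∂Measure.pi ν := by
  classical
  have hcont := continuous_refQ hf
  have hmeas : Measurable fun x : Fin d → ℝ => ENNReal.ofReal (f (WithLp.toLp 2 x) ^ 2) := by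
    have : Continuous fun x : Fin d → ℝ => f (WithLp.toLp 2 x) ^ 2 := by fun_prop
    exact this.measurable.ennreal_ofReal
  have key : ∀ s : Finset (Fin d), ∫⁻ x, ENNReal.ofReal (f (WithLp.toLp 2 x) ^ 2) ∂Measure.pi μ ≤
      c ^ s.card * ∫⁻ x, ENNReal.ofReal (f (WithLp.toLp 2 x) ^ 2)
        ∂Measure.pi (fun i => if i ∈ s then ν i else μ i) := by
    intro s
    induction s using Finset.induction_on with
    | empty => simp
    | insert j s hj ih =>
      refine ih.trans ?_
      have : ∀ i, SigmaFinite (if i ∈ s then ν i else μ i) := by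
        intro i; split_ifs <;> infer_instance
      have : ∀ i, SigmaFinite (if i ∈ insert j s then ν i else μ i) := by
        intro i; split_ifs <;> infer_instance
      rw [Finset.card_insert_of_notMem hj, pow_succ, mul_assoc]
      refine mul_le_mul_right ?_ _
      refine lintegral_pi_le_update _ j _ ?_ hmeas hmeas c hc fun x => ?_
      · intro i hi
        simp [hi]
      · obtain ⟨q, hq, hq'⟩ := exists_polynomial_update hf j x
        simp only [hq', hj, if_false, Finset.mem_insert_self, if_true]
        exact h j q hq
  simpa using key Finset.univ

/-- The purely atomic measure on the Gauss–Legendre–Lobatto nodes with the given masses. -/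
def atomic (p : ℕ) (c : ℝ → ENNReal) : Measure ℝ := ∑ t ∈ gllNodes p, c t • Measure.dirac t

lemma lintegral_atomic (c : ℝ → ENNReal) (f : ℝ → ENNReal) :
    ∫⁻ t, f t ∂atomic p c = ∑ t ∈ gllNodes p, c t * f t := by
  rw [atomic, lintegral_finsetSum_measure]
  simp [lintegral_smul_measure]

lemma isFiniteMeasure_atomic (c : ℝ → ENNReal) (hc : ∀ t, c t ≠ ⊤) :
    IsFiniteMeasure (atomic p c) := by
  refine ⟨?_⟩
  have := lintegral_atomic (p := p) c (fun _ => 1)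
  rw [lintegral_one] at this
  rw [this]
  exact ENNReal.sum_lt_top.2 fun t _ => by simpa using (hc t).lt_top

/-- A product of atomic measures is the tensor-product quadrature rule. -/
lemma lintegral_pi_atomic (c : Fin d → ℝ → ENNReal) (hc : ∀ i t, c i t ≠ ⊤)
    (f : (Fin d → ℝ) → ENNReal) :
    ∫⁻ x, f x ∂Measure.pi (fun i => atomic p (c i)) =
      ∑ a : NodeIdx d p, (∏ i, c i (a i)) * f (fun i => a i) := by
  classical
  have : ∀ i, IsFiniteMeasure (atomic p (c i)) := fun i => isFiniteMeasure_atomic _ (hc i)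
  set s : Finset (Fin d → ℝ) := Fintype.piFinset fun _ => gllNodes p with hs
  have hone : ∀ i t, t ∈ gllNodes p → atomic p (c i) {t} = c i t := by
    intro i t ht
    rw [← lintegral_indicator_one (MeasurableSet.singleton t), lintegral_atomic,
      Finset.sum_eq_single t]
    · simp
    · intro s _ hst; simp [hst]
    · exact fun h => absurd ht h
  have hae : ∀ᵐ x ∂Measure.pi (fun i => atomic p (c i)), x ∈ (s : Set (Fin d → ℝ)) := by
    have h1 : ∀ i, ∀ᵐ x ∂Measure.pi (fun i => atomic p (c i)), x i ∈ gllNodes p := by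
      intro i
      refine (Measure.tendsto_eval_ae_ae (μ := fun i => atomic p (c i)) (i := i)).eventually
        (p := fun t => t ∈ gllNodes p) ?_
      rw [ae_iff]
      have hm : MeasurableSet {t | t ∉ gllNodes p} :=
        ((gllNodes p).measurableSet).compl
      rw [← lintegral_indicator_one hm, lintegral_atomic]
      exact Finset.sum_eq_zero fun t ht => by simp [ht]
    filter_upwards [ae_all_iff.2 h1] with x hx
    simpa [hs] using hx
  rw [← Measure.restrict_eq_self_of_ae_mem hae, lintegral_finset]
  refine Finset.sum_bij' (fun x hx => fun i => ⟨x i, Fintype.mem_piFinset.1 hx i⟩)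
    (fun a _ => fun i => (a i : ℝ)) (fun _ _ => Finset.mem_univ _)
    (fun a _ => Fintype.mem_piFinset.2 fun i => (a i).2) (fun _ _ => rfl) (fun _ _ => rfl) ?_
  intro x hx
  rw [Measure.pi_singleton, mul_comm]
  congr 1
  exact Finset.prod_congr rfl fun i _ => hone i _ (Fintype.mem_piFinset.1 hx i)

/-- Lebesgue measure on the reference interval. -/
def unitMeasure : Measure ℝ := volume.restrict (Set.Ioo (-1) 1)

instance : IsFiniteMeasure unitMeasure := by unfold unitMeasure; infer_instance

lemma unitMeasure_eq_Icc : unitMeasure = volume.restrict (Set.Icc (-1 : ℝ) 1) :=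
  Measure.restrict_congr_set Ioo_ae_eq_Icc

lemma lintegral_unitMeasure (q : ℝ[X]) :
    ∫⁻ t, ENNReal.ofReal (q.eval t ^ 2) ∂unitMeasure = ENNReal.ofReal (polyInt (q ^ 2)) := by
  have e : unitMeasure = volume.restrict (Set.Ioc (-1 : ℝ) 1) :=
    Measure.restrict_congr_set Ioo_ae_eq_Ioc
  rw [polyInt_apply, intervalIntegral.integral_of_le (by norm_num), e,
    ofReal_integral_eq_lintegral_ofReal]
  · simp only [eval_pow]
  · exact ((q ^ 2).continuous.intervalIntegrable (-1) 1).1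
  · exact Filter.Eventually.of_forall fun x => by simp only [eval_pow]; positivity

/-- The masses of the Gauss–Legendre–Lobatto rule. -/
def gllMass (p : ℕ) (t : ℝ) : ENNReal := ENNReal.ofReal (gllWeight p t)

/-- The unit mass at an end point of the reference interval. -/
def endMass (b : Bool) (t : ℝ) : ENNReal := if t = sgn b then 1 else 0

lemma sgn_mem_gllNodes (hp : 1 < p) (b : Bool) : sgn b ∈ gllNodes p := by
  cases b
  · simpa [sgn] using neg_one_mem_gllNodes hp
  · simpa [sgn] using one_mem_gllNodes hp

lemma gllWeight_sgn (hp : 1 < p) (b : Bool) : gllWeight p (sgn b) = 2 / (p * (p + 1)) := by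
  rw [← gllWeight_one hp]
  cases b
  · simpa [sgn] using gllWeight_neg hp (one_mem_gllNodes hp)
  · simp [sgn]

lemma atomic_endMass (hp : 1 < p) (b : Bool) : atomic p (endMass b) = Measure.dirac (sgn b) := by
  rw [atomic, Finset.sum_eq_single (sgn b)]
  · simp [endMass]
  · intro t _ ht; simp [endMass, ht]
  · exact fun h => absurd (sgn_mem_gllNodes hp b) h

lemma lintegral_gllMass (hp : 1 < p) (q : ℝ[X]) :
    ∫⁻ t, ENNReal.ofReal (q.eval t ^ 2) ∂atomic p (gllMass p) =
      ENNReal.ofReal (gllSum p (q ^ 2)) := by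
  rw [lintegral_atomic, gllSum, ENNReal.ofReal_sum_of_nonneg]
  · refine Finset.sum_congr rfl fun t ht => ?_
    rw [gllMass, ← ENNReal.ofReal_mul (gllWeight_pos hp ht).le, eval_pow]
  · intro t ht
    rw [eval_pow]
    exact mul_nonneg (gllWeight_pos hp ht).le (sq_nonneg _)

/-- The product measure carried by the cube. -/
def cubeMeasure (d : ℕ) : Measure (Fin d → ℝ) := Measure.pi fun _ => unitMeasure

/-- The product measure carried by a facet of the cube. -/
def facetMeasure (j : Fin d) (b : Bool) : Measure (Fin d → ℝ) :=
  Measure.pi (Function.update (fun _ => unitMeasure) j (Measure.dirac (sgn b)))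

/-- The tensor product quadrature weights. -/
def nodeWeight (a : NodeIdx d p) : ℝ := ∏ i, gllWeight p (a i)

lemma nodeWeight_pos (hp : 1 < p) (a : NodeIdx d p) : 0 < nodeWeight a :=
  Finset.prod_pos fun i _ => gllWeight_pos hp (a i).2

lemma lintegral_unitMeasure_le (hp : 1 < p) {q : ℝ[X]} (hq : q.natDegree ≤ p) :
    ∫⁻ t, ENNReal.ofReal (q.eval t ^ 2) ∂unitMeasure ≤
      1 * ∫⁻ t, ENNReal.ofReal (q.eval t ^ 2) ∂atomic p (gllMass p) := by
  rw [lintegral_unitMeasure, lintegral_gllMass hp, one_mul]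
  exact ENNReal.ofReal_le_ofReal (polyInt_sq_le_gllSum hp hq)

lemma lintegral_gllMass_le (hp : 1 < p) {q : ℝ[X]} (hq : q.natDegree ≤ p) :
    ∫⁻ t, ENNReal.ofReal (q.eval t ^ 2) ∂atomic p (gllMass p) ≤
      3 * ∫⁻ t, ENNReal.ofReal (q.eval t ^ 2) ∂unitMeasure := by
  rw [lintegral_unitMeasure, lintegral_gllMass hp,
    show (3 : ENNReal) = ENNReal.ofReal 3 by simp, ← ENNReal.ofReal_mul (by norm_num)]
  exact ENNReal.ofReal_le_ofReal (gllSum_sq_le hp hq)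

lemma lintegral_pi_gllMass (hp : 1 < p) (f : (Fin d → ℝ) → ℝ) :
    ∫⁻ x, ENNReal.ofReal (f x ^ 2) ∂Measure.pi (fun _ : Fin d => atomic p (gllMass p)) =
      ENNReal.ofReal (∑ a : NodeIdx d p, nodeWeight a * f (fun i => a i) ^ 2) := by
  rw [lintegral_pi_atomic (fun _ => gllMass p) (fun _ _ => ENNReal.ofReal_ne_top),
    ENNReal.ofReal_sum_of_nonneg
      (fun a _ => mul_nonneg (nodeWeight_pos hp a).le (sq_nonneg _))]
  refine Finset.sum_congr rfl fun a _ => ?_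
  rw [ENNReal.ofReal_mul (nodeWeight_pos hp a).le, nodeWeight,
    ENNReal.ofReal_prod_of_nonneg fun i _ => (gllWeight_pos hp (a i).2).le]
  rfl

/-- `L²` norm on the cube versus weighted nodal values. -/
lemma lintegral_cubeMeasure_le (hp : 1 < p) {f : Pt d → ℝ} (hf : f ∈ refQ d p) :
    ∫⁻ x, ENNReal.ofReal (f (WithLp.toLp 2 x) ^ 2) ∂cubeMeasure d ≤
      ENNReal.ofReal (∑ a : NodeIdx d p, nodeWeight a * f (refNode a) ^ 2) := by
  have : IsFiniteMeasure (atomic p (gllMass p)) :=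
    isFiniteMeasure_atomic _ fun _ => ENNReal.ofReal_ne_top
  have h := lintegral_pi_sq_le (fun _ : Fin d => unitMeasure) (fun _ => atomic p (gllMass p)) 1
    (by simp) (fun _ q hq => lintegral_unitMeasure_le hp hq) hf
  rw [lintegral_pi_gllMass hp (fun x => f (WithLp.toLp 2 x)), one_pow, one_mul] at h
  exact h

lemma le_lintegral_cubeMeasure (hp : 1 < p) {f : Pt d → ℝ} (hf : f ∈ refQ d p) :
    ENNReal.ofReal (∑ a : NodeIdx d p, nodeWeight a * f (refNode a) ^ 2) ≤
      3 ^ d * ∫⁻ x, ENNReal.ofReal (f (WithLp.toLp 2 x) ^ 2) ∂cubeMeasure d := by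
  have : IsFiniteMeasure (atomic p (gllMass p)) :=
    isFiniteMeasure_atomic _ fun _ => ENNReal.ofReal_ne_top
  have h := lintegral_pi_sq_le (fun _ : Fin d => atomic p (gllMass p)) (fun _ => unitMeasure) 3
    (by simp) (fun _ q hq => lintegral_gllMass_le hp hq) hf
  rw [lintegral_pi_gllMass hp (fun x => f (WithLp.toLp 2 x))] at h
  exact h

open Classical in
/-- The sum of the weighted squares of the nodal values on a facet. -/
def facetSum (p : ℕ) (j : Fin d) (b : Bool) (f : Pt d → ℝ) : ℝ :=
  ∑ a ∈ Finset.univ.filter (fun a : NodeIdx d p => (a j : ℝ) = sgn b),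
    nodeWeight a * f (refNode a) ^ 2

lemma facetSum_nonneg (hp : 1 < p) (j : Fin d) (b : Bool) (f : Pt d → ℝ) :
    0 ≤ facetSum p j b f :=
  Finset.sum_nonneg fun a _ => mul_nonneg (nodeWeight_pos hp a).le (sq_nonneg _)

/-- The quadrature rule on a facet has the nodal weights divided by the weight `2 / (p (p + 1))`
of an end point. This is the source of the factor `p²` between facets and elements. -/
lemma lintegral_pi_facetMass (hp : 1 < p) (j : Fin d) (b : Bool) (f : Pt d → ℝ) :
    ∫⁻ x, ENNReal.ofReal (f (WithLp.toLp 2 x) ^ 2) ∂Measure.pi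
        (fun i : Fin d => atomic p (Function.update (fun _ => gllMass p) j (endMass b) i)) =
      ENNReal.ofReal (p * (p + 1) / 2 * facetSum p j b f) := by
  classical
  have hp0 : (0 : ℝ) < p := by exact_mod_cast (by omega : 0 < p)
  rw [lintegral_pi_atomic]
  · rw [facetSum, Finset.mul_sum, ENNReal.ofReal_sum_of_nonneg, Finset.sum_filter]
    · refine Finset.sum_congr rfl fun a _ => ?_
      rw [← Finset.mul_prod_erase _ _ (Finset.mem_univ j), Function.update_self, endMass]
      split_ifs with h
      · have h1 : (p : ℝ) * (p + 1) / 2 * (nodeWeight a * f (refNode a) ^ 2) =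
            (∏ i ∈ Finset.univ.erase j, gllWeight p (a i)) * f (refNode a) ^ 2 := by
          rw [nodeWeight, ← Finset.mul_prod_erase _ _ (Finset.mem_univ j), h, gllWeight_sgn hp]
          field_simp
        rw [h1, one_mul, ENNReal.ofReal_mul
            (Finset.prod_nonneg fun i _ => (gllWeight_pos hp (a i).2).le),
          ENNReal.ofReal_prod_of_nonneg fun i _ => (gllWeight_pos hp (a i).2).le]
        congr 1
        refine Finset.prod_congr rfl fun i hi => ?_
        rw [Function.update_of_ne (Finset.ne_of_mem_erase hi), gllMass]
      · simp
    · intro a _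
      have := (nodeWeight_pos hp a).le
      positivity
  · intro i t
    by_cases h : i = j
    · subst h
      rw [Function.update_self, endMass]
      split_ifs <;> simp
    · rw [Function.update_of_ne h]
      exact ENNReal.ofReal_ne_top

lemma lintegral_facetMeasure_le (hp : 1 < p) (j : Fin d) (b : Bool) {f : Pt d → ℝ}
    (hf : f ∈ refQ d p) :
    ∫⁻ x, ENNReal.ofReal (f (WithLp.toLp 2 x) ^ 2) ∂facetMeasure j b ≤
      ENNReal.ofReal (p * (p + 1) / 2 * facetSum p j b f) := by
  have h1 : ∀ i, IsFiniteMeasure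
      (Function.update (fun _ : Fin d => unitMeasure) j (Measure.dirac (sgn b)) i) := by
    intro i
    by_cases h : i = j
    · subst h; rw [Function.update_self]; infer_instance
    · rw [Function.update_of_ne h]; infer_instance
  have h2 : ∀ i : Fin d, IsFiniteMeasure
      (atomic p (Function.update (fun _ => gllMass p) j (endMass b) i)) := by
    intro i
    refine isFiniteMeasure_atomic _ fun t => ?_
    by_cases h : i = j
    · subst h; rw [Function.update_self, endMass]; split_ifs <;> simp
    · rw [Function.update_of_ne h]; exact ENNReal.ofReal_ne_top
  have h := lintegral_pi_sq_le
    (Function.update (fun _ : Fin d => unitMeasure) j (Measure.dirac (sgn b)))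
    (fun i => atomic p (Function.update (fun _ => gllMass p) j (endMass b) i)) 1
    (by simp) (fun i q hq => ?_) hf
  · rw [lintegral_pi_facetMass hp, one_pow, one_mul] at h
    exact h
  · by_cases h : i = j
    · subst h
      rw [Function.update_self, Function.update_self, atomic_endMass hp, one_mul]
    · rw [Function.update_of_ne h, Function.update_of_ne h]
      exact lintegral_unitMeasure_le hp hq

lemma le_lintegral_facetMeasure (hp : 1 < p) (j : Fin d) (b : Bool) {f : Pt d → ℝ}
    (hf : f ∈ refQ d p) :
    ENNReal.ofReal (p * (p + 1) / 2 * facetSum p j b f) ≤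
      3 ^ d * ∫⁻ x, ENNReal.ofReal (f (WithLp.toLp 2 x) ^ 2) ∂facetMeasure j b := by
  have h1 : ∀ i, IsFiniteMeasure
      (Function.update (fun _ : Fin d => unitMeasure) j (Measure.dirac (sgn b)) i) := by
    intro i
    by_cases h : i = j
    · subst h; rw [Function.update_self]; infer_instance
    · rw [Function.update_of_ne h]; infer_instance
  have h2 : ∀ i : Fin d, IsFiniteMeasure
      (atomic p (Function.update (fun _ => gllMass p) j (endMass b) i)) := by
    intro i
    refine isFiniteMeasure_atomic _ fun t => ?_
    by_cases h : i = j
    · subst h; rw [Function.update_self, endMass]; split_ifs <;> simp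
    · rw [Function.update_of_ne h]; exact ENNReal.ofReal_ne_top
  have h := lintegral_pi_sq_le
    (fun i => atomic p (Function.update (fun _ => gllMass p) j (endMass b) i))
    (Function.update (fun _ : Fin d => unitMeasure) j (Measure.dirac (sgn b))) 3
    (by simp) (fun i q hq => ?_) hf
  · rw [lintegral_pi_facetMass hp] at h
    exact h
  · by_cases h : i = j
    · subst h
      rw [Function.update_self, Function.update_self, atomic_endMass hp]
      exact le_mul_of_one_le_left' (by norm_num)
    · rw [Function.update_of_ne h, Function.update_of_ne h]
      exact lintegral_gllMass_le hp hq

/-- The inverse inequality for partial derivatives on the cube. -/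
lemma lintegral_partialDeriv_le (hp : 1 < p) {f g : Pt d → ℝ} (hf : f ∈ refQ d p)
    (hg : g ∈ refQ d p) (j : Fin d)
    (h : ∀ x : Fin d → ℝ, HasDerivAt (fun t => f (WithLp.toLp 2 (Function.update x j t)))
      (g (WithLp.toLp 2 x)) (x j)) :
    ∫⁻ x, ENNReal.ofReal (g (WithLp.toLp 2 x) ^ 2) ∂cubeMeasure d ≤
      ENNReal.ofReal (96 * p ^ 4) *
        ∫⁻ x, ENNReal.ofReal (f (WithLp.toLp 2 x) ^ 2) ∂cubeMeasure d := by
  have hmeas : ∀ {f : Pt d → ℝ}, f ∈ refQ d p →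
      Measurable fun x : Fin d → ℝ => ENNReal.ofReal (f (WithLp.toLp 2 x) ^ 2) := by
    intro f hf
    have hcont := continuous_refQ hf
    have : Continuous fun x : Fin d → ℝ => f (WithLp.toLp 2 x) ^ 2 := by fun_prop
    exact this.measurable.ennreal_ofReal
  refine lintegral_pi_le_update _ j _ (fun _ _ => rfl) (hmeas hg) (hmeas hf) _
    ENNReal.ofReal_ne_top fun x => ?_
  obtain ⟨q, hq, hq'⟩ := exists_polynomial_update hf j x
  have hder : ∀ t, g (WithLp.toLp 2 (Function.update x j t)) = (derivative q).eval t := by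
    intro t
    have h1 := h (Function.update x j t)
    simp only [Function.update_idem, Function.update_self, hq'] at h1
    exact h1.unique (q.hasDerivAt t)
  simp only [hder, hq', lintegral_unitMeasure]
  rw [← ENNReal.ofReal_mul (by positivity)]
  exact ENNReal.ofReal_le_ofReal (polyInt_derivative_sq_le hp hq)

/-! ### The reference cube and its facets as measure spaces -/

lemma lintegral_refCube (f : Pt d → ENNReal) :
    ∫⁻ x in refCube d, f x = ∫⁻ x, f (WithLp.toLp 2 x) ∂cubeMeasure d := by
  have e : cubeMeasure d = volume.restrict (Set.univ.pi fun _ : Fin d => Set.Ioo (-1 : ℝ) 1) := by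
    rw [volume_pi, Measure.restrict_pi_pi]; rfl
  have hmp := (EuclideanSpace.volume_preserving_symm_measurableEquiv_toLp (Fin d)).symm
  have h := hmp.setLIntegral_comp_preimage_emb (MeasurableEquiv.measurableEmbedding _) f (refCube d)
  have e2 : (⇑(MeasurableEquiv.toLp 2 (Fin d → ℝ)).symm.symm ⁻¹' refCube d) =
      Set.univ.pi fun _ : Fin d => Set.Ioo (-1 : ℝ) 1 := by
    ext y
    exact ⟨fun h i _ => h i, fun h i => h i (Set.mem_univ i)⟩
  rw [← h, e, e2]
  rfl

lemma lintegral_refFacet (j : Fin d) (b : Bool) {f : Pt d → ENNReal} (hf : Measurable f) :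
    ∫⁻ x in refFacet j b, f x ∂μHE[d - 1] =
      ∫⁻ x, f (WithLp.toLp 2 x) ∂facetMeasure j b := by
  obtain ⟨n, rfl⟩ : ∃ n, d = n + 1 := ⟨d - 1, by have := j.pos; omega⟩
  set φ : Pt n → Pt (n + 1) := fun y => WithLp.toLp 2 (j.insertNth (sgn b) y.ofLp) with hφ
  have hiso : Isometry φ := by
    refine Isometry.of_dist_eq fun x y => ?_
    rw [EuclideanSpace.dist_eq, EuclideanSpace.dist_eq, Fin.sum_univ_succAbove _ j]
    simp [hφ]
  have hcont : Continuous φ := hiso.continuous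
  have hemb : MeasurableEmbedding φ := hiso.isClosedEmbedding.measurableEmbedding
  set S : Set (Pt n) := {y | ∀ i, y i ∈ Set.Icc (-1 : ℝ) 1} with hS
  have himg : refFacet j b = φ '' S := by
    ext x
    simp only [refFacet, Set.mem_ofPred_eq, Set.mem_image, hS, hφ]
    constructor
    · rintro ⟨h1, h2⟩
      refine ⟨WithLp.toLp 2 (j.removeNth x.ofLp), fun i => h1 _, ?_⟩
      rw [← h2]
      ext i
      simp
    · rintro ⟨y, hy, rfl⟩
      refine ⟨fun i => ?_, by simp⟩
      rcases Fin.eq_self_or_eq_succAbove j i with rfl | ⟨i', rfl⟩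
      · cases b <;> simp [sgn]
      · simpa using hy i'
  have h1 : ∫⁻ x in refFacet j b, f x ∂μHE[n + 1 - 1] = ∫⁻ y in S, f (φ y) := by
    rw [Nat.add_sub_cancel, himg]
    have e1 : (μHE[n] : Measure (Pt (n + 1))).restrict (φ '' S) =
        ((μHE[n] : Measure (Pt n)).map φ).restrict (φ '' S) := by
      rw [hiso.map_euclideanHausdorffMeasure, Measure.restrict_restrict_of_subset
        (Set.image_subset_range φ S)]
    rw [e1, hemb.restrict_map, Set.preimage_image_eq _ hiso.injective, hemb.lintegral_map,
      EuclideanSpace.euclideanHausdorffMeasure_eq_volume]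
  have e2 : Measure.pi (fun _ : Fin n => unitMeasure) =
      volume.restrict (Set.univ.pi fun _ : Fin n => Set.Icc (-1 : ℝ) 1) := by
    rw [volume_pi, Measure.restrict_pi_pi, unitMeasure_eq_Icc]
  have hmp := (EuclideanSpace.volume_preserving_symm_measurableEquiv_toLp (Fin n)).symm
  have h2 : ∫⁻ y in S, f (φ y) =
      ∫⁻ y, f (φ (WithLp.toLp 2 y)) ∂Measure.pi (fun _ : Fin n => unitMeasure) := by
    rw [← hmp.setLIntegral_comp_preimage_emb (MeasurableEquiv.measurableEmbedding _), e2]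
    have : (⇑(MeasurableEquiv.toLp 2 (Fin n → ℝ)).symm.symm ⁻¹' S) =
        Set.univ.pi fun _ : Fin n => Set.Icc (-1 : ℝ) 1 := by
      ext y
      exact ⟨fun h i _ => h i, fun h i => h i (Set.mem_univ i)⟩
    rw [this]; rfl
  rw [h1, h2, facetMeasure]
  set μ : Fin (n + 1) → Measure ℝ :=
    Function.update (fun _ => unitMeasure) j (Measure.dirac (sgn b)) with hμ
  have hfin : ∀ i, IsFiniteMeasure (μ i) := by
    intro i
    by_cases h : i = j
    · subst h; rw [hμ, Function.update_self]; infer_instance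
    · rw [hμ, Function.update_of_ne h]; infer_instance
  have hmp2 := (measurePreserving_piFinSuccAbove μ j).symm
  have h3 : ∀ i : Fin n, μ (j.succAbove i) = unitMeasure := fun i => by
    rw [hμ, Function.update_of_ne (Fin.succAbove_ne j i)]
  have h4 : μ j = Measure.dirac (sgn b) := by rw [hμ, Function.update_self]
  have hfm : Measurable fun x : Fin (n + 1) → ℝ => f (WithLp.toLp 2 x) :=
    hf.comp (MeasurableEquiv.toLp 2 (Fin (n + 1) → ℝ)).measurable
  rw [← hmp2.lintegral_comp hfm]
  simp only [h3]
  rw [h4, Measure.dirac_prod, lintegral_map]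
  · rfl
  · exact hfm.comp (MeasurableEquiv.measurable _)
  · exact measurable_prodMk_left

/-! ### Scaling to the elements of a mesh -/

/-- Integration with respect to Hausdorff measure over a Lipschitz image. -/
lemma lintegral_image_le (e : Pt d ≃ₜ Pt d) {L : NNReal} (hL : LipschitzWith L e) (m : ℕ)
    (S : Set (Pt d)) (g : Pt d → ENNReal) :
    ∫⁻ x in e '' S, g x ∂μHE[m] ≤ L ^ m * ∫⁻ x in S, g (e x) ∂μHE[m] := by
  have hle : (μHE[m] : Measure (Pt d)).restrict (e '' S) ≤
      ((L : ENNReal) ^ m) • ((μHE[m] : Measure (Pt d)).restrict S).map e.toMeasurableEquiv := by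
    refine Measure.le_iff.2 fun A hA => ?_
    rw [Measure.restrict_apply hA, Measure.smul_apply, smul_eq_mul,
      MeasurableEquiv.map_apply, Measure.restrict_apply (e.toMeasurableEquiv.measurable hA)]
    have e1 : A ∩ e '' S = e '' (e ⁻¹' A ∩ S) := by
      rw [Set.image_preimage_inter]
    rw [e1, Measure.euclideanHausdorffMeasure_def]
    have h1 := hL.hausdorffMeasure_image_le (d := (m : ℝ)) (by positivity) (e ⁻¹' A ∩ S)
    rw [ENNReal.rpow_natCast] at h1
    simp only [Measure.smul_apply, ENNReal.smul_def, smul_eq_mul]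
    rw [mul_left_comm]
    exact mul_le_mul_right h1 _
  calc ∫⁻ x in e '' S, g x ∂μHE[m]
      ≤ ∫⁻ x, g x ∂(((L : ENNReal) ^ m) •
          ((μHE[m] : Measure (Pt d)).restrict S).map e.toMeasurableEquiv) :=
        lintegral_mono' hle le_rfl
    _ = L ^ m * ∫⁻ x in S, g (e x) ∂μHE[m] := by
        rw [lintegral_smul_measure, lintegral_map_equiv]; rfl

lemma lintegral_le_image (e : Pt d ≃ₜ Pt d) {L : NNReal} (hL : LipschitzWith L e.symm) (m : ℕ)
    (S : Set (Pt d)) (g : Pt d → ENNReal) :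
    ∫⁻ x in S, g (e x) ∂μHE[m] ≤ L ^ m * ∫⁻ x in e '' S, g x ∂μHE[m] := by
  have h := lintegral_image_le e.symm hL m (e '' S) (fun x => g (e x))
  have e1 : e.symm '' (e '' S) = S := by
    rw [← Set.image_comp]; simp
  rw [e1] at h
  simpa using h

namespace Mesh

variable {Ω : Set (Pt d)} {M : Mesh Ω} {K h : ℝ}

/-- The affine maps of the mesh and their inverses are Lipschitz at the scale `h`, the diameters
are comparable to `h`, and boundedly many elements meet at each point. -/
structure Scaled (M : Mesh Ω) (K h : ℝ) : Prop where
  h_pos : 0 < h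
  one_le : 1 ≤ K
  dist_map_le : ∀ k x y, dist (M.map k x) (M.map k y) ≤ K * h * dist x y
  dist_symm_le : ∀ k x y, dist ((M.map k).symm x) ((M.map k).symm y) ≤ K / h * dist x y
  diam_le : ∀ k, M.diam k ≤ K * h
  le_diam : ∀ k, h ≤ K * M.diam k
  card_le : ∀ ξ, ((M.elemsAt ξ).card : ℝ) ≤ K

/-- The affine map of an element as a homeomorphism. -/
def homeo (M : Mesh Ω) (k : Fin M.N) : Pt d ≃ₜ Pt d :=
  (AffineEquiv.toContinuousAffineEquiv (M.map k)).toHomeomorph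

lemma Scaled.K_pos (hM : M.Scaled K h) : 0 < K := lt_of_lt_of_le one_pos hM.one_le

lemma Scaled.lipschitz (hM : M.Scaled K h) (k : Fin M.N) :
    LipschitzWith (K * h).toNNReal (M.homeo k) :=
  LipschitzWith.of_dist_le_mul fun x y => by
    rw [Real.coe_toNNReal _ (mul_nonneg hM.K_pos.le hM.h_pos.le)]
    exact hM.dist_map_le k x y

lemma Scaled.lipschitz_symm (hM : M.Scaled K h) (k : Fin M.N) :
    LipschitzWith (K / h).toNNReal (M.homeo k).symm :=
  LipschitzWith.of_dist_le_mul fun x y => by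
    rw [Real.coe_toNNReal _ (div_nonneg hM.K_pos.le hM.h_pos.le)]
    exact hM.dist_symm_le k x y

lemma isClosed_refFacet (j : Fin d) (b : Bool) : IsClosed (refFacet j b) := by
  have : refFacet j b = (⋂ i, {x : Pt d | x i ∈ Set.Icc (-1 : ℝ) 1}) ∩ {x | x j = sgn b} := by
    ext x; simp [refFacet]
  rw [this]
  refine IsClosed.inter (isClosed_iInter fun i => ?_) (isClosed_eq (by fun_prop) continuous_const)
  exact isClosed_Icc.preimage (by fun_prop : Continuous fun x : Pt d => x i)

lemma isOpen_refCube : IsOpen (refCube d) := by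
  have : refCube d = ⋂ i, {x : Pt d | x i ∈ Set.Ioo (-1 : ℝ) 1} := by
    ext x; simp [refCube]
  rw [this]
  refine isOpen_iInter_of_finite fun i => ?_
  exact isOpen_Ioo.preimage (by fun_prop : Continuous fun x : Pt d => x i)

lemma isOpen_elem (k : Fin M.N) : IsOpen (M.elem k) :=
  (M.homeo k).isOpenMap _ isOpen_refCube

lemma isClosed_facet (σ : M.Side) : IsClosed (M.facet σ) :=
  (M.homeo σ.1).isClosedMap _ (isClosed_refFacet _ _)

lemma isBounded_closedCube : Bornology.IsBounded {x : Pt d | ∀ i, x i ∈ Set.Icc (-1 : ℝ) 1} := by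
  refine (Metric.isBounded_closedBall (x := (0 : Pt d)) (r := √d)).subset fun x hx => ?_
  rw [mem_closedBall_zero_iff, EuclideanSpace.norm_eq]
  refine Real.sqrt_le_sqrt ?_
  calc ∑ i, ‖x i‖ ^ 2 ≤ ∑ _i : Fin d, (1 : ℝ) := by
        refine Finset.sum_le_sum fun i _ => ?_
        have := hx i
        rw [Real.norm_eq_abs, sq_abs]
        nlinarith [this.1, this.2]
    _ = d := by simp

lemma isCompact_facet (σ : M.Side) : IsCompact (M.facet σ) := by
  refine IsCompact.image ?_ (M.homeo σ.1).continuous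
  exact Metric.isCompact_of_isClosed_isBounded (isClosed_refFacet _ _)
    (isBounded_closedCube.subset fun x hx => hx.1)

lemma isCompact_closure_elem (k : Fin M.N) : IsCompact (closure (M.elem k)) := by
  have h1 : IsCompact (closure (refCube d)) :=
    Metric.isCompact_of_isClosed_isBounded isClosed_closure
      (isBounded_closedCube.subset fun x hx i => ⟨(hx i).1.le, (hx i).2.le⟩).closure
  have h2 := h1.image (M.homeo k).continuous
  rw [(M.homeo k).image_closure] at h2
  exact h2

lemma lintegral_elem_le (hM : M.Scaled K h) (k : Fin M.N) (g : Pt d → ENNReal) :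
    ∫⁻ x in M.elem k, g x ≤
      ENNReal.ofReal ((K * h) ^ d) * ∫⁻ x, g (M.map k (WithLp.toLp 2 x)) ∂cubeMeasure d := by
  have := lintegral_image_le (M.homeo k) (hM.lipschitz k) d (refCube d) g
  rw [EuclideanSpace.euclideanHausdorffMeasure_eq_volume, lintegral_refCube] at this
  rw [ENNReal.ofReal_pow (mul_nonneg hM.K_pos.le hM.h_pos.le)]
  exact this

lemma le_lintegral_elem (hM : M.Scaled K h) (k : Fin M.N) (g : Pt d → ENNReal) :
    ∫⁻ x, g (M.map k (WithLp.toLp 2 x)) ∂cubeMeasure d ≤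
      ENNReal.ofReal ((K / h) ^ d) * ∫⁻ x in M.elem k, g x := by
  have := lintegral_le_image (M.homeo k) (hM.lipschitz_symm k) d (refCube d) g
  rw [EuclideanSpace.euclideanHausdorffMeasure_eq_volume, lintegral_refCube] at this
  rw [ENNReal.ofReal_pow (div_nonneg hM.K_pos.le hM.h_pos.le)]
  exact this

lemma lintegral_facet_le (hM : M.Scaled K h) (σ : M.Side) {g : Pt d → ENNReal}
    (hg : Measurable g) :
    ∫⁻ x in M.facet σ, g x ∂μHE[d - 1] ≤ ENNReal.ofReal ((K * h) ^ (d - 1)) *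
      ∫⁻ x, g (M.map σ.1 (WithLp.toLp 2 x)) ∂facetMeasure σ.2.1 σ.2.2 := by
  have := lintegral_image_le (M.homeo σ.1) (hM.lipschitz σ.1) (d - 1) (refFacet σ.2.1 σ.2.2) g
  rw [lintegral_refFacet _ _ (f := fun x => g (M.homeo σ.1 x))
    (hg.comp (M.homeo σ.1).continuous.measurable)] at this
  rw [ENNReal.ofReal_pow (mul_nonneg hM.K_pos.le hM.h_pos.le)]
  exact this

lemma le_lintegral_facet (hM : M.Scaled K h) (σ : M.Side) {g : Pt d → ENNReal}
    (hg : Measurable g) :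
    ∫⁻ x, g (M.map σ.1 (WithLp.toLp 2 x)) ∂facetMeasure σ.2.1 σ.2.2 ≤
      ENNReal.ofReal ((K / h) ^ (d - 1)) * ∫⁻ x in M.facet σ, g x ∂μHE[d - 1] := by
  have := lintegral_le_image (M.homeo σ.1) (hM.lipschitz_symm σ.1) (d - 1)
    (refFacet σ.2.1 σ.2.2) g
  rw [lintegral_refFacet _ _ (f := fun x => g (M.homeo σ.1 x))
    (hg.comp (M.homeo σ.1).continuous.measurable)] at this
  rw [ENNReal.ofReal_pow (div_nonneg hM.K_pos.le hM.h_pos.le)]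
  exact this

end Mesh

lemma integral_sq_le_of_lintegral {X : Type*} [MeasurableSpace X] {μ : Measure X} {u : X → ℝ}
    (hu : AEStronglyMeasurable u μ) {c : ℝ} (hc : 0 ≤ c)
    (hle : ∫⁻ x, ENNReal.ofReal (u x ^ 2) ∂μ ≤ ENNReal.ofReal c) : ∫ x, u x ^ 2 ∂μ ≤ c := by
  rw [integral_eq_lintegral_of_nonneg_ae (Filter.Eventually.of_forall fun x => sq_nonneg _)
    (hu.pow 2)]
  exact ENNReal.toReal_le_of_le_ofReal hc hle

lemma le_integral_sq_of_lintegral {X : Type*} [MeasurableSpace X] {μ : Measure X} {u : X → ℝ}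
    (hu : AEStronglyMeasurable u μ) {c C : ℝ} (hC : 0 ≤ C)
    (hfin : ∫⁻ x, ENNReal.ofReal (u x ^ 2) ∂μ ≠ ⊤)
    (hle : ENNReal.ofReal c ≤ ENNReal.ofReal C * ∫⁻ x, ENNReal.ofReal (u x ^ 2) ∂μ) :
    c ≤ C * ∫ x, u x ^ 2 ∂μ := by
  have h0 : 0 ≤ ∫ x, u x ^ 2 ∂μ := integral_nonneg fun x => sq_nonneg _
  have e : ∫⁻ x, ENNReal.ofReal (u x ^ 2) ∂μ = ENNReal.ofReal (∫ x, u x ^ 2 ∂μ) := by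
    rw [integral_eq_lintegral_of_nonneg_ae (Filter.Eventually.of_forall fun x => sq_nonneg _)
      (hu.pow 2), ENNReal.ofReal_toReal hfin]
  rw [e, ← ENNReal.ofReal_mul hC] at hle
  exact (ENNReal.ofReal_le_ofReal_iff (mul_nonneg hC h0)).1 hle

namespace Mesh

variable {Ω : Set (Pt d)} {M : Mesh Ω} {K h : ℝ}

/-- The function is polynomial of coordinate degree at most `p` in the coordinates of an
element. -/
def IsPolyOn (M : Mesh Ω) (p : ℕ) (k : Fin M.N) (u : Pt d → ℝ) : Prop :=
  (fun x => u (M.map k x)) ∈ refQ d p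

lemma IsPolyOn.continuous {k : Fin M.N} {u : Pt d → ℝ} (hu : M.IsPolyOn p k u) :
    Continuous u := by
  have h1 := (continuous_refQ hu).comp (M.homeo k).symm.continuous
  refine h1.congr fun x => ?_
  exact congrArg u ((M.map k).apply_symm_apply x)

/-- The weighted sum of the squares of the nodal values on an element. -/
def nodeSum (M : Mesh Ω) (p : ℕ) (k : Fin M.N) (u : Pt d → ℝ) : ℝ :=
  ∑ a : NodeIdx d p, nodeWeight a * u (M.node k a) ^ 2

lemma nodeSum_nonneg (hp : 1 < p) (k : Fin M.N) (u : Pt d → ℝ) : 0 ≤ M.nodeSum p k u :=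
  Finset.sum_nonneg fun a _ => mul_nonneg (nodeWeight_pos hp a).le (sq_nonneg _)

lemma measurable_ofReal_sq {u : Pt d → ℝ} (hu : Continuous u) :
    Measurable fun x => ENNReal.ofReal (u x ^ 2) :=
  (hu.pow 2).measurable.ennreal_ofReal

lemma lintegral_elem_sq_le (hM : M.Scaled K h) (hp : 1 < p) {k : Fin M.N} {u : Pt d → ℝ}
    (hu : M.IsPolyOn p k u) :
    ∫⁻ x in M.elem k, ENNReal.ofReal (u x ^ 2) ≤
      ENNReal.ofReal ((K * h) ^ d * M.nodeSum p k u) := by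
  have hK := hM.K_pos
  have hh := hM.h_pos
  refine (lintegral_elem_le hM k _).trans ?_
  rw [ENNReal.ofReal_mul (by positivity)]
  exact mul_le_mul_right (lintegral_cubeMeasure_le hp hu) _

/-- On an element, weighted nodal values are controlled by the `L²` norm, uniformly in `p`. -/
lemma nodeSum_le_integral (hM : M.Scaled K h) (hp : 1 < p) {k : Fin M.N} {u : Pt d → ℝ}
    (hu : M.IsPolyOn p k u) :
    M.nodeSum p k u ≤ 3 ^ d * (K / h) ^ d * ∫ x in M.elem k, u x ^ 2 := by
  have hK := hM.K_pos
  have hh := hM.h_pos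
  refine le_integral_sq_of_lintegral hu.continuous.aestronglyMeasurable (by positivity)
    ((lintegral_elem_sq_le hM hp hu).trans_lt ENNReal.ofReal_lt_top).ne ?_
  refine (le_lintegral_cubeMeasure hp hu).trans ?_
  rw [ENNReal.ofReal_mul (by positivity), mul_assoc,
    show ENNReal.ofReal (3 ^ d) = 3 ^ d by rw [ENNReal.ofReal_pow (by norm_num)]; simp]
  exact mul_le_mul_right (le_lintegral_elem hM k _) _

lemma lintegral_facet_sq_le (hM : M.Scaled K h) (hp : 1 < p) (σ : M.Side) {u : Pt d → ℝ}
    (hu : M.IsPolyOn p σ.1 u) :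
    ∫⁻ x in M.facet σ, ENNReal.ofReal (u x ^ 2) ∂μHE[d - 1] ≤ ENNReal.ofReal ((K * h) ^ (d - 1) *
      (p * (p + 1) / 2 * facetSum p σ.2.1 σ.2.2 fun x => u (M.map σ.1 x))) := by
  have hK := hM.K_pos
  have hh := hM.h_pos
  refine (lintegral_facet_le hM σ (measurable_ofReal_sq hu.continuous)).trans ?_
  rw [ENNReal.ofReal_mul (by positivity)]
  exact mul_le_mul_right (lintegral_facetMeasure_le hp _ _ hu) _

/-- On a facet, the `L²` norm is controlled by weighted nodal values, with the factor `p²`. -/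
lemma faceIntegral_sq_le (hM : M.Scaled K h) (hp : 1 < p) (σ : M.Side) {u : Pt d → ℝ}
    (hu : M.IsPolyOn p σ.1 u) :
    faceIntegral (M.facet σ) (fun x => u x ^ 2) ≤ (K * h) ^ (d - 1) *
      (p * (p + 1) / 2 * facetSum p σ.2.1 σ.2.2 fun x => u (M.map σ.1 x)) := by
  have hK := hM.K_pos
  have hh := hM.h_pos
  exact integral_sq_le_of_lintegral hu.continuous.aestronglyMeasurable
    (mul_nonneg (by positivity) (mul_nonneg (by positivity) (facetSum_nonneg hp _ _ _)))
    (lintegral_facet_sq_le hM hp σ hu)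

lemma facetSum_le_faceIntegral (hM : M.Scaled K h) (hp : 1 < p) (σ : M.Side) {u : Pt d → ℝ}
    (hu : M.IsPolyOn p σ.1 u) :
    p * (p + 1) / 2 * facetSum p σ.2.1 σ.2.2 (fun x => u (M.map σ.1 x)) ≤
      3 ^ d * (K / h) ^ (d - 1) * faceIntegral (M.facet σ) (fun x => u x ^ 2) := by
  have hK := hM.K_pos
  have hh := hM.h_pos
  refine le_integral_sq_of_lintegral hu.continuous.aestronglyMeasurable (by positivity)
    ((lintegral_facet_sq_le hM hp σ hu).trans_lt ENNReal.ofReal_lt_top).ne ?_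
  refine (le_lintegral_facetMeasure hp _ _ hu).trans ?_
  rw [ENNReal.ofReal_mul (by positivity), mul_assoc,
    show ENNReal.ofReal (3 ^ d) = 3 ^ d by rw [ENNReal.ofReal_pow (by norm_num)]; simp]
  exact mul_le_mul_right (le_lintegral_facet hM σ (measurable_ofReal_sq hu.continuous)) _

lemma facetSum_le_nodeSum (hp : 1 < p) (σ : M.Side) (u : Pt d → ℝ) :
    facetSum p σ.2.1 σ.2.2 (fun x => u (M.map σ.1 x)) ≤ M.nodeSum p σ.1 u := by
  classical
  refine Finset.sum_le_sum_of_subset_of_nonneg (Finset.filter_subset _ _) fun a _ _ => ?_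
  exact mul_nonneg (nodeWeight_pos hp a).le (sq_nonneg _)

lemma measure_facet_lt_top (hM : M.Scaled K h) (σ : M.Side) : μHE[d - 1] (M.facet σ) < ⊤ := by
  have h1 : M.IsPolyOn 2 σ.1 fun _ => 1 := by
    have := prod_eval_mem_refQ (p := 2) (fun _ : Fin d => (1 : ℝ[X])) (by simp)
    simpa [IsPolyOn] using this
  have := lintegral_facet_sq_le hM one_lt_two σ h1
  simp only [one_pow, ENNReal.ofReal_one, lintegral_one, Measure.restrict_apply_univ] at this
  exact this.trans_lt ENNReal.ofReal_lt_top

lemma integrableOn_facet (hM : M.Scaled K h) (σ : M.Side) {u : Pt d → ℝ} (hu : Continuous u) :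
    IntegrableOn u (M.facet σ) μHE[d - 1] := by
  obtain ⟨C, hC⟩ := (isCompact_facet σ).exists_bound_of_continuousOn hu.continuousOn
  exact Measure.integrableOn_of_bounded (measure_facet_lt_top hM σ).ne hu.aestronglyMeasurable
    (ae_restrict_of_forall_mem (isClosed_facet σ).measurableSet hC)

lemma integrableOn_elem (k : Fin M.N) {u : Pt d → ℝ} (hu : Continuous u) :
    IntegrableOn u (M.elem k) :=
  (hu.continuousOn.integrableOn_compact (isCompact_closure_elem k)).mono_set subset_closure

lemma fderiv_single_eq {f g : Pt d → ℝ} (hf : Differentiable ℝ f) (j : Fin d)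
    (hder : ∀ x : Fin d → ℝ, HasDerivAt
      (fun t => f (WithLp.toLp 2 (Function.update x j t))) (g (WithLp.toLp 2 x)) (x j))
    (x : Pt d) : fderiv ℝ f x (EuclideanSpace.single j 1) = g x := by
  have h1 : HasDerivAt (fun t : ℝ => (WithLp.toLp 2 (Function.update x.ofLp j t) : Pt d))
      (EuclideanSpace.single j 1) (x j) := by
    have e : (fun t : ℝ => (WithLp.toLp 2 (Function.update x.ofLp j t) : Pt d)) =
        fun t => x + (t - x j) • EuclideanSpace.single j (1 : ℝ) := by
      funext t
      ext i
      by_cases hi : i = j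
      · subst hi; simp
      · simp [hi]
    rw [e]
    have := (((hasDerivAt_id (x j)).sub_const (x j)).smul_const
      (EuclideanSpace.single j (1 : ℝ) : Pt d)).const_add x
    simpa using this
  have h2 : HasFDerivAt f (fderiv ℝ f x) (WithLp.toLp 2 (Function.update x.ofLp j (x j))) := by
    rw [Function.update_eq_self]
    exact (hf x).hasFDerivAt
  have h3 := h2.comp_hasDerivAt (x j) h1
  exact h3.unique (hder x.ofLp)

/-- The inverse inequality on an element. -/
lemma integral_elem_gradient_le (hM : M.Scaled K h) (hp : 1 < p) {k : Fin M.N} {u : Pt d → ℝ}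
    (hu : M.IsPolyOn p k u) :
    ∫ x in M.elem k, ‖gradient u x‖ ^ 2 ≤
      (K * h) ^ d * ((K / h) ^ 2 * (d * (96 * p ^ 4 * M.nodeSum p k u))) := by
  have hK := hM.K_pos
  have hh := hM.h_pos
  have hn := nodeSum_nonneg (M := M) hp k u
  choose g hg hder using exists_partialDeriv hu
  set f : Pt d → ℝ := fun x => u (M.map k x) with hf
  have hfd : Differentiable ℝ f := differentiable_refQ hu
  have hline : ∀ x : Pt d, ∀ j, fderiv ℝ f x (EuclideanSpace.single j 1) = g j x :=
    fun x j => fderiv_single_eq hfd j (hder j) x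
  have hnorm : ∀ x : Pt d, ‖fderiv ℝ f x‖ ^ 2 = ∑ j, g j x ^ 2 := by
    intro x
    have e : ∀ j, (gradient f x) j = g j x := by
      intro j
      rw [← hline, ← inner_gradient_left, EuclideanSpace.inner_single_right]
      simp
    have h1 : ‖fderiv ℝ f x‖ = ‖gradient f x‖ := by
      rw [gradient, LinearIsometryEquiv.norm_map]
    rw [h1, EuclideanSpace.norm_eq, Real.sq_sqrt (Finset.sum_nonneg fun _ _ => sq_nonneg _)]
    refine Finset.sum_congr rfl fun j _ => ?_
    rw [e, Real.norm_eq_abs, sq_abs]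
  -- the chain rule for the inverse of the affine map
  have hchain : ∀ x : Pt d, ‖gradient u (M.map k x)‖ ^ 2 ≤ (K / h) ^ 2 * ∑ j, g j x ^ 2 := by
    intro x
    have hue : u = f ∘ (M.map k).symm := by
      funext y; simp [hf]
    have hsd : DifferentiableAt ℝ (M.map k).symm (M.map k x) :=
      (AffineEquiv.toContinuousAffineEquiv (M.map k).symm).toContinuousAffineMap.differentiable _
    have hL : ‖fderiv ℝ (M.map k).symm (M.map k x)‖ ≤ K / h := by
      have := norm_fderiv_le_of_lipschitz ℝ (x₀ := M.map k x) (hM.lipschitz_symm k)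
      rwa [Real.coe_toNNReal _ (by positivity)] at this
    have h1 : ‖gradient u (M.map k x)‖ ≤ ‖fderiv ℝ f x‖ * (K / h) := by
      rw [gradient, LinearIsometryEquiv.norm_map, hue,
        fderiv_comp _ (hfd _) hsd, AffineEquiv.symm_apply_apply]
      exact (ContinuousLinearMap.opNorm_comp_le _ _).trans
        (mul_le_mul_of_nonneg_left hL (norm_nonneg _))
    rw [← hnorm, mul_comm, ← mul_pow]
    exact pow_le_pow_left₀ (norm_nonneg _) h1 2
  have hgc : ∀ j, Continuous (g j) := fun j => continuous_refQ (hg j)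
  refine integral_sq_le_of_lintegral ?_ (by positivity) ?_
  · have : Measurable (fun x => fderiv ℝ u x) := measurable_fderiv ℝ u
    refine Measurable.aestronglyMeasurable ?_
    have e : (fun x => ‖gradient u x‖) = fun x => ‖fderiv ℝ u x‖ := by
      funext x
      rw [gradient, LinearIsometryEquiv.norm_map]
    rw [e]
    exact this.norm
  · refine (lintegral_elem_le hM k _).trans ?_
    rw [ENNReal.ofReal_mul (by positivity)]
    refine mul_le_mul_right ?_ _
    calc ∫⁻ x, ENNReal.ofReal (‖gradient u (M.map k (WithLp.toLp 2 x))‖ ^ 2) ∂cubeMeasure d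
        ≤ ∫⁻ x, ENNReal.ofReal ((K / h) ^ 2) *
            ∑ j, ENNReal.ofReal (g j (WithLp.toLp 2 x) ^ 2) ∂cubeMeasure d := by
          refine lintegral_mono fun x => ?_
          rw [← ENNReal.ofReal_sum_of_nonneg fun _ _ => sq_nonneg _,
            ← ENNReal.ofReal_mul (by positivity)]
          exact ENNReal.ofReal_le_ofReal (hchain _)
      _ = ENNReal.ofReal ((K / h) ^ 2) *
            ∑ j, ∫⁻ x, ENNReal.ofReal (g j (WithLp.toLp 2 x) ^ 2) ∂cubeMeasure d := by
          rw [lintegral_const_mul' _ _ ENNReal.ofReal_ne_top, lintegral_finsetSum]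
          intro j _
          have hc := hgc j
          have : Continuous fun x : Fin d → ℝ => g j (WithLp.toLp 2 x) ^ 2 := by fun_prop
          exact this.measurable.ennreal_ofReal
      _ ≤ ENNReal.ofReal ((K / h) ^ 2) *
            ∑ _j : Fin d, ENNReal.ofReal (96 * p ^ 4 * M.nodeSum p k u) := by
          refine mul_le_mul_right (Finset.sum_le_sum fun j _ => ?_) _
          refine (lintegral_partialDeriv_le hp hu (hg j) j (hder j)).trans ?_
          rw [ENNReal.ofReal_mul (p := 96 * p ^ 4) (by positivity)]
          exact mul_le_mul_right (lintegral_cubeMeasure_le hp hu) _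
      _ = _ := by
          rw [Finset.sum_const, Finset.card_univ, Fintype.card_fin, nsmul_eq_mul,
            ENNReal.ofReal_mul (p := (K / h) ^ 2) (by positivity),
            ENNReal.ofReal_mul (p := (d : ℝ)) (by positivity), ENNReal.ofReal_natCast]

end Mesh

/-! ### Shape regularity and quasi-uniformity -/

namespace Mesh

variable {Ω : Set (Pt d)} {M : Mesh Ω} {K h : ℝ}

lemma mem_refCube_of_norm_lt {x : Pt d} (hx : ‖x‖ < 1) : x ∈ refCube d := fun i => by
  have h1 := (PiLp.norm_apply_le x i).trans_lt hx
  rw [Real.norm_eq_abs, abs_lt] at h1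
  exact h1

lemma norm_le_of_mem_closedCube {x : Pt d} (hx : ∀ i, x i ∈ Set.Icc (-1 : ℝ) 1) : ‖x‖ ≤ √d := by
  rw [EuclideanSpace.norm_eq]
  refine Real.sqrt_le_sqrt ?_
  calc ∑ i, ‖x i‖ ^ 2 ≤ ∑ _i : Fin d, (1 : ℝ) := by
        refine Finset.sum_le_sum fun i _ => ?_
        have := hx i
        rw [Real.norm_eq_abs, sq_abs]
        nlinarith [this.1, this.2]
    _ = d := by simp

lemma isBounded_elem (k : Fin M.N) : Bornology.IsBounded (M.elem k) :=
  (isCompact_closure_elem k).isBounded.subset subset_closure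

lemma elem_nonempty (k : Fin M.N) : (M.elem k).Nonempty :=
  ⟨M.map k 0, 0, mem_refCube_of_norm_lt (by simp), rfl⟩

lemma map_sub_map (k : Fin M.N) (x y : Pt d) :
    M.map k x - M.map k y = (M.map k).linear (x - y) := by
  have := (M.map k).toAffineMap.linearMap_vsub x y
  simpa using this.symm

lemma symm_sub_symm (k : Fin M.N) (x y : Pt d) :
    (M.map k).symm x - (M.map k).symm y = (M.map k).symm.linear (x - y) := by
  have := (M.map k).symm.toAffineMap.linearMap_vsub x y
  simpa using this.symm

/-- The linear part of an element map has norm at most the diameter, since the reference cube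
contains a ball of radius `1`. -/
lemma norm_linear_le (k : Fin M.N) (u : Pt d) : ‖(M.map k).linear u‖ ≤ M.diam k * ‖u‖ := by
  rcases eq_or_ne u 0 with rfl | hu
  · simp
  have hn : 0 < ‖u‖ := norm_pos_iff.2 hu
  set v : Pt d := (2 * ‖u‖)⁻¹ • u with hv
  have hvn : ‖v‖ < 1 := by
    rw [hv, norm_smul, norm_inv, norm_mul, norm_norm, Real.norm_ofNat]
    rw [mul_inv, mul_assoc, inv_mul_cancel₀ hn.ne']; norm_num
  have h1 : dist (M.map k v) (M.map k (-v)) ≤ M.diam k :=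
    Metric.dist_le_diam_of_mem (isBounded_elem k) ⟨v, mem_refCube_of_norm_lt hvn, rfl⟩
      ⟨-v, mem_refCube_of_norm_lt (by rwa [norm_neg]), rfl⟩
  have h2 : v - -v = ‖u‖⁻¹ • u := by
    rw [hv, sub_neg_eq_add, ← add_smul]; congr 1; field_simp; norm_num
  rw [dist_eq_norm, map_sub_map, h2, map_smul, norm_smul, norm_inv, norm_norm,
    inv_mul_le_iff₀ hn] at h1
  linarith

/-- An inscribed ball of radius `ρ` is mapped into the reference cube, of half-diagonal `√d`. -/
lemma norm_linear_symm_le (k : Fin M.N) {c : Pt d} {ρ : ℝ} (hρ : 0 < ρ)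
    (hc : Metric.ball c ρ ⊆ M.elem k) (u : Pt d) :
    ‖(M.map k).symm.linear u‖ ≤ 2 * √d / ρ * ‖u‖ := by
  rcases eq_or_ne u 0 with rfl | hu
  · simp
  have hn : 0 < ‖u‖ := norm_pos_iff.2 hu
  set v : Pt d := (ρ / (2 * ‖u‖)) • u with hv
  have hvn : ‖v‖ < ρ := by
    rw [hv, norm_smul, Real.norm_of_nonneg (by positivity), div_mul_eq_mul_div,
      div_lt_iff₀ (by positivity)]
    nlinarith
  have hmem : ∀ w : Pt d, ‖w‖ < ρ → ‖(M.map k).symm (c + w)‖ ≤ √d := by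
    intro w hw
    obtain ⟨x, hx, hxe⟩ := hc (show c + w ∈ Metric.ball c ρ by simpa [Metric.mem_ball, dist_eq_norm])
    rw [← hxe, AffineEquiv.symm_apply_apply]
    exact norm_le_of_mem_closedCube fun i => ⟨(hx i).1.le, (hx i).2.le⟩
  have h1 : ‖(M.map k).symm (c + v) - (M.map k).symm (c + -v)‖ ≤ 2 * √d := by
    refine (norm_sub_le _ _).trans ?_
    linarith [hmem v hvn, hmem (-v) (by rwa [norm_neg])]
  have h2 : c + v - (c + -v) = (ρ / ‖u‖) • u := by
    rw [hv, add_sub_add_left_eq_sub, sub_neg_eq_add, ← add_smul]; congr 1; field_simp; norm_num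
  rw [symm_sub_symm, h2, map_smul, norm_smul, Real.norm_of_nonneg (by positivity)] at h1
  rw [div_mul_eq_mul_div, le_div_iff₀ hρ]
  rw [div_mul_eq_mul_div, div_le_iff₀ hn] at h1
  linarith

lemma mem_elemsAt {ξ : Pt d} {l : Fin M.N} : l ∈ M.elemsAt ξ ↔ ξ ∈ closure (M.elem l) := by
  classical
  simp [elemsAt]

lemma diam_pos (hd : 0 < d) (k : Fin M.N) : 0 < M.diam k := by
  have h1 := norm_linear_le k (EuclideanSpace.single ⟨0, hd⟩ (1 : ℝ))
  rw [PiLp.norm_single, norm_one, mul_one] at h1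
  refine lt_of_lt_of_le (norm_pos_iff.2 fun h0 => ?_) h1
  have := (LinearEquiv.map_eq_zero_iff _).1 h0
  simp at this

/-- Shape regularity and quasi-uniformity make the mesh maps comparable to a scaling by `h`, and
limit, by comparison of volumes, the number of the elements that meet at a point. -/
theorem exists_scaled (hd : 0 < d) (γ q : ℝ) : ∃ K : ℝ, 1 ≤ K ∧ ∀ {Ω : Set (Pt d)} (M : Mesh Ω),
    0 < M.N → M.ShapeRegular γ → M.QuasiUniform q → ∃ h, M.Scaled K h := by
  refine ⟨1 + |q| + |q| + 2 * √d * |γ| * |q| + (2 * |q| * |γ| * |q|) ^ d, ?_, ?_⟩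
  · rw [add_assoc, add_assoc, add_assoc]
    exact le_add_of_nonneg_right (by positivity)
  intro Ω M hN hγ hq
  set K := 1 + |q| + |q| + 2 * √d * |γ| * |q| + (2 * |q| * |γ| * |q|) ^ d with hK
  set k₀ : Fin M.N := ⟨0, hN⟩
  have hh := diam_pos (M := M) hd k₀
  set h := M.diam k₀ with hh'
  have hq0 : 0 < q := by
    by_contra hcon
    have := hq k₀ k₀
    nlinarith
  have hγ0 : 0 < γ := by
    obtain ⟨c, ρ, hρ, -, h2⟩ := hγ k₀
    by_contra hcon
    nlinarith
  rw [abs_of_pos hq0, abs_of_pos hγ0] at hK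
  have hKq : q ≤ K := by rw [hK]; nlinarith [show 0 ≤ 2 * √d * γ * q + (2 * q * γ * q) ^ d by positivity]
  have hK2 : 2 * √d * γ * q ≤ K := by
    rw [hK]; nlinarith [show 0 ≤ (2 * q * γ * q) ^ d by positivity]
  have hK3 : (2 * q * γ * q) ^ d ≤ K := by
    rw [hK]; nlinarith [show 0 ≤ 2 * √d * γ * q by positivity]
  have hρle : ∀ k : Fin M.N, ∀ ρ, M.diam k ≤ γ * ρ → h / (q * γ) ≤ ρ := by
    intro k ρ h2
    rw [div_le_iff₀ (by positivity)]
    have := hq k₀ k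
    nlinarith
  refine ⟨h, hh, ?_, ?_, ?_, ?_, ?_, ?_⟩
  · rw [hK]; nlinarith [show 0 ≤ 2 * √d * γ * q + (2 * q * γ * q) ^ d by positivity]
  · intro k x y
    rw [dist_eq_norm, dist_eq_norm, map_sub_map]
    refine (norm_linear_le k _).trans (mul_le_mul_of_nonneg_right ?_ (norm_nonneg _))
    exact (hq k k₀).trans (mul_le_mul_of_nonneg_right hKq hh.le)
  · intro k x y
    obtain ⟨c, ρ, hρ, h1, h2⟩ := hγ k
    rw [dist_eq_norm, dist_eq_norm, symm_sub_symm]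
    refine (norm_linear_symm_le k hρ h1 _).trans (mul_le_mul_of_nonneg_right ?_ (norm_nonneg _))
    have h3 := hρle k ρ h2
    rw [div_le_iff₀ (by positivity)] at h3
    rw [div_le_div_iff₀ hρ hh]
    calc 2 * √d * h ≤ 2 * √d * (ρ * (q * γ)) := by gcongr
      _ = 2 * √d * γ * q * ρ := by ring
      _ ≤ K * ρ := by gcongr
  · intro k
    exact (hq k k₀).trans (mul_le_mul_of_nonneg_right hKq hh.le)
  · intro k
    exact (hq k₀ k).trans (mul_le_mul_of_nonneg_right hKq (diam_pos hd k).le)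
  · intro ξ
    refine le_trans ?_ hK3
    choose c ρ hρ hball hle using hγ
    set r := h / (q * γ) with hr
    have hr0 : 0 < r := by positivity
    set R := 2 * q * h with hR
    have hR0 : 0 < R := by positivity
    have hsub : ∀ k, Metric.ball (c k) r ⊆ M.elem k := fun k =>
      (Metric.ball_subset_ball (hρle k _ (hle k))).trans (hball k)
    have hdisj : (↑(M.elemsAt ξ) : Set (Fin M.N)).PairwiseDisjoint
        (fun k => Metric.ball (c k) r) := fun k _ l _ hkl =>
      (M.disjoint k l hkl).mono (hsub k) (hsub l)
    have hbig : (⋃ k ∈ M.elemsAt ξ, Metric.ball (c k) r) ⊆ Metric.ball ξ R := by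
      refine Set.iUnion₂_subset fun k hk x hx => ?_
      have h1 : dist x ξ ≤ Metric.diam (closure (M.elem k)) :=
        Metric.dist_le_diam_of_mem (isCompact_closure_elem k).isBounded
          (subset_closure (hsub k hx)) (mem_elemsAt.1 hk)
      rw [Metric.diam_closure] at h1
      have h2 := hq k k₀
      have h3 : dist x ξ ≤ q * h := h1.trans h2
      rw [Metric.mem_ball]
      nlinarith [mul_pos hq0 hh]
    have hvol := measure_mono (μ := (volume : Measure (Pt d))) hbig
    rw [measure_biUnion_finset hdisj fun k _ => measurableSet_ball] at hvol
    simp only [Measure.addHaar_ball_of_pos _ _ hr0, Measure.addHaar_ball_of_pos _ _ hR0,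
      finrank_euclideanSpace, Fintype.card_fin, Finset.sum_const, nsmul_eq_mul] at hvol
    rw [← mul_assoc] at hvol
    have h0 : (volume : Measure (Pt d)) (Metric.ball 0 1) ≠ 0 :=
      (Metric.measure_ball_pos _ _ one_pos).ne'
    have h1 : (volume : Measure (Pt d)) (Metric.ball 0 1) ≠ ⊤ := measure_ball_lt_top.ne
    rw [ENNReal.mul_le_mul_iff_left h0 h1, ← ENNReal.ofReal_natCast,
      ← ENNReal.ofReal_mul (by positivity), ENNReal.ofReal_le_ofReal_iff (by positivity)] at hvol
    have h2 : R = 2 * q * γ * q * r := by rw [hR, hr]; field_simp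
    rw [h2, mul_pow] at hvol
    exact le_of_mul_le_mul_right hvol (by positivity)

end Mesh

/-! ### Affine maps between faces of the cube -/

lemma sgn_eq (b : Bool) : sgn b = 1 ∨ sgn b = -1 := by cases b <;> simp [sgn]

lemma sgn_mul_self (b : Bool) : sgn b * sgn b = 1 := by cases b <;> simp [sgn]

lemma sgn_ne_zero (b : Bool) : sgn b ≠ 0 := by cases b <;> simp [sgn]

lemma sgn_mem_Icc (b : Bool) : sgn b ∈ Set.Icc (-1 : ℝ) 1 := by cases b <;> simp [sgn]

lemma abs_sgn (b : Bool) : |sgn b| = 1 := by cases b <;> simp [sgn]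

lemma sgn_injective : Function.Injective sgn := by
  intro b b' h
  cases b <;> cases b' <;> simp [sgn] at h ⊢ <;> norm_num at h

/-- The point of a face with the given free coordinates. -/
def facePt (s : Fin d → Option Bool) (y : Fin d → ℝ) : Pt d :=
  WithLp.toLp 2 fun i => (s i).elim (y i) sgn

lemma facePt_mem (s : Fin d → Option Bool) {y : Fin d → ℝ} (hy : ∀ i, y i ∈ Set.Icc (-1 : ℝ) 1) :
    facePt s y ∈ refFace s := by
  intro i
  simp only [facePt]
  cases hs : s i with
  | none => exact ⟨hy i, by simp⟩
  | some b => exact ⟨sgn_mem_Icc b, by rintro b' ⟨⟩; rfl⟩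

lemma affine_sub (T : Pt d ≃ᵃ[ℝ] Pt d) (x y : Pt d) : T x - T y = T.linear (x - y) := by
  have := T.toAffineMap.linearMap_vsub x y
  simpa using this.symm

/-- The matrix entries of the linear part of an affine equivalence. -/
def entry (T : Pt d ≃ᵃ[ℝ] Pt d) (i j : Fin d) : ℝ := T.linear (EuclideanSpace.single j 1) i

lemma linear_apply_eq_sum (T : Pt d ≃ᵃ[ℝ] Pt d) (v : Pt d) (i : Fin d) :
    T.linear v i = ∑ j, entry T i j * v j := by
  have hv : v = ∑ j, v j • EuclideanSpace.single j (1 : ℝ) := by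
    ext i
    simp [Finset.sum_apply, Pi.single_apply]
  conv_lhs => rw [hv]
  rw [map_sum]
  simp only [map_smul, WithLp.ofLp_sum, WithLp.ofLp_smul, Finset.sum_apply, Pi.smul_apply,
    smul_eq_mul, entry]
  exact Finset.sum_congr rfl fun j _ => mul_comm _ _

lemma sum_entry_mul_symm (T : Pt d ≃ᵃ[ℝ] Pt d) (i j : Fin d) :
    ∑ k, entry T i k * entry T.symm k j = if i = j then 1 else 0 := by
  have h := linear_apply_eq_sum T (T.symm.linear (EuclideanSpace.single j 1)) i
  rw [show T.linear (T.symm.linear (EuclideanSpace.single j (1 : ℝ))) = EuclideanSpace.single j 1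
    from T.linear.apply_symm_apply _] at h
  rw [show ∑ k, entry T i k * entry T.symm k j = _ from h.symm]
  simp

/-- An affine map between faces keeps the frozen coordinates of the image constant along the free
directions of the source. -/
lemma entry_eq_zero {T : Pt d ≃ᵃ[ℝ] Pt d} {s t : Fin d → Option Bool}
    (hT : T '' refFace s = refFace t) {i j : Fin d} (hi : t i ≠ none) (hj : s j = none) :
    entry T i j = 0 := by
  obtain ⟨b, hb⟩ := Option.ne_none_iff_exists'.1 hi
  have h1 : T (facePt s (Pi.single j 1)) ∈ refFace t := hT ▸ ⟨_, facePt_mem s fun k => by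
    by_cases hk : k = j
    · subst hk; simp
    · simp [hk], rfl⟩
  have h2 : T (facePt s 0) ∈ refFace t := hT ▸ ⟨_, facePt_mem s fun k => by simp, rfl⟩
  have h3 : facePt s (Pi.single j 1) - facePt s 0 = EuclideanSpace.single j 1 := by
    ext k
    by_cases hk : k = j
    · subst hk; simp [facePt, hj]
    · simp [facePt, hk]
  have h4 := congrArg (fun v : Pt d => v i) (affine_sub T (facePt s (Pi.single j 1)) (facePt s 0))
  simp only [h3, PiLp.sub_apply, (h1 i).2 b hb, (h2 i).2 b hb, sub_self] at h4
  exact h4.symm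

/-- The free coordinates of the image of a face as affine functions: the constant term and the
coefficients have absolute values with sum at most one. -/
lemma abs_add_sum_abs_entry_le {T : Pt d ≃ᵃ[ℝ] Pt d} {s t : Fin d → Option Bool}
    (hT : T '' refFace s = refFace t) (i : Fin d) :
    |T (facePt s 0) i| + ∑ j ∈ Finset.univ.filter (fun j => s j = none), |entry T i j| ≤ 1 := by
  classical
  have key : ∀ y : Fin d → ℝ, (∀ k, y k ∈ Set.Icc (-1 : ℝ) 1) →
      |T (facePt s 0) i + ∑ j ∈ Finset.univ.filter (fun j => s j = none), entry T i j * y j| ≤ 1 := by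
    intro y hy
    have h1 : T (facePt s y) ∈ refFace t := hT ▸ ⟨_, facePt_mem s hy, rfl⟩
    have h2 := congrArg (fun v : Pt d => v i) (affine_sub T (facePt s y) (facePt s 0))
    simp only [PiLp.sub_apply, linear_apply_eq_sum] at h2
    have h3 : ∑ j, entry T i j * ((facePt s y) j - (facePt s 0) j) =
        ∑ j ∈ Finset.univ.filter (fun j => s j = none), entry T i j * y j := by
      rw [Finset.sum_filter]
      refine Finset.sum_congr rfl fun j _ => ?_
      cases hs : s j <;> simp [facePt, hs]
    rw [h3] at h2
    rw [← h2, add_sub_cancel, abs_le]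
    exact (h1 i).1
  set c := T (facePt s 0) i with hc
  set σ : ℝ := if 0 ≤ c then 1 else -1 with hσ
  have h1 := key (fun j => σ * if 0 ≤ entry T i j then 1 else -1) fun k => by
    rw [hσ]; split_ifs <;> norm_num
  have h2 : ∑ j ∈ Finset.univ.filter (fun j => s j = none),
      entry T i j * (σ * if 0 ≤ entry T i j then 1 else -1) =
      σ * ∑ j ∈ Finset.univ.filter (fun j => s j = none), |entry T i j| := by
    rw [Finset.mul_sum]
    refine Finset.sum_congr rfl fun j _ => ?_
    split_ifs with h
    · rw [abs_of_nonneg h]; ring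
    · rw [abs_of_neg (not_le.1 h)]; ring
  rw [h2] at h1
  have h3 : 0 ≤ ∑ j ∈ Finset.univ.filter (fun j => s j = none), |entry T i j| :=
    Finset.sum_nonneg fun _ _ => abs_nonneg _
  rw [abs_le] at h1
  by_cases h : 0 ≤ c
  · rw [hσ, if_pos h] at h1
    rw [abs_of_nonneg h]; linarith [h1.2]
  · rw [hσ, if_neg h] at h1
    rw [abs_of_neg (not_le.1 h)]; linarith [h1.1]

lemma symm_image_refFace {T : Pt d ≃ᵃ[ℝ] Pt d} {s t : Fin d → Option Bool}
    (hT : T '' refFace s = refFace t) : T.symm '' refFace t = refFace s := by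
  rw [← hT, ← Set.image_comp]
  simp

/-- Each free coordinate of the image is plus or minus a free coordinate. -/
lemma exists_free_coordinate {T : Pt d ≃ᵃ[ℝ] Pt d} {s t : Fin d → Option Bool}
    (hT : T '' refFace s = refFace t) {i : Fin d} (hi : t i = none) :
    ∃ j, s j = none ∧ entry T.symm j i ≠ 0 ∧ |entry T i j| = 1 ∧
      (∀ k, s k = none → k ≠ j → entry T i k = 0) ∧ T (facePt s 0) i = 0 := by
  classical
  have hT' := symm_image_refFace hT
  have hrow := abs_add_sum_abs_entry_le hT
  have hrow' := abs_add_sum_abs_entry_le hT'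
  have h1 := sum_entry_mul_symm T i i
  rw [if_pos rfl] at h1
  obtain ⟨j, -, hj⟩ := Finset.exists_ne_zero_of_sum_ne_zero (by rw [h1]; exact one_ne_zero)
  have hjB : entry T.symm j i ≠ 0 := right_ne_zero_of_mul hj
  have hjs : s j = none := by
    by_contra hcon
    exact hjB (entry_eq_zero hT' hcon hi)
  -- a column of the inverse with sum of absolute values one picks rows with an entry `± 1`
  have h2 := sum_entry_mul_symm T.symm j j
  rw [if_pos rfl, show T.symm.symm = T from rfl] at h2
  have hle : ∀ k, |entry T k j| ≤ 1 := fun k => by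
    have := hrow k
    have h3 := Finset.single_le_sum (f := fun j => |entry T k j|) (fun _ _ => abs_nonneg _)
      (show j ∈ Finset.univ.filter (fun j => s j = none) by simp [hjs])
    linarith [abs_nonneg (T (facePt s 0) k)]
  have h3 : ∑ k ∈ Finset.univ.filter (fun k => t k = none), entry T.symm j k * entry T k j = 1 := by
    rw [← h2, Finset.sum_filter]
    refine Finset.sum_congr rfl fun k _ => ?_
    split_ifs with h
    · rfl
    · rw [entry_eq_zero hT h hjs, mul_zero]
  have h4 : ∑ k ∈ Finset.univ.filter (fun k => t k = none),
      |entry T.symm j k| * (1 - |entry T k j|) ≤ 0 := by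
    have h5 : ∑ k ∈ Finset.univ.filter (fun k => t k = none),
        entry T.symm j k * entry T k j ≤ ∑ k ∈ Finset.univ.filter (fun k => t k = none),
        |entry T.symm j k| * |entry T k j| :=
      Finset.sum_le_sum fun k _ => by rw [← abs_mul]; exact le_abs_self _
    simp only [mul_sub, mul_one, Finset.sum_sub_distrib]
    linarith [hrow' j, abs_nonneg (T.symm (facePt t 0) j)]
  have h5 : |entry T.symm j i| * (1 - |entry T i j|) ≤ 0 := by
    refine le_trans ?_ h4
    exact Finset.single_le_sum (f := fun k => |entry T.symm j k| * (1 - |entry T k j|))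
      (fun k _ => mul_nonneg (abs_nonneg _) (sub_nonneg.2 (hle k))) (by simp [hi])
  have h6 : |entry T i j| = 1 := by
    have := abs_pos.2 hjB
    nlinarith [hle i]
  have h7 := hrow i
  rw [← Finset.add_sum_erase _ _ (show j ∈ Finset.univ.filter (fun j => s j = none) by
    simp [hjs]), h6] at h7
  have h8 : 0 ≤ ∑ k ∈ (Finset.univ.filter (fun j => s j = none)).erase j, |entry T i k| :=
    Finset.sum_nonneg fun _ _ => abs_nonneg _
  refine ⟨j, hjs, hjB, h6, fun k hk hkj => ?_, ?_⟩
  · have h9 := Finset.single_le_sum (f := fun k => |entry T i k|) (fun _ _ => abs_nonneg _)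
      (show k ∈ (Finset.univ.filter (fun j => s j = none)).erase j by simp [hk, hkj])
    have := abs_nonneg (T (facePt s 0) i)
    exact abs_eq_zero.1 (le_antisymm (by linarith) (abs_nonneg _))
  · exact abs_eq_zero.1 (le_antisymm (by linarith) (abs_nonneg _))

/-- An affine equivalence that maps a face of the cube onto a face of the cube acts there as a
signed permutation of the coordinates. -/
theorem exists_signedPerm {T : Pt d ≃ᵃ[ℝ] Pt d} {s t : Fin d → Option Bool}
    (hT : T '' refFace s = refFace t) : ∃ (π : Equiv.Perm (Fin d)) (ε : Fin d → ℝ),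
      (∀ i, ε i = 1 ∨ ε i = -1) ∧ ∀ x ∈ refFace s, ∀ i, T x i = ε i * x (π i) := by
  classical
  have hT' := symm_image_refFace hT
  -- matching of free coordinates, injective in both directions
  have hex : ∀ {T : Pt d ≃ᵃ[ℝ] Pt d} {s t : Fin d → Option Bool}, T '' refFace s = refFace t →
      ∃ f : {i // t i = none} → {j // s j = none}, Function.Injective f ∧
        ∀ i : {i // t i = none}, |entry T i (f i)| = 1 ∧ (∀ k, s k = none → k ≠ f i → entry T i k = 0) ∧
          T (facePt s 0) i = 0 := by
    intro T s t hT
    have h := fun i : {i // t i = none} => exists_free_coordinate hT i.2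
    choose f hfs hB h1 h2 h3 using h
    refine ⟨fun i => ⟨f i, hfs i⟩, ?_, fun i => ⟨h1 i, h2 i, h3 i⟩⟩
    intro i i' hii
    have hff : f i = f i' := congrArg Subtype.val hii
    by_contra hne
    have hne' : (i : Fin d) ≠ i' := fun h => hne (Subtype.ext h)
    have h4 := sum_entry_mul_symm T i i'
    rw [if_neg hne', Finset.sum_eq_single (f i)] at h4
    · rcases mul_eq_zero.1 h4 with h | h
      · have := h1 i; rw [h] at this; simp at this
      · exact hB i' (hff ▸ h)
    · intro k _ hk
      by_cases hs : s k = none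
      · rw [h2 i k hs hk, zero_mul]
      · rw [entry_eq_zero (symm_image_refFace hT) hs i'.2, mul_zero]
    · simp
  obtain ⟨f, hf, hfT⟩ := hex hT
  obtain ⟨g, hg, -⟩ := hex hT'
  have hbij : Function.Bijective f := (Fintype.bijective_iff_injective_and_card f).2
    ⟨hf, le_antisymm (Fintype.card_le_of_injective f hf) (Fintype.card_le_of_injective g hg)⟩
  set e : {i // t i = none} ≃ {j // s j = none} := Equiv.ofBijective f hbij with he
  refine ⟨e.extendSubtype, ?_⟩
  have hε : ∀ i, ∃ ε : ℝ, (ε = 1 ∨ ε = -1) ∧ ∀ x ∈ refFace s, T x i = ε * x (e.extendSubtype i) := by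
    intro i
    by_cases hi : t i = none
    · obtain ⟨h1, h2, h3⟩ := hfT ⟨i, hi⟩
      set j := f ⟨i, hi⟩ with hj
      have hπ : e.extendSubtype i = j := e.extendSubtype_apply_of_mem i hi
      refine ⟨entry T i j, ?_, fun x hx => ?_⟩
      · rcases abs_cases (entry T i j) with h | h
        · left; rw [← h.1]; exact h1
        · right; rw [← neg_neg (entry T i j), ← h.1]; exact congrArg Neg.neg h1
      · have h4 := congrArg (fun v : Pt d => v i) (affine_sub T x (facePt s 0))
        simp only [PiLp.sub_apply, h3, sub_zero, linear_apply_eq_sum] at h4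
        rw [h4, hπ, Finset.sum_eq_single (j : Fin d)]
        · simp [facePt, j.2]
        · intro k _ hk
          by_cases hs : s k = none
          · rw [h2 k hs hk, zero_mul]
          · obtain ⟨b, hb⟩ := Option.ne_none_iff_exists'.1 hs
            rw [(hx k).2 b hb]
            simp [facePt, hb]
        · simp
    · obtain ⟨b, hb⟩ := Option.ne_none_iff_exists'.1 hi
      have hs : s (e.extendSubtype i) ≠ none := e.extendSubtype_not_mem i hi
      obtain ⟨b', hb'⟩ := Option.ne_none_iff_exists'.1 hs
      refine ⟨sgn b * sgn b', ?_, fun x hx => ?_⟩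
      · cases b <;> cases b' <;> simp [sgn]
      · have hTx : T x ∈ refFace t := hT ▸ ⟨x, hx, rfl⟩
        rw [(hTx i).2 b hb, (hx _).2 b' hb', mul_assoc, sgn_mul_self, mul_one]
  choose ε hε1 hε2 using hε
  exact ⟨ε, hε1, fun x hx i => hε2 i x hx⟩

/-! ### Facets of the cube -/

/-- The index of a facet among the faces. -/
def facetIdx (j : Fin d) (b : Bool) : Fin d → Option Bool :=
  Function.update (fun _ => none) j (some b)

lemma refFace_facetIdx (j : Fin d) (b : Bool) : refFace (facetIdx j b) = refFacet j b := by
  ext x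
  constructor
  · intro hx
    exact ⟨fun i => (hx i).1, (hx j).2 b (by simp [facetIdx])⟩
  · rintro ⟨h1, h2⟩ i
    refine ⟨h1 i, fun b' hb' => ?_⟩
    by_cases hi : i = j
    · subst hi
      simp only [facetIdx, Function.update_self, Option.some.injEq] at hb'
      rw [h2, hb']
    · simp [facetIdx, hi] at hb'

lemma facetCenter_mem (j : Fin d) (b : Bool) :
    (EuclideanSpace.single j (sgn b) : Pt d) ∈ refFacet j b := by
  refine ⟨fun i => ?_, by simp⟩
  by_cases hi : i = j
  · subst hi; simpa using sgn_mem_Icc b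
  · simp [hi]

lemma refFacet_injective {j j' : Fin d} {b b' : Bool} (h : refFacet j b = refFacet j' b') :
    j = j' ∧ b = b' := by
  have h1 : (EuclideanSpace.single j (sgn b) : Pt d) ∈ refFacet j' b' := h ▸ facetCenter_mem j b
  have h2 : (EuclideanSpace.single j (sgn b) : Pt d) j' = sgn b' := h1.2
  have hj : j = j' := by
    by_contra hne
    have : (EuclideanSpace.single j (sgn b) : Pt d) j' = 0 := by simp [Ne.symm hne]
    exact sgn_ne_zero b' (by rw [← h2, this])
  subst hj
  exact ⟨rfl, sgn_injective (by simpa using h2)⟩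

section

variable {T : Pt d ≃ᵃ[ℝ] Pt d} {j j' : Fin d} {b b' : Bool}

/-- The coordinate normal to a facet is mapped to the one normal to the image. -/
lemma map_facet_coordinate (hT : T '' refFacet j b = refFacet j' b') (x : Pt d) :
    T x j' = sgn b' + entry T j' j * (x j - sgn b) := by
  have hT' : T '' refFace (facetIdx j b) = refFace (facetIdx j' b') := by
    rwa [refFace_facetIdx, refFace_facetIdx]
  have h0 : T (EuclideanSpace.single j (sgn b)) ∈ refFacet j' b' := hT ▸ ⟨_, facetCenter_mem j b, rfl⟩
  have h1 := congrArg (fun v : Pt d => v j') (affine_sub T x (EuclideanSpace.single j (sgn b)))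
  simp only [PiLp.sub_apply, linear_apply_eq_sum] at h1
  rw [Finset.sum_eq_single j, h0.2] at h1
  · simp only [PiLp.single_apply, if_true] at h1
    linarith
  · intro k _ hk
    rw [entry_eq_zero hT' (by simp [facetIdx]) (by simp [facetIdx, hk]), zero_mul]
  · simp

lemma entry_facet_ne_zero (hT : T '' refFacet j b = refFacet j' b') : entry T j' j ≠ 0 := by
  intro h0
  have h1 := map_facet_coordinate hT (T.symm 0)
  rw [AffineEquiv.apply_symm_apply, h0, zero_mul, add_zero] at h1
  exact sgn_ne_zero b' h1.symm

lemma map_facetCenter (hT : T '' refFacet j b = refFacet j' b') :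
    T (EuclideanSpace.single j (sgn b)) = EuclideanSpace.single j' (sgn b') := by
  have hT' : T '' refFace (facetIdx j b) = refFace (facetIdx j' b') := by
    rwa [refFace_facetIdx, refFace_facetIdx]
  obtain ⟨π, ε, -, h⟩ := exists_signedPerm hT'
  rw [refFace_facetIdx] at h
  have hc := facetCenter_mem j b
  have h0 : T (EuclideanSpace.single j (sgn b)) ∈ refFacet j' b' := hT ▸ ⟨_, hc, rfl⟩
  have h1 := h _ hc j'
  rw [h0.2] at h1
  have hπ : π j' = j := by
    by_contra hne
    have : (EuclideanSpace.single j (sgn b) : Pt d) (π j') = 0 := by simp [hne]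
    rw [this, mul_zero] at h1
    exact sgn_ne_zero b' h1
  ext i
  by_cases hi : i = j'
  · subst hi; rw [h0.2]; simp
  · rw [h _ hc i]
    have : π i ≠ j := fun he => hi (π.injective (he.trans hπ.symm))
    simp [this, hi]

/-- If the open cubes do not overlap, the orientation is reversed in the normal direction. -/
lemma entry_facet_neg (hT : T '' refFacet j b = refFacet j' b')
    (hdis : Disjoint (T '' refCube d) (refCube d)) : sgn b * sgn b' * entry T j' j < 0 := by
  by_contra hcon
  have hne : sgn b * sgn b' * entry T j' j ≠ 0 :=
    mul_ne_zero (mul_ne_zero (sgn_ne_zero _) (sgn_ne_zero _)) (entry_facet_ne_zero hT)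
  have hpos : 0 < sgn b * sgn b' * entry T j' j := lt_of_le_of_ne (not_lt.1 hcon) (Ne.symm hne)
  set c := entry T j' j with hc
  -- points slightly below the centre of the facet would belong to both cubes
  set x : ℝ → Pt d := fun δ => EuclideanSpace.single j ((1 - δ) * sgn b) with hx
  have hxc : Continuous x := by
    have : x = fun δ => ((1 - δ) * sgn b) • EuclideanSpace.single j (1 : ℝ) := by
      funext δ
      ext i
      simp [hx]
    rw [this]; fun_prop
  have hTc : Continuous T := (AffineEquiv.toContinuousAffineEquiv T).continuous
  have hcont : Continuous fun δ => T (x δ) := hTc.comp hxc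
  have h0 : T (x 0) = EuclideanSpace.single j' (sgn b') := by
    rw [← map_facetCenter hT]; simp [hx]
  have hothers : ∀ᶠ δ in nhdsWithin (0 : ℝ) (Set.Ioi 0), ∀ i, i ≠ j' → T (x δ) i ∈ Set.Ioo (-1 : ℝ) 1 := by
    refine nhdsWithin_le_nhds ?_
    refine Filter.eventually_all.2 fun i => ?_
    by_cases hi : i = j'
    · simp [hi]
    · have hci : Continuous fun δ => T (x δ) i := by fun_prop
      have : (fun δ => T (x δ) i) 0 ∈ Set.Ioo (-1 : ℝ) 1 := by simp [h0, hi]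
      filter_upwards [hci.continuousAt.eventually (isOpen_Ioo.mem_nhds this)] with δ hδ _
      exact hδ
  have hsmall : ∀ᶠ δ in nhdsWithin (0 : ℝ) (Set.Ioi 0),
      δ < 1 ∧ δ * (sgn b * sgn b' * c) < 1 := by
    refine nhdsWithin_le_nhds ?_
    have h1 : Continuous fun δ : ℝ => δ * (sgn b * sgn b' * c) := by fun_prop
    filter_upwards [isOpen_Iio.mem_nhds (show (0 : ℝ) < 1 from one_pos),
      h1.continuousAt.eventually (isOpen_Iio.mem_nhds (show (fun δ : ℝ => δ * (sgn b * sgn b' * c)) 0 < 1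
        by simp))] with δ h1 h2
    exact ⟨h1, h2⟩
  obtain ⟨δ, ⟨h1, h2, h3⟩, hδ⟩ := ((hothers.and hsmall).and self_mem_nhdsWithin).exists
  have hδ0 : 0 < δ := hδ
  refine Set.disjoint_left.1 hdis ⟨x δ, fun i => ?_, rfl⟩ fun i => ?_
  · by_cases hi : i = j
    · subst hi
      simp only [hx, PiLp.single_apply, if_true]
      rcases sgn_eq b with h | h <;> rw [h] <;> constructor <;> linarith
    · simp [hx, hi]
  · by_cases hi : i = j'
    · subst hi
      rw [map_facet_coordinate hT]
      simp only [hx, PiLp.single_apply, if_true]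
      have e : sgn b' + c * ((1 - δ) * sgn b - sgn b) =
          sgn b' * (1 - δ * (sgn b * sgn b' * c)) := by
        have := sgn_mul_self b'
        linear_combination (c * δ * sgn b) * this
      rw [e]
      have hp : 0 < δ * (sgn b * sgn b' * c) := mul_pos hδ0 hpos
      rcases sgn_eq b' with h | h <;> rw [h] at hp h3 ⊢ <;> constructor <;> linarith
    · exact h1 i hi

end

namespace Mesh

variable {Ω : Set (Pt d)} {M : Mesh Ω} {K h : ℝ}

/-! ### Neighbouring elements -/

lemma closure_refCube : closure (refCube d) = refFace fun _ => none := by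
  refine Set.Subset.antisymm ?_ fun x hx => ?_
  · have h1 : refFace (fun _ : Fin d => none) =
        ⋂ i, (fun x : Pt d => x i) ⁻¹' Set.Icc (-1 : ℝ) 1 := by
      ext x; simp [refFace]
    refine closure_minimal (fun x hx i => ⟨⟨(hx i).1.le, (hx i).2.le⟩, by simp⟩) ?_
    rw [h1]
    exact isClosed_iInter fun i => isClosed_Icc.preimage (by fun_prop)
  · have hc : Continuous fun t : ℝ => t • x := by fun_prop
    have h1 : (1 : ℝ) ∈ closure (Set.Ioo (0 : ℝ) 1) := by
      rw [closure_Ioo (by norm_num)]; simp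
    have h2 := map_mem_closure hc h1 (t := refCube d) fun t ht i => by
      have h3 := (hx i).1
      simp only [PiLp.smul_apply, smul_eq_mul]
      constructor <;> nlinarith [ht.1, ht.2, h3.1, h3.2]
    simpa using h2

lemma closure_elem (k : Fin M.N) : closure (M.elem k) = M.map k '' refFace fun _ => none := by
  rw [← closure_refCube]
  exact ((M.homeo k).image_closure _).symm

lemma mem_closure_elem {k : Fin M.N} {x : Pt d} :
    x ∈ closure (M.elem k) ↔ ∀ i, (M.map k).symm x i ∈ Set.Icc (-1 : ℝ) 1 := by
  rw [closure_elem]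
  constructor
  · rintro ⟨y, hy, rfl⟩ i
    rw [AffineEquiv.symm_apply_apply]
    exact (hy i).1
  · intro hx
    exact ⟨(M.map k).symm x, fun i => ⟨hx i, by simp⟩, by simp⟩

lemma mem_elem {k : Fin M.N} {x : Pt d} :
    x ∈ M.elem k ↔ ∀ i, (M.map k).symm x i ∈ Set.Ioo (-1 : ℝ) 1 := by
  constructor
  · rintro ⟨y, hy, rfl⟩ i
    rw [AffineEquiv.symm_apply_apply]
    exact hy i
  · intro hx
    exact ⟨(M.map k).symm x, hx, by simp⟩

lemma mem_facet {σ : M.Side} {x : Pt d} :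
    x ∈ M.facet σ ↔ (M.map σ.1).symm x ∈ refFacet σ.2.1 σ.2.2 := by
  constructor
  · rintro ⟨y, hy, rfl⟩
    rwa [AffineEquiv.symm_apply_apply]
  · intro hx
    exact ⟨(M.map σ.1).symm x, hx, by simp⟩

lemma facet_subset_closure (σ : M.Side) : M.facet σ ⊆ closure (M.elem σ.1) := fun _ hx =>
  mem_closure_elem.2 (mem_facet.1 hx).1

/-- The change of coordinates between two elements. -/
def transition (M : Mesh Ω) (k l : Fin M.N) : Pt d ≃ᵃ[ℝ] Pt d := (M.map k).trans (M.map l).symm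

lemma transition_apply (k l : Fin M.N) (x : Pt d) :
    M.transition k l x = (M.map l).symm (M.map k x) := rfl

lemma map_transition (k l : Fin M.N) (x : Pt d) :
    M.map l (M.transition k l x) = M.map k x := by simp [transition_apply]

lemma transition_image {k l : Fin M.N} {A B : Set (Pt d)} (h : M.map k '' A = M.map l '' B) :
    M.transition k l '' A = B := by
  have : M.transition k l '' A = (M.map l).symm '' (M.map k '' A) := by
    rw [← Set.image_comp]; rfl
  rw [this, h, ← Set.image_comp]
  simp

lemma node_eq_iff {l : Fin M.N} {a : NodeIdx d p} {x : Pt d} :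
    M.node l a = x ↔ ∀ i, (a i : ℝ) = (M.map l).symm x i := by
  rw [node, ← AffineEquiv.eq_symm_apply]
  constructor
  · rintro h i
    rw [← h]; rfl
  · intro h
    ext i
    exact h i

lemma gllWeight_signed (hp : 1 < p) {ε t : ℝ} (hε : ε = 1 ∨ ε = -1) (ht : t ∈ gllNodes p) :
    ε * t ∈ gllNodes p ∧ gllWeight p (ε * t) = gllWeight p t := by
  rcases hε with rfl | rfl
  · simpa using ht
  · rw [neg_one_mul]
    exact ⟨neg_mem_gllNodes hp ht, gllWeight_neg hp ht⟩

/-- The nodes of two elements match on their intersection, with equal weights. -/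
lemma exists_node_eq (hp : 1 < p) {k l : Fin M.N} {a : NodeIdx d p}
    (hl : M.node k a ∈ closure (M.elem l)) :
    ∃ a' : NodeIdx d p, M.node l a' = M.node k a ∧ nodeWeight a' = nodeWeight a := by
  by_cases hkl : k = l
  · subst hkl; exact ⟨a, rfl, rfl⟩
  have hk : M.node k a ∈ closure (M.elem k) := by
    rw [closure_elem]
    exact ⟨refNode a, fun i => ⟨gllNodes_subset_Icc hp (a i).2, by simp⟩, rfl⟩
  rcases M.conforming k l hkl with hdis | ⟨s, t, hs, ht⟩
  · exact absurd hl (Set.disjoint_left.1 hdis hk)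
  have hT := transition_image (hs.symm.trans ht)
  obtain ⟨π, ε, hε, hTx⟩ := exists_signedPerm hT
  have hmem : refNode a ∈ refFace s := by
    have : M.node k a ∈ M.map k '' refFace s := hs ▸ ⟨hk, hl⟩
    obtain ⟨y, hy, hye⟩ := this
    rwa [← (M.map k).injective hye]
  have h1 := hTx _ hmem
  refine ⟨fun i => ⟨ε i * a (π i), (gllWeight_signed hp (hε i) (a (π i)).2).1⟩, ?_, ?_⟩
  · rw [node_eq_iff]
    intro i
    rw [node, ← transition_apply, h1]
    rfl
  · rw [nodeWeight, nodeWeight]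
    rw [← Equiv.prod_comp π fun i => gllWeight p (a i)]
    exact Finset.prod_congr rfl fun i _ => (gllWeight_signed hp (hε i) (a (π i)).2).2

lemma transition_image_facet {σ τ : M.Side} (h : M.facet σ = M.facet τ) :
    M.transition σ.1 τ.1 '' refFacet σ.2.1 σ.2.2 = refFacet τ.2.1 τ.2.2 :=
  transition_image h

lemma side_eq_of_facet_eq {σ τ : M.Side} (h : M.facet σ = M.facet τ) (h1 : σ.1 = τ.1) :
    σ = τ := by
  obtain ⟨k, j, b⟩ := σ
  obtain ⟨l, j', b'⟩ := τ
  obtain rfl : k = l := h1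
  have := (M.map k).injective.image_injective h
  obtain ⟨rfl, rfl⟩ := refFacet_injective this
  rfl

/-- A polynomial of a neighbour agrees on the common facet with a polynomial of the element. -/
lemma exists_isPolyOn_eq_on_facet {σ τ : M.Side} (h : M.facet σ = M.facet τ)
    {u : Pt d → ℝ} (hu : M.IsPolyOn p τ.1 u) :
    ∃ w, M.IsPolyOn p σ.1 w ∧ ∀ x ∈ M.facet σ, w x = u x := by
  have hT := transition_image_facet h
  rw [← refFace_facetIdx, ← refFace_facetIdx] at hT
  obtain ⟨π, ε, -, hTx⟩ := exists_signedPerm hT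
  refine ⟨fun x => u (M.map τ.1 (WithLp.toLp 2 fun i => ε i * (M.map σ.1).symm x (π i))), ?_, ?_⟩
  · have := refQ_comp_signedPerm hu π ε
    simpa [IsPolyOn] using this
  · intro x hx
    have hx' := mem_facet.1 hx
    rw [← refFace_facetIdx] at hx'
    have h1 : (WithLp.toLp 2 fun i => ε i * (M.map σ.1).symm x (π i) : Pt d) =
        M.transition σ.1 τ.1 ((M.map σ.1).symm x) := by
      ext i
      exact (hTx _ hx' i).symm
    simp only [h1, map_transition, AffineEquiv.apply_symm_apply]

/-- The covector whose normalization is the normal of a side. -/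
def conormal (M : Mesh Ω) (σ : M.Side) : Pt d :=
  LinearMap.adjoint ((M.map σ.1).symm.linear : Pt d →ₗ[ℝ] Pt d) (EuclideanSpace.single σ.2.1 1)

lemma inner_conormal (σ : M.Side) (y : Pt d) :
    ⟪M.conormal σ, y⟫ = (M.map σ.1).symm.linear y σ.2.1 := by
  rw [conormal, LinearMap.adjoint_inner_left, EuclideanSpace.inner_single_left]
  simp

lemma conormal_ne_zero (σ : M.Side) : M.conormal σ ≠ 0 := by
  intro h0
  have h1 := inner_conormal σ ((M.map σ.1).linear (EuclideanSpace.single σ.2.1 1))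
  rw [h0, inner_zero_left] at h1
  have h2 : (M.map σ.1).symm.linear ((M.map σ.1).linear (EuclideanSpace.single σ.2.1 (1 : ℝ))) =
      EuclideanSpace.single σ.2.1 1 := (M.map σ.1).linear.symm_apply_apply _
  rw [h2] at h1
  simp at h1

lemma normal_eq (σ : M.Side) :
    M.normal σ = sgn σ.2.2 • (‖M.conormal σ‖⁻¹ • M.conormal σ) := rfl

lemma norm_normal (σ : M.Side) : ‖M.normal σ‖ = 1 := by
  rw [normal_eq, norm_smul, Real.norm_eq_abs, abs_sgn, one_mul, norm_smul, norm_inv, norm_norm,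
    inv_mul_cancel₀ (norm_ne_zero_iff.2 (conormal_ne_zero σ))]

lemma disjoint_transition {k l : Fin M.N} (hkl : k ≠ l) :
    Disjoint (M.transition k l '' refCube d) (refCube d) := by
  rw [Set.disjoint_left]
  rintro _ ⟨x, hx, rfl⟩ hy
  exact Set.disjoint_left.1 (M.disjoint k l hkl) ⟨x, hx, rfl⟩ ⟨_, hy, map_transition k l x⟩

/-- The outward normals of two elements on a common facet are opposite. -/
lemma normal_eq_neg {σ τ : M.Side} (h : M.facet σ = M.facet τ) (hne : σ.1 ≠ τ.1) :
    M.normal τ = -M.normal σ := by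
  have hT := transition_image_facet h
  have hneg := entry_facet_neg hT (disjoint_transition hne)
  set c := entry (M.transition σ.1 τ.1) τ.2.1 σ.2.1 with hc
  have hw : M.conormal τ = c • M.conormal σ := by
    refine ext_inner_right ℝ fun y => ?_
    rw [inner_smul_left, inner_conormal, inner_conormal]
    have h1 := map_facet_coordinate hT ((M.map σ.1).symm (y +ᵥ M.map σ.1 0))
    have h2 := map_facet_coordinate hT ((M.map σ.1).symm (M.map σ.1 0))
    rw [transition_apply, AffineEquiv.apply_symm_apply] at h1 h2
    have h3 := congrArg (fun v : Pt d => v τ.2.1) (symm_sub_symm τ.1 (y +ᵥ M.map σ.1 0) (M.map σ.1 0))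
    have h4 := congrArg (fun v : Pt d => v σ.2.1) (symm_sub_symm σ.1 (y +ᵥ M.map σ.1 0) (M.map σ.1 0))
    simp only [PiLp.sub_apply, vadd_eq_add, add_sub_cancel_right] at h1 h2 h3 h4
    rw [← h3, ← h4, h1, h2]
    simp only [RCLike.conj_to_real]
    ring
  have hn : ‖M.conormal σ‖ ≠ 0 := norm_ne_zero_iff.2 (conormal_ne_zero σ)
  rw [normal_eq, normal_eq, hw, norm_smul, smul_smul, smul_smul, smul_smul, ← neg_smul]
  congr 1
  have hc0 : c ≠ 0 := by rintro h0; rw [h0] at hneg; simp at hneg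
  rw [Real.norm_eq_abs]
  have key : sgn τ.2.2 * c = -(sgn σ.2.2 * |c|) := by
    rcases sgn_eq σ.2.2 with h1 | h1 <;> rcases sgn_eq τ.2.2 with h2 | h2 <;>
      rw [h1, h2] at hneg ⊢
    · rw [abs_of_neg (by linarith)]; ring
    · rw [abs_of_pos (by linarith)]; ring
    · rw [abs_of_pos (by linarith)]; ring
    · rw [abs_of_neg (by linarith)]; ring
  have hca : |c| ≠ 0 := abs_ne_zero.2 hc0
  rw [mul_inv]
  calc sgn τ.2.2 * (|c|⁻¹ * ‖M.conormal σ‖⁻¹) * c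
      = (sgn τ.2.2 * c) * (|c|⁻¹ * ‖M.conormal σ‖⁻¹) := by ring
    _ = -(sgn σ.2.2 * ‖M.conormal σ‖⁻¹) := by rw [key]; field_simp

lemma mem_sides {f : Set (Pt d)} {σ : M.Side} : σ ∈ M.sides f ↔ M.facet σ = f := by
  classical
  simp [sides]

lemma mem_faces {f : Set (Pt d)} : f ∈ M.faces ↔ ∃ σ, M.facet σ = f := by
  classical
  simp [faces]

lemma facet_mem_faces (σ : M.Side) : M.facet σ ∈ M.faces := mem_faces.2 ⟨σ, rfl⟩

/-- A face has one side, or two sides in different elements. -/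
lemma sides_facet (σ : M.Side) : M.sides (M.facet σ) = {σ} ∨
    ∃ τ, σ.1 ≠ τ.1 ∧ M.facet σ = M.facet τ ∧ M.sides (M.facet σ) = {σ, τ} := by
  classical
  by_cases hτ : ∃ τ, τ ≠ σ ∧ M.facet τ = M.facet σ
  · right
    obtain ⟨τ, hne, hf⟩ := hτ
    have h1 : σ.1 ≠ τ.1 := fun h => hne (side_eq_of_facet_eq hf h.symm)
    refine ⟨τ, h1, hf.symm, ?_⟩
    ext ρ
    rw [mem_sides, Finset.mem_insert, Finset.mem_singleton]
    constructor
    · intro hρ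
      by_contra hcon
      rw [not_or] at hcon
      have h2 : σ.1 ≠ ρ.1 := fun h => hcon.1 (side_eq_of_facet_eq hρ h.symm)
      have h3 : τ.1 ≠ ρ.1 := fun h => hcon.2 (side_eq_of_facet_eq (hρ.trans hf.symm) h.symm)
      have e1 := normal_eq_neg hf.symm h1
      have e2 := normal_eq_neg hρ.symm h2
      have e3 := normal_eq_neg (hf.trans hρ.symm) h3
      rw [e1, e2, neg_neg] at e3
      have h0 : M.normal σ = 0 := by
        ext i
        have := congrArg (fun v : Pt d => v i) e3
        simp only [PiLp.neg_apply] at this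
        simp only [PiLp.zero_apply]
        linarith
      have := norm_normal σ
      rw [h0, norm_zero] at this
      exact zero_ne_one this
    · rintro (rfl | rfl)
      · rfl
      · exact hf
  · left
    ext ρ
    rw [mem_sides, Finset.mem_singleton]
    constructor
    · intro hρ
      by_contra hcon
      exact hτ ⟨ρ, hcon, hρ⟩
    · rintro rfl; rfl

lemma card_sides_le (f : Set (Pt d)) : (M.sides f).card ≤ 2 := by
  classical
  by_cases hf : ∃ σ, M.facet σ = f
  · obtain ⟨σ, rfl⟩ := hf
    rcases sides_facet σ with h | ⟨τ, -, -, h⟩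
    · rw [h]; simp
    · rw [h]; exact Finset.card_le_two
  · have : M.sides f = ∅ := by
      rw [Finset.eq_empty_iff_forall_notMem]
      intro σ hσ
      exact hf ⟨σ, mem_sides.1 hσ⟩
    rw [this]; simp

/-! ### Elements around a point -/

/-- The elements lie in `Ω` itself and not only in its closure: an open convex set is the interior
of its closure. -/
lemma elem_subset (hΩ : IsOpen Ω) (hc : Convex ℝ Ω) (k : Fin M.N) : M.elem k ⊆ Ω := by
  have h1 : M.elem k ⊆ closure Ω := by
    rw [← M.cover]
    exact subset_closure.trans (Set.subset_iUnion (fun k => closure (M.map k '' refCube d)) k)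
  have h2 : M.elem k ⊆ interior (closure Ω) := interior_maximal h1 (isOpen_elem k)
  rcases (M.elem k).eq_empty_or_nonempty with h0 | h0
  · rw [h0]; exact Set.empty_subset _
  have hne : (interior Ω).Nonempty := by
    rw [hΩ.interior_eq]
    exact closure_nonempty_iff.1 (h0.mono h1)
  rwa [hc.interior_closure_eq_interior_of_nonempty_interior hne, hΩ.interior_eq] at h2

lemma exists_mem_closure_elem {x : Pt d} (hx : x ∈ closure Ω) :
    ∃ k, x ∈ closure (M.elem k) := by
  rw [← M.cover] at hx
  exact Set.mem_iUnion.1 hx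

lemma disjoint_elem_closure {k l : Fin M.N} (h : k ≠ l) :
    Disjoint (M.elem k) (closure (M.elem l)) :=
  (M.disjoint k l h).closure_right (isOpen_elem k)

/-- The points on faces of dimension at most `d - 2`, with these faces extended to affine
subspaces. -/
def ridges (M : Mesh Ω) : Set (Pt d) :=
  {y | ∃ (k : Fin M.N) (i j : Fin d) (b b' : Bool), i ≠ j ∧ (M.map k).symm y i = sgn b ∧
    (M.map k).symm y j = sgn b'}

/-- The complement of a hyperplane, given in the coordinates of an element, is dense. -/
lemma dense_affine_ne_zero (k : Fin M.N) {i j : Fin d} (hij : i ≠ j) (α β c : ℝ)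
    (h : ¬(α = 0 ∧ β = 0)) :
    Dense {y : Pt d | α * (M.map k).symm y i + β * (M.map k).symm y j + c ≠ 0} := by
  -- move from a zero in a direction in which the affine function is not constant
  obtain ⟨v, hv⟩ : ∃ v : Pt d, α * v i + β * v j ≠ 0 := by
    by_cases hα : α = 0
    · refine ⟨EuclideanSpace.single j 1, ?_⟩
      have hβ : β ≠ 0 := fun hβ => h ⟨hα, hβ⟩
      simpa [hij] using hβ
    · refine ⟨EuclideanSpace.single i 1, ?_⟩
      simpa [hij.symm] using hα
  rw [dense_iff_inter_open]
  intro U hU ⟨y, hy⟩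
  set w := (M.map k).linear v with hw
  have hcont : Continuous fun t : ℝ => y + t • w := by fun_prop
  have hval : ∀ t : ℝ, ∀ n, (M.map k).symm (y + t • w) n = (M.map k).symm y n + t * v n := by
    intro t n
    have h1 := congrArg (fun z : Pt d => z n) (symm_sub_symm k (y + t • w) y)
    have h2 : (M.map k).symm.linear w = v := (M.map k).linear.symm_apply_apply v
    simp only [add_sub_cancel_left, map_smul, h2, PiLp.sub_apply, PiLp.smul_apply,
      smul_eq_mul] at h1
    linarith
  have hnhds : ∀ᶠ t in nhdsWithin (0 : ℝ) {0}ᶜ, y + t • w ∈ U := by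
    refine nhdsWithin_le_nhds ?_
    exact hcont.continuousAt.eventually (hU.mem_nhds (by simpa using hy))
  by_cases h0 : α * (M.map k).symm y i + β * (M.map k).symm y j + c = 0
  · obtain ⟨t, ht, ht0⟩ := (hnhds.and self_mem_nhdsWithin).exists
    refine ⟨_, ht, ?_⟩
    have ht0' : t ≠ 0 := ht0
    change α * (M.map k).symm (y + t • w) i + β * (M.map k).symm (y + t • w) j + c ≠ 0
    rw [hval, hval]
    have e : α * ((M.map k).symm y i + t * v i) + β * ((M.map k).symm y j + t * v j) + c =
        (α * (M.map k).symm y i + β * (M.map k).symm y j + c) + t * (α * v i + β * v j) := by ring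
    rw [e, h0, zero_add]
    exact mul_ne_zero ht0' hv
  · exact ⟨y, hy, h0⟩

lemma isOpen_affine_ne_zero (k : Fin M.N) (i j : Fin d) (α β c : ℝ) :
    IsOpen {y : Pt d | α * (M.map k).symm y i + β * (M.map k).symm y j + c ≠ 0} := by
  have h1 : Continuous (M.map k).symm := (M.homeo k).symm.continuous
  exact isOpen_ne_fun (by fun_prop) continuous_const

/-- A generic segment from a point off the ridges avoids the ridges. -/
lemma exists_segment_disjoint_ridges {x : Pt d} (hx : x ∉ M.ridges) {V : Set (Pt d)}
    (hV : IsOpen V) (hne : V.Nonempty) : ∃ y ∈ V, Disjoint (segment ℝ x y) M.ridges := by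
  set I := {q : Fin M.N × (Fin d × Fin d) × (Bool × Bool) // q.2.1.1 ≠ q.2.1.2} with hI
  -- the segment to `y` meets a ridge only if a certain affine function vanishes at `y`
  set α : I → ℝ := fun q => -((M.map q.1.1).symm x q.1.2.1.2 - sgn q.1.2.2.2) with hα
  set β : I → ℝ := fun q => (M.map q.1.1).symm x q.1.2.1.1 - sgn q.1.2.2.1 with hβ
  set c : I → ℝ := fun q => -(α q * sgn q.1.2.2.1 + β q * sgn q.1.2.2.2) with hc
  set G : I → Set (Pt d) := fun q => {y | α q * (M.map q.1.1).symm y q.1.2.1.1 +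
    β q * (M.map q.1.1).symm y q.1.2.1.2 + c q ≠ 0} with hG
  have hne0 : ∀ q, ¬(α q = 0 ∧ β q = 0) := by
    rintro ⟨⟨k, ⟨i, j⟩, b, b'⟩, hij⟩ ⟨h1, h2⟩
    exact hx ⟨k, i, j, b, b', hij, sub_eq_zero.1 h2, sub_eq_zero.1 (neg_eq_zero.1 h1)⟩
  have hdense : Dense (⋂ q, G q) := dense_iInter_of_isOpen
    (fun q => isOpen_affine_ne_zero _ _ _ _ _ _)
    (fun q => dense_affine_ne_zero _ q.2 _ _ _ (hne0 q))
  obtain ⟨y, hyV, hyG⟩ := hdense.inter_open_nonempty V hV hne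
  refine ⟨y, hyV, Set.disjoint_left.2 ?_⟩
  rintro z hz ⟨k, i, j, b, b', hij, h1, h2⟩
  set q : I := ⟨(k, (i, j), (b, b')), hij⟩ with hq
  have hyq : y ∈ G q := Set.mem_iInter.1 hyG q
  rw [segment_eq_image'] at hz
  obtain ⟨t, ht, rfl⟩ := hz
  have hval : ∀ n, (M.map k).symm (x + t • (y - x)) n =
      (M.map k).symm x n + t * ((M.map k).symm y n - (M.map k).symm x n) := by
    intro n
    have e1 := congrArg (fun z : Pt d => z n) (symm_sub_symm k (x + t • (y - x)) x)
    have e2 := congrArg (fun z : Pt d => z n) (symm_sub_symm k y x)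
    simp only [add_sub_cancel_left, map_smul, PiLp.sub_apply, PiLp.smul_apply,
      smul_eq_mul] at e1 e2
    rw [e2]; linarith
  simp only [hval] at h1 h2
  have hαq : α q = -((M.map k).symm x j - sgn b') := rfl
  have hβq : β q = (M.map k).symm x i - sgn b := rfl
  have hprod : t * (α q * (M.map k).symm y i + β q * (M.map k).symm y j + c q) = 0 := by
    have hcq : c q = -(α q * sgn b + β q * sgn b') := rfl
    rw [hcq, hαq, hβq]
    linear_combination (-((M.map k).symm x j - sgn b')) * h1 + ((M.map k).symm x i - sgn b) * h2
  rcases mul_eq_zero.1 hprod with h0 | h0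
  · rw [h0] at h1 h2
    exact hx ⟨k, i, j, b, b', hij, by linarith, by linarith⟩
  · exact hyq h0

/-- The ridges lie in finitely many hyperplanes, so they contain no open set. -/
lemma exists_notMem_ridges {V : Set (Pt d)} (hV : IsOpen V) (hne : V.Nonempty) :
    ∃ y ∈ V, y ∉ M.ridges := by
  set I := {q : Fin M.N × (Fin d × Fin d) × (Bool × Bool) // q.2.1.1 ≠ q.2.1.2} with hI
  set G : I → Set (Pt d) := fun q => {y | 1 * (M.map q.1.1).symm y q.1.2.1.1 +
    0 * (M.map q.1.1).symm y q.1.2.1.2 + (-sgn q.1.2.2.1) ≠ 0} with hG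
  have hdense : Dense (⋂ q, G q) := dense_iInter_of_isOpen
    (fun q => isOpen_affine_ne_zero _ _ _ _ _ _)
    (fun q => dense_affine_ne_zero _ q.2 _ _ _ (by simp))
  obtain ⟨y, hyV, hyG⟩ := hdense.inter_open_nonempty V hV hne
  refine ⟨y, hyV, ?_⟩
  rintro ⟨k, i, j, b, b', hij, h1, h2⟩
  have hyq := Set.mem_iInter.1 hyG ⟨(k, (i, j), (b, b')), hij⟩
  apply hyq
  simp [h1]

/-- Off the ridges, two elements meet only within common facets. -/
lemma exists_facet_of_mem_closure {k l : Fin M.N} (hkl : k ≠ l) {z : Pt d}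
    (hz : z ∉ M.ridges) (hk : z ∈ closure (M.elem k)) (hl : z ∈ closure (M.elem l)) :
    ∃ σ τ : M.Side, σ.1 = k ∧ τ.1 = l ∧ M.facet σ = closure (M.elem k) ∩ closure (M.elem l) ∧
      M.facet τ = closure (M.elem k) ∩ closure (M.elem l) := by
  have hface : ∀ {k l : Fin M.N}, k ≠ l → z ∈ closure (M.elem k) → z ∈ closure (M.elem l) →
      ∀ s, closure (M.elem k) ∩ closure (M.elem l) = M.map k '' refFace s →
      ∃ σ : M.Side, σ.1 = k ∧ M.facet σ = closure (M.elem k) ∩ closure (M.elem l) := by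
    intro k l hkl hk hl s hs
    obtain ⟨x, hx, hxz⟩ : z ∈ M.map k '' refFace s := hs ▸ ⟨hk, hl⟩
    have hxs : (M.map k).symm z = x := by rw [← hxz]; simp
    obtain ⟨j, hj⟩ : ∃ j, s j ≠ none := by
      by_contra! hcon
      have : s = fun _ => none := funext hcon
      rw [this, ← closure_elem] at hs
      obtain ⟨y, hy⟩ := elem_nonempty (M := M) k
      have h1 : y ∈ closure (M.elem k) ∩ closure (M.elem l) := by
        rw [hs]; exact subset_closure hy
      exact Set.disjoint_left.1 (disjoint_elem_closure hkl) hy h1.2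
    obtain ⟨b, hb⟩ := Option.ne_none_iff_exists'.1 hj
    have hsj : s = facetIdx j b := by
      funext i
      by_cases hi : i = j
      · subst hi; simp [facetIdx, hb]
      · rw [facetIdx, Function.update_of_ne hi]
        by_contra hcon
        obtain ⟨b', hb'⟩ := Option.ne_none_iff_exists'.1 hcon
        exact hz ⟨k, i, j, b', b, hi, by rw [hxs]; exact (hx i).2 b' hb',
          by rw [hxs]; exact (hx j).2 b hb⟩
    refine ⟨(k, j, b), rfl, ?_⟩
    rw [hs, hsj, refFace_facetIdx]
    rfl
  rcases M.conforming k l hkl with hdis | ⟨s, t, hs, ht⟩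
  · exact absurd hl (Set.disjoint_left.1 hdis hk)
  obtain ⟨σ, hσ, hσf⟩ := hface hkl hk hl s hs
  obtain ⟨τ, hτ, hτf⟩ := hface hkl.symm hl hk t (by rw [Set.inter_comm]; exact ht)
  exact ⟨σ, τ, hσ, hτ, hσf, by rw [hτf, Set.inter_comm]⟩

/-- A ball around a point that avoids the closed sets of a finite family not containing it. -/
lemma exists_ball_disjoint {ι : Type*} [Finite ι] (C : ι → Set (Pt d)) (hC : ∀ i, IsClosed (C i))
    (ξ : Pt d) : ∃ r > 0, ∀ i, ξ ∉ C i → Disjoint (Metric.ball ξ r) (C i) := by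
  have h1 : ∀ᶠ x in nhds ξ, ∀ i, ξ ∉ C i → x ∉ C i := by
    refine Filter.eventually_all.2 fun i => ?_
    by_cases h : ξ ∈ C i
    · simp [h]
    · filter_upwards [(hC i).isOpen_compl.mem_nhds h] with x hx _
      exact hx
  obtain ⟨r, hr, hball⟩ := Metric.eventually_nhds_iff_ball.1 h1
  exact ⟨r, hr, fun i hi => Set.disjoint_left.2 fun x hx => hball x hx i hi⟩

/-- The elements around a point are connected through facets containing the point. -/
theorem exists_common_facet (hΩ : IsOpen Ω) (hc : Convex ℝ Ω) {ξ : Pt d} {S : Set (Fin M.N)}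
    {k₀ l₀ : Fin M.N} (hk₀ : k₀ ∈ M.elemsAt ξ) (hl₀ : l₀ ∈ M.elemsAt ξ) (hkS : k₀ ∈ S)
    (hlS : l₀ ∉ S) : ∃ σ τ : M.Side, σ.1 ∈ S ∧ τ.1 ∉ S ∧ τ.1 ∈ M.elemsAt ξ ∧
      M.facet σ = M.facet τ ∧ ξ ∈ M.facet σ := by
  obtain ⟨r, hr, hball⟩ := exists_ball_disjoint (fun k => closure (M.elem k))
    (fun _ => isClosed_closure) ξ
  have hnon : ∀ k, k ∈ M.elemsAt ξ → (M.elem k ∩ Metric.ball ξ r).Nonempty := by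
    intro k hk
    obtain ⟨y, hy⟩ := mem_closure_iff.1 (mem_elemsAt.1 hk) _ Metric.isOpen_ball
      (Metric.mem_ball_self hr)
    exact ⟨y, hy.2, hy.1⟩
  obtain ⟨x, hxV, hx⟩ := exists_notMem_ridges (M := M)
    ((isOpen_elem k₀).inter Metric.isOpen_ball) (hnon k₀ hk₀)
  obtain ⟨y, hyV, hxy⟩ := exists_segment_disjoint_ridges hx
    ((isOpen_elem l₀).inter Metric.isOpen_ball) (hnon l₀ hl₀)
  have hsegB : segment ℝ x y ⊆ Metric.ball ξ r := (convex_ball ξ r).segment_subset hxV.2 hyV.2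
  have hsegΩ : segment ℝ x y ⊆ Ω :=
    hc.segment_subset (elem_subset hΩ hc k₀ hxV.1) (elem_subset hΩ hc l₀ hyV.1)
  -- a segment between the two elements, near `ξ` and off the ridges, is covered by two closed sets:
  -- the elements in `S` and those not in `S`; a point in both lies on a common facet
  set A := ⋃ k ∈ {k | k ∈ M.elemsAt ξ ∧ k ∈ S}, closure (M.elem k) with hA
  set B := ⋃ k ∈ {k | k ∈ M.elemsAt ξ ∧ k ∉ S}, closure (M.elem k) with hB
  have hAc : IsClosed A := (Set.toFinite _).isClosed_biUnion fun _ _ => isClosed_closure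
  have hBc : IsClosed B := (Set.toFinite _).isClosed_biUnion fun _ _ => isClosed_closure
  have hcov : segment ℝ x y ⊆ A ∪ B := by
    intro z hz
    obtain ⟨k, hk⟩ := exists_mem_closure_elem (M := M) (subset_closure (hsegΩ hz))
    have hkξ : k ∈ M.elemsAt ξ := by
      by_contra hcon
      exact Set.disjoint_left.1 (hball k fun h => hcon (mem_elemsAt.2 h)) (hsegB hz) hk
    by_cases hkS : k ∈ S
    · exact Or.inl (Set.mem_biUnion (show k ∈ {k | k ∈ M.elemsAt ξ ∧ k ∈ S} from ⟨hkξ, hkS⟩) hk)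
    · exact Or.inr (Set.mem_biUnion (show k ∈ {k | k ∈ M.elemsAt ξ ∧ k ∉ S} from ⟨hkξ, hkS⟩) hk)
  obtain ⟨z, hz, hzA, hzB⟩ := isPreconnected_closed_iff.1 (convex_segment x y).isPreconnected A B
    hAc hBc hcov
    ⟨x, left_mem_segment ℝ x y, Set.mem_biUnion
      (show k₀ ∈ {k | k ∈ M.elemsAt ξ ∧ k ∈ S} from ⟨hk₀, hkS⟩) (subset_closure hxV.1)⟩
    ⟨y, right_mem_segment ℝ x y, Set.mem_biUnion
      (show l₀ ∈ {k | k ∈ M.elemsAt ξ ∧ k ∉ S} from ⟨hl₀, hlS⟩) (subset_closure hyV.1)⟩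
  obtain ⟨k, ⟨hkξ, hkS'⟩, hzk⟩ := Set.mem_iUnion₂.1 hzA
  obtain ⟨l, ⟨hlξ, hlS'⟩, hzl⟩ := Set.mem_iUnion₂.1 hzB
  have hkl : k ≠ l := by rintro rfl; exact hlS' hkS'
  obtain ⟨σ, τ, rfl, rfl, hσ, hτ⟩ := exists_facet_of_mem_closure hkl
    (Set.disjoint_left.1 hxy hz) hzk hzl
  exact ⟨σ, τ, hkS', hlS', hlξ, hσ.trans hτ.symm,
    hσ ▸ ⟨mem_elemsAt.1 hkξ, mem_elemsAt.1 hlξ⟩⟩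

lemma mem_Ioo_of_notMem_ridges {σ : M.Side} {z : Pt d} (hz : z ∉ M.ridges)
    (hzσ : z ∈ M.facet σ) {i : Fin d} (hi : i ≠ σ.2.1) :
    (M.map σ.1).symm z i ∈ Set.Ioo (-1 : ℝ) 1 := by
  obtain ⟨h1, h2⟩ := mem_facet.1 hzσ
  refine ⟨lt_of_le_of_ne (h1 i).1 fun h => ?_, lt_of_le_of_ne (h1 i).2 fun h => ?_⟩
  · exact hz ⟨σ.1, i, σ.2.1, false, σ.2.2, hi, by simp [sgn, ← h], h2⟩
  · exact hz ⟨σ.1, i, σ.2.1, true, σ.2.2, hi, by simp [sgn, h], h2⟩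

/-- Two elements with a common facet cover a neighbourhood of its relatively interior points. -/
lemma union_mem_nhds {σ τ : M.Side} (h : M.facet σ = M.facet τ) (hne : σ.1 ≠ τ.1) {z : Pt d}
    (hz : z ∉ M.ridges) (hzσ : z ∈ M.facet σ) :
    closure (M.elem σ.1) ∪ closure (M.elem τ.1) ∈ nhds z := by
  have hT := transition_image_facet h
  have hneg := entry_facet_neg hT (disjoint_transition hne)
  have hev : ∀ ρ : M.Side, z ∈ M.facet ρ → ∀ᶠ y in nhds z,
      (∀ i, i ≠ ρ.2.1 → (M.map ρ.1).symm y i ∈ Set.Ioo (-1 : ℝ) 1) ∧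
      -1 < sgn ρ.2.2 * (M.map ρ.1).symm y ρ.2.1 := by
    intro ρ hρ
    have hc : Continuous (M.map ρ.1).symm := (M.homeo ρ.1).symm.continuous
    refine Filter.Eventually.and (Filter.eventually_all.2 fun i => ?_) ?_
    · by_cases hi : i = ρ.2.1
      · simp [hi]
      · have hci : Continuous fun y => (M.map ρ.1).symm y i := by fun_prop
        filter_upwards [hci.continuousAt.eventually
          (isOpen_Ioo.mem_nhds (mem_Ioo_of_notMem_ridges hz hρ hi))] with y hy _
        exact hy
    · have hci : Continuous fun y => sgn ρ.2.2 * (M.map ρ.1).symm y ρ.2.1 := by fun_prop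
      refine hci.continuousAt.eventually (isOpen_Ioi.mem_nhds ?_)
      change -1 < sgn ρ.2.2 * (M.map ρ.1).symm z ρ.2.1
      rw [(mem_facet.1 hρ).2, sgn_mul_self]; norm_num
  have hin : ∀ (ρ : M.Side) (y : Pt d),
      (∀ i, i ≠ ρ.2.1 → (M.map ρ.1).symm y i ∈ Set.Ioo (-1 : ℝ) 1) →
      -1 < sgn ρ.2.2 * (M.map ρ.1).symm y ρ.2.1 →
      sgn ρ.2.2 * (M.map ρ.1).symm y ρ.2.1 ≤ 1 → y ∈ closure (M.elem ρ.1) := by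
    intro ρ y h1 h2 h3
    refine mem_closure_elem.2 fun i => ?_
    by_cases hi : i = ρ.2.1
    · subst hi
      rcases sgn_eq ρ.2.2 with h | h <;> rw [h] at h2 h3 <;> constructor <;> linarith
    · exact Set.Ioo_subset_Icc_self (h1 i hi)
  filter_upwards [hev σ hzσ, hev τ (h ▸ hzσ)] with y hy1 hy2
  by_cases hle : sgn σ.2.2 * (M.map σ.1).symm y σ.2.1 ≤ 1
  · exact Or.inl (hin σ y hy1.1 hy1.2 hle)
  · refine Or.inr (hin τ y hy2.1 hy2.2 ?_)
    have h1 := map_facet_coordinate hT ((M.map σ.1).symm y)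
    rw [transition_apply, AffineEquiv.apply_symm_apply] at h1
    rw [h1]
    set c := entry (M.transition σ.1 τ.1) τ.2.1 σ.2.1
    set x := (M.map σ.1).symm y σ.2.1
    have e : sgn τ.2.2 * (sgn τ.2.2 + c * (x - sgn σ.2.2)) =
        1 + (sgn σ.2.2 * sgn τ.2.2 * c) * (sgn σ.2.2 * x - 1) := by
      have e1 := sgn_mul_self τ.2.2
      have e2 := sgn_mul_self σ.2.2
      linear_combination e1 - (sgn τ.2.2 * c * x) * e2
    rw [e]
    nlinarith

/-- At each point of the boundary of the domain there is a boundary face. -/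
theorem exists_boundary_facet (hΩ : IsOpen Ω) (hc : Convex ℝ Ω) {ξ : Pt d}
    (hξ : ξ ∈ frontier Ω) : ∃ σ : M.Side, ξ ∈ M.facet σ ∧ M.sides (M.facet σ) = {σ} := by
  -- within the radius, every facet that meets the ball contains `ξ`
  obtain ⟨r₁, hr₁, hball₁⟩ := exists_ball_disjoint (fun k => closure (M.elem k))
    (fun _ => isClosed_closure) ξ
  obtain ⟨r₂, hr₂, hball₂⟩ := exists_ball_disjoint M.facet isClosed_facet ξ
  set r := min r₁ r₂ with hr
  have hr0 : 0 < r := lt_min hr₁ hr₂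
  have hξc : ξ ∈ closure Ω := frontier_subset_closure hξ
  obtain ⟨k₀, hk₀⟩ := exists_mem_closure_elem (M := M) hξc
  have hΩne : (interior Ω).Nonempty := by
    rw [hΩ.interior_eq]; exact closure_nonempty_iff.1 ⟨ξ, hξc⟩
  have hint : interior (closure Ω) = Ω := by
    rw [hc.interior_closure_eq_interior_of_nonempty_interior hΩne, hΩ.interior_eq]
  obtain ⟨x, hxV, hx⟩ := exists_notMem_ridges (M := M)
    ((isOpen_elem k₀).inter Metric.isOpen_ball) (by
      obtain ⟨y, hy⟩ := mem_closure_iff.1 hk₀ _ Metric.isOpen_ball (Metric.mem_ball_self hr0)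
      exact ⟨y, hy.2, hy.1⟩)
  -- a segment off the ridges that leaves the domain crosses the boundary at a point `z` inside a
  -- facet; a second element there would make a neighbourhood of `z` part of the closure of `Ω`
  have hout : ((closure Ω)ᶜ ∩ Metric.ball ξ r).Nonempty := by
    by_contra hcon
    rw [Set.not_nonempty_iff_eq_empty] at hcon
    have h1 : Metric.ball ξ r ⊆ closure Ω := by
      intro y hy
      by_contra hy'
      exact (Set.mem_empty_iff_false y).1 (hcon ▸ ⟨hy', hy⟩)
    have h2 : ξ ∈ interior (closure Ω) :=
      mem_interior.2 ⟨_, h1, Metric.isOpen_ball, Metric.mem_ball_self hr0⟩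
    rw [hint] at h2
    exact (hΩ.frontier_eq ▸ hξ : ξ ∈ closure Ω \ Ω).2 h2
  obtain ⟨y, hyV, hxy⟩ := exists_segment_disjoint_ridges hx
    (isClosed_closure.isOpen_compl.inter Metric.isOpen_ball) hout
  have hsegB : segment ℝ x y ⊆ Metric.ball ξ r := (convex_ball ξ r).segment_subset hxV.2 hyV.2
  have hxΩ : x ∈ closure Ω := subset_closure (elem_subset hΩ hc k₀ hxV.1)
  obtain ⟨z, hz, hzf⟩ : ∃ z ∈ segment ℝ x y, z ∈ frontier (closure Ω) := by
    by_contra! hcon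
    have hmem : ∀ z ∈ segment ℝ x y, z ∈ closure Ω → z ∈ interior (closure Ω) := by
      intro z hz hzc
      by_contra hzi
      exact hcon z hz ⟨subset_closure hzc, hzi⟩
    obtain ⟨z, -, hz1, hz2⟩ := (convex_segment x y).isPreconnected (interior (closure Ω))
      (closure Ω)ᶜ isOpen_interior isClosed_closure.isOpen_compl
      (fun z hz => (em (z ∈ closure Ω)).imp (hmem z hz) id)
      ⟨x, left_mem_segment ℝ x y, hmem x (left_mem_segment ℝ x y) hxΩ⟩
      ⟨y, right_mem_segment ℝ x y, hyV.1⟩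
    exact hz2 (interior_subset hz1)
  have hzr : z ∉ M.ridges := Set.disjoint_left.1 hxy hz
  have hzc : z ∈ closure Ω := by simpa using frontier_subset_closure hzf
  have hznot : closure Ω ∉ nhds z := fun hcon => hzf.2 (mem_interior_iff_mem_nhds.2 hcon)
  obtain ⟨k, hk⟩ := exists_mem_closure_elem (M := M) hzc
  have hkcl : ∀ l, closure (M.elem l) ⊆ closure Ω := fun l => closure_mono (elem_subset hΩ hc l)
  have hzk := mem_closure_elem.1 hk
  obtain ⟨j, b, hjb⟩ : ∃ j b, (M.map k).symm z j = sgn b := by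
    by_contra! hcon
    have : z ∈ M.elem k := mem_elem.2 fun i => by
      have h1 := hcon i true
      have h2 := hcon i false
      simp only [sgn, if_true] at h1
      simp only [sgn, Bool.false_eq_true, if_false] at h2
      exact ⟨lt_of_le_of_ne (hzk i).1 (Ne.symm h2), lt_of_le_of_ne (hzk i).2 h1⟩
    exact hznot (Filter.mem_of_superset ((isOpen_elem k).mem_nhds this)
      (subset_closure.trans (hkcl k)))
  set σ : M.Side := (k, j, b) with hσ
  have hzσ : z ∈ M.facet σ := mem_facet.2 ⟨hzk, hjb⟩
  refine ⟨σ, ?_, ?_⟩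
  · by_contra hcon
    exact Set.disjoint_left.1 (hball₂ σ hcon)
      (Metric.ball_subset_ball (min_le_right _ _) (hsegB hz)) hzσ
  · rcases sides_facet σ with h1 | ⟨τ, hne, hf, -⟩
    · exact h1
    · refine absurd (Filter.mem_of_superset (union_mem_nhds hf hne hzr hzσ) ?_) hznot
      exact Set.union_subset (hkcl _) (hkcl _)

end Mesh

/-! ### Symmetric bilinear forms on subspaces -/

/-- The function `A` of two arguments restricts to a symmetric bilinear form on `W`. -/
structure IsSymmBilin {V : Type*} [AddCommGroup V] [Module ℝ V] (A : V → V → ℝ)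
    (W : Submodule ℝ V) : Prop where
  add_left : ∀ u ∈ W, ∀ v ∈ W, ∀ w ∈ W, A (u + v) w = A u w + A v w
  smul_left : ∀ c : ℝ, ∀ u ∈ W, ∀ w ∈ W, A (c • u) w = c * A u w
  symm : ∀ u ∈ W, ∀ v ∈ W, A u v = A v u

namespace IsSymmBilin

variable {V : Type*} [AddCommGroup V] [Module ℝ V] {A : V → V → ℝ} {W : Submodule ℝ V}

lemma mono (hA : IsSymmBilin A W) {U : Submodule ℝ V} (hU : U ≤ W) : IsSymmBilin A U :=
  ⟨fun u hu v hv w hw => hA.add_left u (hU hu) v (hU hv) w (hU hw),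
    fun c u hu w hw => hA.smul_left c u (hU hu) w (hU hw),
    fun u hu v hv => hA.symm u (hU hu) v (hU hv)⟩

lemma add_right (hA : IsSymmBilin A W) {u v w : V} (hu : u ∈ W) (hv : v ∈ W) (hw : w ∈ W) :
    A w (u + v) = A w u + A w v := by
  rw [hA.symm w hw _ (W.add_mem hu hv), hA.add_left u hu v hv w hw, hA.symm u hu w hw,
    hA.symm v hv w hw]

lemma smul_right (hA : IsSymmBilin A W) (c : ℝ) {u w : V} (hu : u ∈ W) (hw : w ∈ W) :
    A w (c • u) = c * A w u := by
  rw [hA.symm w hw _ (W.smul_mem c hu), hA.smul_left c u hu w hw, hA.symm u hu w hw]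

lemma zero_left (hA : IsSymmBilin A W) {w : V} (hw : w ∈ W) : A 0 w = 0 := by
  have := hA.smul_left 0 0 W.zero_mem w hw
  simpa using this

lemma sub_left (hA : IsSymmBilin A W) {u v w : V} (hu : u ∈ W) (hv : v ∈ W) (hw : w ∈ W) :
    A (u - v) w = A u w - A v w := by
  have := hA.add_left (u - v) (W.sub_mem hu hv) v hv w hw
  rw [sub_add_cancel] at this
  linarith

lemma sum_left (hA : IsSymmBilin A W) {ι : Type*} (s : Finset ι) {u : ι → V}
    (hu : ∀ i ∈ s, u i ∈ W) {w : V} (hw : w ∈ W) :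
    A (∑ i ∈ s, u i) w = ∑ i ∈ s, A (u i) w := by
  classical
  induction s using Finset.induction_on with
  | empty => simpa using hA.zero_left hw
  | insert i s hi ih =>
    rw [Finset.sum_insert hi, Finset.sum_insert hi, hA.add_left _ (hu i (by simp)) _
      (W.sum_mem fun j hj => hu j (by simp [hj])) w hw, ih fun j hj => hu j (by simp [hj])]

/-- The inequality of arithmetic and geometric means for a non-negative form. -/
lemma young (hA : IsSymmBilin A W) (hpos : ∀ u ∈ W, 0 ≤ A u u) (c : ℝ) {u v : V} (hu : u ∈ W)
    (hv : v ∈ W) : -(2 * c * A u v) ≤ c ^ 2 * A u u + A v v := by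
  have hcu := W.smul_mem c hu
  have h := hpos (c • u + v) (W.add_mem hcu hv)
  rw [hA.add_left _ hcu _ hv _ (W.add_mem hcu hv), hA.add_right hcu hv hcu,
    hA.add_right hcu hv hv, hA.smul_right c hu hcu, hA.smul_left c u hu u hu,
    hA.smul_left c u hu v hv, hA.smul_right c hu hv, hA.symm v hv u hu] at h
  linarith

/-- Functionals on a finite-dimensional space are represented by a positive definite form. -/
lemma exists_repr (hA : IsSymmBilin A W) (hpos : ∀ u ∈ W, u ≠ 0 → 0 < A u u)
    [FiniteDimensional ℝ W] (l : V → ℝ) (hadd : ∀ u ∈ W, ∀ v ∈ W, l (u + v) = l u + l v)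
    (hsmul : ∀ c : ℝ, ∀ u ∈ W, l (c • u) = c * l u) :
    ∃ w ∈ W, ∀ z ∈ W, A w z = l z := by
  let B : W →ₗ[ℝ] Module.Dual ℝ W := LinearMap.mk₂ ℝ (fun u v => A u v)
    (fun u v w => hA.add_left u u.2 v v.2 w w.2) (fun c u w => hA.smul_left c u u.2 w w.2)
    (fun u v w => hA.add_right v.2 w.2 u.2) (fun c u w => hA.smul_right c w.2 u.2)
  have hinj : Function.Injective B := by
    rw [injective_iff_map_eq_zero]
    intro u hu
    by_contra hne
    have h1 := hpos u u.2 (fun h => hne (Subtype.ext h))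
    have h2 : B u u = 0 := by rw [hu]; rfl
    exact h1.ne' h2
  have hsurj : Function.Surjective B :=
    (LinearMap.injective_iff_surjective_of_finrank_eq_finrank
      (Subspace.dual_finrank_eq (K := ℝ) (V := W)).symm).1 hinj
  obtain ⟨w, hw⟩ := hsurj
    { toFun := fun u => l u
      map_add' := fun u v => hadd u u.2 v v.2
      map_smul' := fun c u => hsmul c u u.2 }
  exact ⟨w, w.2, fun z hz => by simpa [B] using LinearMap.congr_fun hw ⟨z, hz⟩⟩

end IsSymmBilin

namespace Mesh

variable {Ω : Set (Pt d)} {M : Mesh Ω} {K h : ℝ}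

/-! ### Piecewise polynomial functions and fields -/

/-- The space `[V_hp]^d` as a submodule. -/
def fieldSpace (M : Mesh Ω) (p : ℕ) : Submodule ℝ M.BrokenField where
  carrier := M.dgFields p
  zero_mem' := fun _ => (M.dgSpace p).zero_mem
  add_mem' := fun hu hv i => (M.dgSpace p).add_mem (hu i) (hv i)
  smul_mem' := fun c _ hv i => (M.dgSpace p).smul_mem c (hv i)

lemma isPolyOn_apply {η : M.BrokenField} (hη : η ∈ M.dgFields p) (k : Fin M.N) (i : Fin d) :
    M.IsPolyOn p k fun x => η k x i := hη i k

/-- A polynomial is determined by its values at the nodes. -/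
lemma IsPolyOn.eq_sum (hp : 1 < p) {k : Fin M.N} {u : Pt d → ℝ} (hu : M.IsPolyOn p k u)
    (x : Pt d) : u x = ∑ a : NodeIdx d p, u (M.node k a) * refBasis a ((M.map k).symm x) := by
  have := refQ_eq_sum_refBasis hp hu ((M.map k).symm x)
  simpa [node] using this

lemma IsPolyOn.eq_zero (hp : 1 < p) {k : Fin M.N} {u : Pt d → ℝ} (hu : M.IsPolyOn p k u)
    (h0 : ∀ a : NodeIdx d p, u (M.node k a) = 0) : u = 0 := by
  funext x
  rw [hu.eq_sum hp x]
  simp [h0]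

/-- The nodal values of a function, as a linear map. -/
def nodalValues (M : Mesh Ω) (p : ℕ) : M.BrokenFun →ₗ[ℝ] (Fin M.N × NodeIdx d p → ℝ) where
  toFun v i := v i.1 (M.node i.1 i.2)
  map_add' _ _ := rfl
  map_smul' _ _ := rfl

lemma finiteDimensional_dgSpace (hp : 1 < p) : FiniteDimensional ℝ (M.dgSpace p) := by
  refine FiniteDimensional.of_injective ((M.nodalValues p).comp (M.dgSpace p).subtype) ?_
  rw [injective_iff_map_eq_zero]
  intro v hv
  ext k x
  exact congrFun (IsPolyOn.eq_zero hp (v.2 k) fun a => congrFun hv (k, a)) x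

lemma finiteDimensional_fieldSpace (hp : 1 < p) : FiniteDimensional ℝ (M.fieldSpace p) := by
  let T : M.fieldSpace p →ₗ[ℝ] (Fin d → Fin M.N × NodeIdx d p → ℝ) :=
    { toFun := fun η i j => (η : M.BrokenField) j.1 (M.node j.1 j.2) i
      map_add' := fun _ _ => rfl
      map_smul' := fun _ _ => rfl }
  refine FiniteDimensional.of_injective T ?_
  rw [injective_iff_map_eq_zero]
  intro η hη
  ext k x i
  exact congrFun (IsPolyOn.eq_zero hp (isPolyOn_apply η.2 k i)
    fun a => congrFun (congrFun hη i) (k, a)) x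

lemma continuous_field {η : M.BrokenField} (hη : η ∈ M.dgFields p) (k : Fin M.N) :
    Continuous (η k) := by
  have h1 : Continuous fun x => fun i => η k x i :=
    continuous_pi fun i => (isPolyOn_apply hη k i).continuous
  exact (PiLp.continuous_toLp 2 _).comp h1

lemma isSymmBilin_fieldInner : IsSymmBilin M.fieldInner (M.fieldSpace p) where
  add_left u hu v hv w hw := by
    rw [fieldInner, fieldInner, fieldInner, ← Finset.sum_add_distrib]
    refine Finset.sum_congr rfl fun k _ => ?_
    have h1 := continuous_field hu k
    have h2 := continuous_field hv k
    have h3 := continuous_field hw k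
    rw [← integral_add (integrableOn_elem k (h1.inner h3)) (integrableOn_elem k (h2.inner h3))]
    refine integral_congr_ae (Filter.Eventually.of_forall fun x => ?_)
    exact inner_add_left _ _ _
  smul_left c u hu w hw := by
    rw [fieldInner, fieldInner, Finset.mul_sum]
    refine Finset.sum_congr rfl fun k _ => ?_
    rw [← integral_const_mul]
    refine integral_congr_ae (Filter.Eventually.of_forall fun x => ?_)
    exact real_inner_smul_left _ _ _
  symm u hu v hv := by
    refine Finset.sum_congr rfl fun k _ => ?_
    refine integral_congr_ae (Filter.Eventually.of_forall fun x => ?_)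
    exact real_inner_comm _ _

lemma inner_eq_sum (x y : Pt d) : ⟪x, y⟫ = ∑ i, x i * y i := by
  rw [PiLp.inner_apply]
  exact Finset.sum_congr rfl fun i _ => mul_comm _ _

lemma fieldInner_self {η : M.BrokenField} (hη : η ∈ M.dgFields p) :
    M.fieldInner η η = ∑ k, ∑ i, ∫ x in M.elem k, (η k x i) ^ 2 := by
  refine Finset.sum_congr rfl fun k _ => ?_
  have hint : ∀ i ∈ (Finset.univ : Finset (Fin d)),
      Integrable (fun x => (η k x i) ^ 2) (volume.restrict (M.elem k)) := fun i _ =>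
    integrableOn_elem k ((isPolyOn_apply hη k i).continuous.pow 2)
  rw [← integral_finsetSum _ hint]
  refine integral_congr_ae (Filter.Eventually.of_forall fun x => ?_)
  simp only [inner_eq_sum, pow_two]

lemma fieldInner_self_nonneg (η : M.BrokenField) : 0 ≤ M.fieldInner η η :=
  Finset.sum_nonneg fun _ _ => integral_nonneg fun _ => real_inner_self_nonneg

lemma fieldInner_self_pos (hM : M.Scaled K h) (hp : 1 < p) {η : M.BrokenField}
    (hη : η ∈ M.dgFields p) (hne : η ≠ 0) : 0 < M.fieldInner η η := by
  have hK := hM.K_pos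
  have hh := hM.h_pos
  refine lt_of_le_of_ne (fieldInner_self_nonneg η) fun h0 => hne ?_
  rw [fieldInner_self hη] at h0
  have hnn : ∀ k i, 0 ≤ ∫ x in M.elem k, (η k x i) ^ 2 := fun k i =>
    integral_nonneg fun x => sq_nonneg _
  have h1 := (Finset.sum_eq_zero_iff_of_nonneg fun k _ =>
    Finset.sum_nonneg fun i _ => hnn k i).1 h0.symm
  funext k x
  ext i
  have h2 := (Finset.sum_eq_zero_iff_of_nonneg fun i _ => hnn k i).1 (h1 k (by simp)) i (by simp)
  have h3 := nodeSum_le_integral hM hp (isPolyOn_apply hη k i)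
  rw [h2, mul_zero] at h3
  have h4 := (Finset.sum_eq_zero_iff_of_nonneg fun a _ =>
    mul_nonneg (nodeWeight_pos hp a).le (sq_nonneg _)).1
    (le_antisymm h3 (nodeSum_nonneg hp k fun x => η k x i))
  refine congrFun (IsPolyOn.eq_zero hp (isPolyOn_apply hη k i) fun a => ?_) x
  have h5 := h4 a (by simp)
  simpa [(nodeWeight_pos hp a).ne'] using h5

/-- The elementwise gradient of a piecewise polynomial function is a piecewise polynomial field. -/
lemma grad_mem {v : M.BrokenFun} (hv : v ∈ M.dgSpace p) : M.grad v ∈ M.dgFields p := by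
  intro i k
  choose g hg hder using exists_partialDeriv (hv k)
  set f : Pt d → ℝ := fun x => v k (M.map k x) with hf
  have hfd : Differentiable ℝ f := differentiable_refQ (hv k)
  have hline : ∀ x : Pt d, ∀ j, fderiv ℝ f x (EuclideanSpace.single j 1) = g j x :=
    fun x j => fderiv_single_eq hfd j (hder j) x
  set A := (AffineEquiv.toContinuousAffineEquiv (M.map k).symm).toContinuousAffineMap with hA
  set w : Pt d := A.contLinear (EuclideanSpace.single i 1) with hw
  have hkey : (fun x => M.grad v k (M.map k x) i) = ∑ j, w j • g j := by
    funext x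
    have hue : v k = f ∘ A := by
      funext y
      simp only [Function.comp, hf]
      congr 1
      exact ((M.map k).apply_symm_apply y).symm
    have hAx : A (M.map k x) = x := (M.map k).symm_apply_apply x
    have e1 : M.grad v k (M.map k x) i = fderiv ℝ (v k) (M.map k x) (EuclideanSpace.single i 1) := by
      rw [← inner_gradient_left, EuclideanSpace.inner_single_right]
      simp [grad]
    have e2 : w = ∑ j, w j • EuclideanSpace.single j (1 : ℝ) := by
      ext l
      simp [Pi.single_apply]
    rw [e1, hue, fderiv_comp _ (by rw [hAx]; exact hfd x) A.differentiableAt, hAx]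
    have e3 : fderiv ℝ A (M.map k x) = A.contLinear := A.hasFDerivAt.fderiv
    rw [e3, ContinuousLinearMap.comp_apply, ← hw]
    conv_lhs => rw [e2]
    rw [map_sum, Finset.sum_apply]
    refine Finset.sum_congr rfl fun j _ => ?_
    rw [map_smul, hline]
    rfl
  change (fun x => M.grad v k (M.map k x) i) ∈ refQ d p
  rw [hkey]
  exact (refQ d p).sum_mem fun j _ => (refQ d p).smul_mem _ (hg j)

lemma differentiable_of_mem {v : M.BrokenFun} (hv : v ∈ M.dgSpace p) (k : Fin M.N) :
    Differentiable ℝ (v k) := by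
  have hue : v k = (fun x => v k (M.map k x)) ∘
      (AffineEquiv.toContinuousAffineEquiv (M.map k).symm).toContinuousAffineMap := by
    funext y
    simp only [Function.comp]
    congr 1
    exact ((M.map k).apply_symm_apply y).symm
  rw [hue]
  exact (differentiable_refQ (hv k)).comp (ContinuousAffineMap.differentiable _)

lemma grad_add {u v : M.BrokenFun} (hu : u ∈ M.dgSpace p) (hv : v ∈ M.dgSpace p) :
    M.grad (u + v) = M.grad u + M.grad v := by
  funext k x
  simp only [grad, gradient, Pi.add_apply]
  rw [fderiv_add (differentiable_of_mem hu k x) (differentiable_of_mem hv k x), map_add]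

lemma grad_smul (c : ℝ) {u : M.BrokenFun} (hu : u ∈ M.dgSpace p) :
    M.grad (c • u) = c • M.grad u := by
  funext k x
  simp only [grad, gradient, Pi.smul_apply]
  rw [fderiv_const_smul (differentiable_of_mem hu k x)]
  simp

end Mesh

namespace Mesh

variable {Ω : Set (Pt d)} {M : Mesh Ω} {K h α b : ℝ} {β : Set (Pt d) → Pt d}

/-! ### Integrals over faces -/

lemma integrableOn_face (hM : M.Scaled K h) {f : Set (Pt d)} (hf : f ∈ M.faces) {u : Pt d → ℝ}
    (hu : Continuous u) : IntegrableOn u f μHE[d - 1] := by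
  obtain ⟨σ, rfl⟩ := mem_faces.1 hf
  exact integrableOn_facet hM σ hu

lemma faceIntegral_add (hM : M.Scaled K h) {f : Set (Pt d)} (hf : f ∈ M.faces) {u v : Pt d → ℝ}
    (hu : Continuous u) (hv : Continuous v) :
    faceIntegral f (fun x => u x + v x) = faceIntegral f u + faceIntegral f v :=
  integral_add (integrableOn_face hM hf hu) (integrableOn_face hM hf hv)

lemma faceIntegral_const_mul (f : Set (Pt d)) (c : ℝ) (u : Pt d → ℝ) :
    faceIntegral f (fun x => c * u x) = c * faceIntegral f u := integral_const_mul _ _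

lemma faceIntegral_sum (hM : M.Scaled K h) {f : Set (Pt d)} (hf : f ∈ M.faces) {ι : Type*}
    (s : Finset ι) {u : ι → Pt d → ℝ} (hu : ∀ i ∈ s, Continuous (u i)) :
    faceIntegral f (fun x => ∑ i ∈ s, u i x) = ∑ i ∈ s, faceIntegral f (u i) :=
  integral_finsetSum _ fun i hi => integrableOn_face hM hf (hu i hi)

lemma faceIntegral_nonneg (f : Set (Pt d)) {u : Pt d → ℝ} (hu : ∀ x, 0 ≤ u x) :
    0 ≤ faceIntegral f u := integral_nonneg hu

lemma faceIntegral_mono (hM : M.Scaled K h) {f : Set (Pt d)} (hf : f ∈ M.faces) {u v : Pt d → ℝ}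
    (hu : Continuous u) (hv : Continuous v) (huv : ∀ x, u x ≤ v x) :
    faceIntegral f u ≤ faceIntegral f v :=
  integral_mono (integrableOn_face hM hf hu) (integrableOn_face hM hf hv) huv

lemma abs_faceIntegral_le (f : Set (Pt d)) (u : Pt d → ℝ) :
    |faceIntegral f u| ≤ faceIntegral f fun x => |u x| := abs_integral_le_integral_abs

lemma interiorFaces_subset : M.interiorFaces ⊆ M.faces := by
  classical
  exact Finset.filter_subset _ _

lemma continuous_jump {v : M.BrokenFun} (hv : v ∈ M.dgSpace p) (f : Set (Pt d)) :
    Continuous (M.jump v f) := by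
  unfold jump
  refine continuous_finsetSum _ fun σ _ => ?_
  exact (IsPolyOn.continuous (hv σ.1)).smul continuous_const

lemma continuous_avg {η : M.BrokenField} (hη : η ∈ M.dgFields p) (f : Set (Pt d)) :
    Continuous (M.avg η f) := by
  have h1 : Continuous fun x => ∑ σ ∈ M.sides f, η σ.1 x :=
    continuous_finsetSum _ fun σ _ => continuous_field hη σ.1
  exact (h1.const_smul ((M.sides f).card : ℝ)⁻¹ :)

lemma continuous_fluxJump {η : M.BrokenField} (hη : η ∈ M.dgFields p) (f : Set (Pt d)) :
    Continuous (M.fluxJump η f) := by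
  unfold fluxJump
  refine continuous_finsetSum _ fun σ _ => ?_
  exact (continuous_field hη σ.1).inner continuous_const

lemma jump_add (u v : M.BrokenFun) (f : Set (Pt d)) (x : Pt d) :
    M.jump (u + v) f x = M.jump u f x + M.jump v f x := by
  simp [jump, add_smul, Finset.sum_add_distrib]

lemma jump_smul (c : ℝ) (u : M.BrokenFun) (f : Set (Pt d)) (x : Pt d) :
    M.jump (c • u) f x = c • M.jump u f x := by
  simp [jump, mul_smul, Finset.smul_sum]

lemma avg_add (η ζ : M.BrokenField) (f : Set (Pt d)) (x : Pt d) :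
    M.avg (η + ζ) f x = M.avg η f x + M.avg ζ f x := by
  simp [avg, Finset.sum_add_distrib]

lemma avg_smul (c : ℝ) (η : M.BrokenField) (f : Set (Pt d)) (x : Pt d) :
    M.avg (c • η) f x = c • M.avg η f x := by
  simp only [avg, Pi.smul_apply]
  rw [← Finset.smul_sum, smul_comm]

lemma fluxJump_add (η ζ : M.BrokenField) (f : Set (Pt d)) (x : Pt d) :
    M.fluxJump (η + ζ) f x = M.fluxJump η f x + M.fluxJump ζ f x := by
  simp [fluxJump, Finset.sum_add_distrib, inner_add_left]

lemma fluxJump_smul (c : ℝ) (η : M.BrokenField) (f : Set (Pt d)) (x : Pt d) :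
    M.fluxJump (c • η) f x = c * M.fluxJump η f x := by
  simp [fluxJump, Finset.mul_sum, real_inner_smul_left]

/-! ### The penalty form and the lifting form -/

/-- The penalty part `∑_F ∫_F σ [u] · [v]` of the bilinear form. -/
def jumpForm (M : Mesh Ω) (p : ℕ) (α : ℝ) (u v : M.BrokenFun) : ℝ :=
  ∑ f ∈ M.faces, faceIntegral f (fun x => M.penalty p α f * ⟪M.jump u f x, M.jump v f x⟫)

/-- The right-hand side `-∑_F ∫_F [u] · {η} - ∑_{F interior} ∫_F (β · [u]) [η]` of the equation
that defines the lifting `R([u]) + L(β · [u])`. -/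
def liftForm (M : Mesh Ω) (β : Set (Pt d) → Pt d) (u : M.BrokenFun) (η : M.BrokenField) : ℝ :=
  ∑ f ∈ M.faces, -faceIntegral f (fun x => ⟪M.jump u f x, M.avg η f x⟫) +
    ∑ f ∈ M.interiorFaces, -faceIntegral f (fun x => ⟪β f, M.jump u f x⟫ * M.fluxJump η f x)

lemma isSymmBilin_jumpForm (hM : M.Scaled K h) : IsSymmBilin (M.jumpForm p α) (M.dgSpace p) where
  add_left u hu v hv w hw := by
    rw [jumpForm, jumpForm, jumpForm, ← Finset.sum_add_distrib]
    refine Finset.sum_congr rfl fun f hf => ?_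
    rw [← faceIntegral_add hM hf
      (u := fun x => M.penalty p α f * ⟪M.jump u f x, M.jump w f x⟫)
      (v := fun x => M.penalty p α f * ⟪M.jump v f x, M.jump w f x⟫)
      (continuous_const.mul ((continuous_jump hu f).inner (continuous_jump hw f)))
      (continuous_const.mul ((continuous_jump hv f).inner (continuous_jump hw f)))]
    congr 1
    funext x
    rw [jump_add, inner_add_left, mul_add]
  smul_left c u hu w hw := by
    rw [jumpForm, jumpForm, Finset.mul_sum]
    refine Finset.sum_congr rfl fun f hf => ?_
    rw [← faceIntegral_const_mul]
    congr 1
    funext x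
    rw [jump_smul, real_inner_smul_left]
    ring
  symm u hu v hv := by
    refine Finset.sum_congr rfl fun f hf => ?_
    congr 1
    funext x
    rw [real_inner_comm]

lemma liftForm_add_left (hM : M.Scaled K h) {u v : M.BrokenFun} {η : M.BrokenField}
    (hu : u ∈ M.dgSpace p) (hv : v ∈ M.dgSpace p) (hη : η ∈ M.dgFields p) :
    M.liftForm β (u + v) η = M.liftForm β u η + M.liftForm β v η := by
  rw [liftForm, liftForm, liftForm, add_add_add_comm, ← Finset.sum_add_distrib,
    ← Finset.sum_add_distrib]
  congr 1
  · refine Finset.sum_congr rfl fun f hf => ?_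
    rw [← neg_add, ← faceIntegral_add hM hf
      ((continuous_jump hu f).inner (continuous_avg hη f))
      ((continuous_jump hv f).inner (continuous_avg hη f))]
    simp only [jump_add, inner_add_left]
  · refine Finset.sum_congr rfl fun f hf => ?_
    rw [← neg_add, ← faceIntegral_add hM (interiorFaces_subset hf)
      (u := fun x => ⟪β f, M.jump u f x⟫ * M.fluxJump η f x)
      (v := fun x => ⟪β f, M.jump v f x⟫ * M.fluxJump η f x)
      ((continuous_const.inner (continuous_jump hu f)).mul (continuous_fluxJump hη f))
      ((continuous_const.inner (continuous_jump hv f)).mul (continuous_fluxJump hη f))]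
    simp only [jump_add, inner_add_right, add_mul]

lemma liftForm_smul_left (c : ℝ) (u : M.BrokenFun) (η : M.BrokenField) :
    M.liftForm β (c • u) η = c * M.liftForm β u η := by
  rw [liftForm, liftForm, mul_add, Finset.mul_sum, Finset.mul_sum]
  simp only [mul_neg, ← faceIntegral_const_mul, jump_smul, real_inner_smul_left,
    real_inner_smul_right, mul_assoc]

/-- The lifting represents a functional on the piecewise polynomial fields. -/
lemma represent_spec (hM : M.Scaled K h) (hp : 1 < p) {l : M.BrokenField → ℝ}
    (hadd : ∀ η ∈ M.dgFields p, ∀ ζ ∈ M.dgFields p, l (η + ζ) = l η + l ζ)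
    (hsmul : ∀ c : ℝ, ∀ η ∈ M.dgFields p, l (c • η) = c * l η) :
    M.represent p l ∈ M.dgFields p ∧
      ∀ η ∈ M.dgFields p, M.fieldInner (M.represent p l) η = l η := by
  have := finiteDimensional_fieldSpace (M := M) hp
  have hex : ∃ r ∈ M.dgFields p, ∀ η ∈ M.dgFields p, M.fieldInner r η = l η :=
    isSymmBilin_fieldInner.exists_repr (fun η hη hne => fieldInner_self_pos hM hp hη hne) l
      hadd hsmul
  rw [represent, dif_pos hex]
  exact hex.choose_spec

lemma rLift_spec (hM : M.Scaled K h) (hp : 1 < p) {f : Set (Pt d)} (hf : f ∈ M.faces)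
    {τ : Pt d → Pt d} (hτ : Continuous τ) :
    M.rLift p f τ ∈ M.dgFields p ∧ ∀ η ∈ M.dgFields p,
      M.fieldInner (M.rLift p f τ) η = -faceIntegral f fun x => ⟪τ x, M.avg η f x⟫ := by
  refine represent_spec hM hp (fun η hη ζ hζ => ?_) fun c η hη => ?_
  · rw [← neg_add, ← faceIntegral_add hM hf (hτ.inner (continuous_avg hη f))
      (hτ.inner (continuous_avg hζ f))]
    simp only [avg_add, inner_add_right]
  · simp only [mul_neg, ← faceIntegral_const_mul, avg_smul, real_inner_smul_right]

lemma lLift_spec (hM : M.Scaled K h) (hp : 1 < p) {f : Set (Pt d)} (hf : f ∈ M.faces)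
    {φ : Pt d → ℝ} (hφ : Continuous φ) :
    M.lLift p f φ ∈ M.dgFields p ∧ ∀ η ∈ M.dgFields p,
      M.fieldInner (M.lLift p f φ) η = -faceIntegral f fun x => φ x * M.fluxJump η f x := by
  refine represent_spec hM hp (fun η hη ζ hζ => ?_) fun c η hη => ?_
  · rw [← neg_add, ← faceIntegral_add hM hf (u := fun x => φ x * M.fluxJump η f x)
      (v := fun x => φ x * M.fluxJump ζ f x) (hφ.mul (continuous_fluxJump hη f))
      (hφ.mul (continuous_fluxJump hζ f))]
    simp only [fluxJump_add, mul_add]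
  · simp only [mul_neg, ← faceIntegral_const_mul, fluxJump_smul, mul_left_comm]

lemma lifting_mem (hM : M.Scaled K h) (hp : 1 < p) {u : M.BrokenFun} (hu : u ∈ M.dgSpace p) :
    M.lifting p β u ∈ M.dgFields p := by
  refine (M.fieldSpace p).add_mem ((M.fieldSpace p).sum_mem fun f hf => ?_)
    ((M.fieldSpace p).sum_mem fun f hf => ?_)
  · exact (rLift_spec hM hp hf (continuous_jump hu f)).1
  · exact (lLift_spec hM hp (interiorFaces_subset hf)
      (continuous_const.inner (continuous_jump hu f))).1

lemma fieldInner_lifting (hM : M.Scaled K h) (hp : 1 < p) {u : M.BrokenFun}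
    (hu : u ∈ M.dgSpace p) {η : M.BrokenField} (hη : η ∈ M.dgFields p) :
    M.fieldInner (M.lifting p β u) η = M.liftForm β u η := by
  have h1 := fun f hf => rLift_spec (p := p) hM hp (f := f) hf (continuous_jump hu f)
  have h2 := fun f hf => lLift_spec (p := p) hM hp (f := f) (interiorFaces_subset hf)
    (continuous_const.inner (𝕜 := ℝ) (f := fun _ => β f) (continuous_jump hu f))
  have hI := isSymmBilin_fieldInner (M := M) (p := p)
  rw [lifting, hI.add_left _ ((M.fieldSpace p).sum_mem fun f hf => (h1 f hf).1) _
    ((M.fieldSpace p).sum_mem fun f hf => (h2 f hf).1) _ hη,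
    hI.sum_left _ (fun f hf => (h1 f hf).1) hη, hI.sum_left _ (fun f hf => (h2 f hf).1) hη]
  congr 1
  · exact Finset.sum_congr rfl fun f hf => (h1 f hf).2 η hη
  · exact Finset.sum_congr rfl fun f hf => (h2 f hf).2 η hη

lemma dgForm_eq (hM : M.Scaled K h) (hp : 1 < p) (θ : ℝ) {u v : M.BrokenFun}
    (hu : u ∈ M.dgSpace p) (hv : v ∈ M.dgSpace p) :
    M.dgForm p θ α β u v = M.fieldInner (M.grad u) (M.grad v) + M.liftForm β v (M.grad u) +
      M.liftForm β u (M.grad v) + M.jumpForm p α u v +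
      θ * M.fieldInner (M.lifting p β u) (M.lifting p β v) := by
  rw [dgForm, isSymmBilin_fieldInner.symm (M.grad u) (grad_mem hu) _ (lifting_mem hM hp hv),
    fieldInner_lifting hM hp hv (grad_mem hu), fieldInner_lifting hM hp hu (grad_mem hv), jumpForm]

lemma isSymmBilin_dgForm (hM : M.Scaled K h) (hp : 1 < p) (θ : ℝ) :
    IsSymmBilin (M.dgForm p θ α β) (M.dgSpace p) := by
  have hI := isSymmBilin_fieldInner (M := M) (p := p)
  have hJ := isSymmBilin_jumpForm (p := p) (α := α) hM
  refine ⟨fun u hu v hv w hw => ?_, fun c u hu w hw => ?_, fun u hu v hv => ?_⟩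
  · rw [dgForm_eq hM hp θ (add_mem hu hv) hw, dgForm_eq hM hp θ hu hw, dgForm_eq hM hp θ hv hw,
      fieldInner_lifting hM hp (add_mem hu hv) (lifting_mem hM hp hw),
      fieldInner_lifting hM hp hu (lifting_mem hM hp hw),
      fieldInner_lifting hM hp hv (lifting_mem hM hp hw),
      liftForm_add_left hM hu hv (grad_mem hw), liftForm_add_left hM hu hv (lifting_mem hM hp hw),
      ← fieldInner_lifting hM hp hw (grad_mem (add_mem hu hv)),
      ← fieldInner_lifting hM hp hw (grad_mem hu), ← fieldInner_lifting hM hp hw (grad_mem hv),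
      grad_add hu hv, hI.add_right (grad_mem hu) (grad_mem hv) (lifting_mem hM hp hw),
      hI.add_left _ (grad_mem hu) _ (grad_mem hv) _ (grad_mem hw), hJ.add_left u hu v hv w hw]
    ring
  · have hcu := (M.dgSpace p).smul_mem c hu
    rw [dgForm_eq hM hp θ hcu hw, dgForm_eq hM hp θ hu hw,
      fieldInner_lifting hM hp hcu (lifting_mem hM hp hw),
      fieldInner_lifting hM hp hu (lifting_mem hM hp hw), liftForm_smul_left, liftForm_smul_left,
      ← fieldInner_lifting hM hp hw (grad_mem hcu),
      ← fieldInner_lifting hM hp hw (grad_mem hu),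
      grad_smul c hu, hI.smul_right c (grad_mem hu) (lifting_mem hM hp hw),
      hI.smul_left c _ (grad_mem hu) _ (grad_mem hw), hJ.smul_left c u hu w hw]
    ring
  · rw [dgForm_eq hM hp θ hu hv, dgForm_eq hM hp θ hv hu,
      hI.symm _ (grad_mem hu) _ (grad_mem hv), hJ.symm u hu v hv,
      hI.symm _ (lifting_mem hM hp hu) _ (lifting_mem hM hp hv)]
    ring

end Mesh

namespace Mesh

variable {Ω : Set (Pt d)} {M : Mesh Ω} {K h α b : ℝ} {β : Set (Pt d) → Pt d}

/-! ### Bound of the lifting and coercivity -/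

lemma penalty_bounds (hM : M.Scaled K h) (hα : 0 ≤ α) {f : Set (Pt d)} (hf : f ∈ M.faces) :
    α * p ^ 2 / (K * h) ≤ M.penalty p α f ∧ M.penalty p α f ≤ α * p ^ 2 * (K / h) := by
  obtain ⟨σ, hσ⟩ := mem_faces.1 hf
  have hK := hM.K_pos
  have hh := hM.h_pos
  have : Nonempty (M.sides f) := ⟨⟨σ, mem_sides.2 hσ⟩⟩
  have h1 : h / K ≤ ⨅ σ : M.sides f, M.diam σ.1.1 :=
    le_ciInf fun τ => (div_le_iff₀' hK).2 (hM.le_diam _)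
  have h2 : ⨅ σ : M.sides f, M.diam σ.1.1 ≤ K * h :=
    (ciInf_le (Set.finite_range _).bddBelow ⟨σ, mem_sides.2 hσ⟩).trans (hM.diam_le _)
  have h3 : 0 < h / K := div_pos hh hK
  constructor
  · exact div_le_div_of_nonneg_left (by positivity) (h3.trans_le h1) h2
  · refine (div_le_div_of_nonneg_left (by positivity) h3 h1).trans (le_of_eq ?_)
    field_simp

/-- The trace inequality on an element. -/
lemma faceIntegral_sq_le_integral (hd : 0 < d) (hM : M.Scaled K h) (hp : 1 < p) (σ : M.Side)
    {u : Pt d → ℝ} (hu : M.IsPolyOn p σ.1 u) :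
    faceIntegral (M.facet σ) (fun x => u x ^ 2) ≤
      3 ^ d * K ^ (2 * d - 1) * (p ^ 2 / h) * ∫ x in M.elem σ.1, u x ^ 2 := by
  have hK := hM.K_pos
  have hh := hM.h_pos
  have hp1 : (1 : ℝ) ≤ p := by exact_mod_cast hp.le
  have hI : 0 ≤ ∫ x in M.elem σ.1, u x ^ 2 := integral_nonneg fun x => sq_nonneg _
  obtain ⟨e, rfl⟩ : ∃ e, d = e + 1 := ⟨d - 1, by omega⟩
  have hN := nodeSum_nonneg (M := M) hp σ.1 u
  calc faceIntegral (M.facet σ) (fun x => u x ^ 2)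
      ≤ (K * h) ^ e * (p * (p + 1) / 2 * facetSum p σ.2.1 σ.2.2 fun x => u (M.map σ.1 x)) :=
        faceIntegral_sq_le hM hp σ hu
    _ ≤ (K * h) ^ e * (p ^ 2 * (3 ^ (e + 1) * (K / h) ^ (e + 1) *
          ∫ x in M.elem σ.1, u x ^ 2)) := by
        have h1 : (p : ℝ) * (p + 1) / 2 ≤ p ^ 2 := by nlinarith
        have h2 := (facetSum_le_nodeSum hp σ u).trans (nodeSum_le_integral hM hp hu)
        have h3 : 0 ≤ facetSum p σ.2.1 σ.2.2 fun x => u (M.map σ.1 x) := facetSum_nonneg hp _ _ _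
        gcongr
    _ = _ := by
        have : 2 * (e + 1) - 1 = e + (e + 1) := by omega
        rw [this, mul_pow, div_pow, pow_add K e (e + 1), pow_succ h e]
        field_simp

/-- The constant in the trace inequality for piecewise polynomial fields. -/
def traceConst (d : ℕ) (K : ℝ) : ℝ := 2 * d * (3 ^ d * K ^ (2 * d - 1))

lemma sum_faces_sum_sides (g : Set (Pt d) → M.Side → ℝ) :
    ∑ f ∈ M.faces, ∑ σ ∈ M.sides f, g f σ = ∑ σ, g (M.facet σ) σ := by
  classical
  rw [← Finset.sum_fiberwise_of_maps_to (s := Finset.univ) (t := M.faces) (g := M.facet)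
    fun σ _ => facet_mem_faces σ]
  refine Finset.sum_congr rfl fun f _ => ?_
  have e : M.sides f = Finset.univ.filter fun σ => M.facet σ = f := by
    ext σ; simp [mem_sides]
  rw [e]
  exact Finset.sum_congr rfl fun σ hσ => by rw [(Finset.mem_filter.1 hσ).2]

lemma sum_faceIntegral_norm_sq_le (hd : 0 < d) (hM : M.Scaled K h) (hp : 1 < p)
    {η : M.BrokenField} (hη : η ∈ M.dgFields p) :
    ∑ f ∈ M.faces, faceIntegral f (fun x => ∑ σ ∈ M.sides f, ‖η σ.1 x‖ ^ 2) ≤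
      traceConst d K * (p ^ 2 / h) * M.fieldInner η η := by
  have hc := fun k => continuous_field hη k
  calc ∑ f ∈ M.faces, faceIntegral f (fun x => ∑ σ ∈ M.sides f, ‖η σ.1 x‖ ^ 2)
      = ∑ f ∈ M.faces, ∑ σ ∈ M.sides f, faceIntegral f (fun x => ‖η σ.1 x‖ ^ 2) :=
        Finset.sum_congr rfl fun f hf => faceIntegral_sum hM hf _ fun σ _ => (hc σ.1).norm.pow 2
    _ = ∑ σ : M.Side, faceIntegral (M.facet σ) (fun x => ‖η σ.1 x‖ ^ 2) :=
        sum_faces_sum_sides fun f σ => faceIntegral f (fun x => ‖η σ.1 x‖ ^ 2)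
    _ = ∑ σ : M.Side, ∑ i, faceIntegral (M.facet σ) (fun x => (η σ.1 x i) ^ 2) := by
        refine Finset.sum_congr rfl fun σ _ => ?_
        rw [← faceIntegral_sum hM (facet_mem_faces σ) (u := fun i x => (η σ.1 x i) ^ 2) _
          fun i _ => (isPolyOn_apply hη σ.1 i).continuous.pow 2]
        congr 1
        funext x
        rw [EuclideanSpace.norm_sq_eq]
        exact Finset.sum_congr rfl fun i _ => by rw [Real.norm_eq_abs, sq_abs]
    _ ≤ ∑ σ : M.Side, ∑ i, 3 ^ d * K ^ (2 * d - 1) * (p ^ 2 / h) *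
          ∫ x in M.elem σ.1, (η σ.1 x i) ^ 2 :=
        Finset.sum_le_sum fun σ _ => Finset.sum_le_sum fun i _ =>
          faceIntegral_sq_le_integral hd hM hp σ (isPolyOn_apply hη σ.1 i)
    _ = traceConst d K * (p ^ 2 / h) * M.fieldInner η η := by
        rw [fieldInner_self hη, Fintype.sum_prod_type, Finset.mul_sum]
        refine Finset.sum_congr rfl fun k _ => ?_
        simp only [← Finset.mul_sum, Finset.sum_const, Finset.card_univ, Fintype.card_prod, Fintype.card_fin, Fintype.card_bool, nsmul_eq_mul,
          traceConst]
        push_cast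
        ring

lemma norm_avg_le (η : M.BrokenField) {f : Set (Pt d)} (hf : f ∈ M.faces) (x : Pt d) :
    ‖M.avg η f x‖ ≤ ∑ σ ∈ M.sides f, ‖η σ.1 x‖ := by
  obtain ⟨σ, hσ⟩ := mem_faces.1 hf
  have h1 : 1 ≤ (M.sides f).card := Finset.card_pos.2 ⟨σ, mem_sides.2 hσ⟩
  have h2 : (1 : ℝ) ≤ (M.sides f).card := by exact_mod_cast h1
  rw [avg, norm_smul, norm_inv, Real.norm_natCast]
  calc ((M.sides f).card : ℝ)⁻¹ * ‖∑ σ ∈ M.sides f, η σ.1 x‖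
      ≤ 1 * ∑ σ ∈ M.sides f, ‖η σ.1 x‖ := by
        gcongr
        · exact inv_le_one_of_one_le₀ h2
        · exact norm_sum_le _ _
    _ = _ := one_mul _

lemma abs_fluxJump_le (η : M.BrokenField) (f : Set (Pt d)) (x : Pt d) :
    |M.fluxJump η f x| ≤ ∑ σ ∈ M.sides f, ‖η σ.1 x‖ := by
  refine (Finset.abs_sum_le_sum_abs _ _).trans (Finset.sum_le_sum fun σ _ => ?_)
  have := abs_real_inner_le_norm (η σ.1 x) (M.normal σ)
  rwa [norm_normal, mul_one] at this

lemma norm_mul_sum_le {t : ℝ} (ht : 0 < t) (η : M.BrokenField) (f : Set (Pt d)) (x y : Pt d) :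
    ‖y‖ * ∑ σ ∈ M.sides f, ‖η σ.1 x‖ ≤
      t / 2 * ‖y‖ ^ 2 + 1 / t * ∑ σ ∈ M.sides f, ‖η σ.1 x‖ ^ 2 := by
  have h1 := sq_sum_le_card_mul_sum_sq (s := M.sides f) (f := fun σ => ‖η σ.1 x‖)
  have h2 : ((M.sides f).card : ℝ) ≤ 2 := by exact_mod_cast card_sides_le f
  have h3 : 0 ≤ ∑ σ ∈ M.sides f, ‖η σ.1 x‖ ^ 2 := Finset.sum_nonneg fun _ _ => sq_nonneg _
  set S := ∑ σ ∈ M.sides f, ‖η σ.1 x‖ with hS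
  set E := ∑ σ ∈ M.sides f, ‖η σ.1 x‖ ^ 2 with hE
  have h4 : S ^ 2 ≤ 2 * E := h1.trans (mul_le_mul_of_nonneg_right h2 h3)
  have h5 : ‖y‖ * S ≤ t / 2 * ‖y‖ ^ 2 + 1 / (2 * t) * S ^ 2 := by
    have : t / 2 * ‖y‖ ^ 2 + 1 / (2 * t) * S ^ 2 - ‖y‖ * S = (t * ‖y‖ - S) ^ 2 / (2 * t) := by
      field_simp
      ring
    have h6 : 0 ≤ (t * ‖y‖ - S) ^ 2 / (2 * t) := by positivity
    linarith
  refine h5.trans (add_le_add le_rfl ?_)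
  calc 1 / (2 * t) * S ^ 2 ≤ 1 / (2 * t) * (2 * E) := by gcongr
    _ = 1 / t * E := by field_simp

lemma sum_faceIntegral_jump_sq_le (hM : M.Scaled K h) (hα : 0 < α) (hp : 1 < p)
    (u : M.BrokenFun) :
    ∑ f ∈ M.faces, faceIntegral f (fun x => ‖M.jump u f x‖ ^ 2) ≤
      K * h / (α * p ^ 2) * M.jumpForm p α u u := by
  have hK := hM.K_pos
  have hh := hM.h_pos
  have hp0 : (0 : ℝ) < p := by exact_mod_cast (by omega : 0 < p)
  rw [jumpForm, Finset.mul_sum]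
  refine Finset.sum_le_sum fun f hf => ?_
  rw [faceIntegral_const_mul, ← mul_assoc]
  have h1 := (penalty_bounds (p := p) hM hα.le hf).1
  have h2 : 1 ≤ K * h / (α * p ^ 2) * M.penalty p α f := by
    calc (1 : ℝ) = K * h / (α * p ^ 2) * (α * p ^ 2 / (K * h)) := by field_simp
      _ ≤ _ := by gcongr
  simp only [real_inner_self_eq_norm_sq]
  exact le_mul_of_one_le_left (faceIntegral_nonneg f fun x => sq_nonneg _) h2

lemma jumpForm_self_nonneg (hM : M.Scaled K h) (hα : 0 ≤ α) (u : M.BrokenFun) :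
    0 ≤ M.jumpForm p α u u := by
  have hK := hM.K_pos
  have hh := hM.h_pos
  refine Finset.sum_nonneg fun f hf => faceIntegral_nonneg f fun x => ?_
  refine mul_nonneg (le_trans ?_ (penalty_bounds (p := p) hM hα hf).1) real_inner_self_nonneg
  positivity

/-- The lifting form is bounded by the penalty form and the `L²` norm of the field, by the trace
inequality. The parameter `s` comes from Young's inequality and is chosen later to absorb the second
term. -/
lemma abs_liftForm_le (hd : 0 < d) (hM : M.Scaled K h) (hp : 1 < p) (hα : 0 < α) (hb : 0 ≤ b)
    (hβ : ∀ f, ‖β f‖ ≤ b) {s : ℝ} (hs : 0 < s) {u : M.BrokenFun} {η : M.BrokenField}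
    (hu : u ∈ M.dgSpace p) (hη : η ∈ M.dgFields p) :
    |M.liftForm β u η| ≤ (1 + b) * (s * K / (2 * α) * M.jumpForm p α u u +
      traceConst d K / s * M.fieldInner η η) := by
  have hK := hM.K_pos
  have hh := hM.h_pos
  have hp0 : (0 : ℝ) < p := by exact_mod_cast (by omega : 0 < p)
  set t : ℝ := s * (p ^ 2 / h) with ht
  have ht0 : 0 < t := by positivity
  set g : Set (Pt d) → Pt d → ℝ := fun f x =>
    t / 2 * ‖M.jump u f x‖ ^ 2 + 1 / t * ∑ σ ∈ M.sides f, ‖η σ.1 x‖ ^ 2 with hg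
  have hj := fun f => continuous_jump hu f
  have hE : ∀ f, Continuous fun x => ∑ σ ∈ M.sides f, ‖η σ.1 x‖ ^ 2 := fun f =>
    continuous_finsetSum _ fun σ _ => (continuous_field hη σ.1).norm.pow 2
  have hj2 : ∀ f, Continuous fun x => t / 2 * ‖M.jump u f x‖ ^ 2 := fun f =>
    continuous_const.mul ((hj f).norm.pow 2)
  have hE2 : ∀ f, Continuous fun x => 1 / t * ∑ σ ∈ M.sides f, ‖η σ.1 x‖ ^ 2 := fun f =>
    continuous_const.mul (hE f)
  have hgc : ∀ f, Continuous (g f) := fun f => (hj2 f).add (hE2 f)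
  have hg0 : ∀ f x, 0 ≤ g f x := fun f x => by
    have : 0 ≤ ∑ σ ∈ M.sides f, ‖η σ.1 x‖ ^ 2 := Finset.sum_nonneg fun _ _ => sq_nonneg _
    simp only [hg]; positivity
  have h1 : ∀ f ∈ M.faces, |-faceIntegral f (fun x => ⟪M.jump u f x, M.avg η f x⟫)| ≤
      faceIntegral f (g f) := by
    intro f hf
    rw [abs_neg]
    refine (abs_faceIntegral_le _ _).trans (faceIntegral_mono hM hf
      ((hj f).inner (continuous_avg hη f)).abs (hgc f) fun x => ?_)
    refine (abs_real_inner_le_norm _ _).trans (le_trans ?_ (norm_mul_sum_le ht0 η f x _))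
    exact mul_le_mul_of_nonneg_left (norm_avg_le η hf x) (norm_nonneg _)
  have h2 : ∀ f ∈ M.interiorFaces,
      |-faceIntegral f (fun x => ⟪β f, M.jump u f x⟫ * M.fluxJump η f x)| ≤
      b * faceIntegral f (g f) := by
    intro f hf
    rw [abs_neg, ← faceIntegral_const_mul]
    refine (abs_faceIntegral_le _ _).trans (faceIntegral_mono hM (interiorFaces_subset hf)
      ((continuous_const.inner (hj f)).mul (continuous_fluxJump hη f)).abs
      (continuous_const.mul (hgc f)) fun x => ?_)
    rw [abs_mul]
    calc |⟪β f, M.jump u f x⟫| * |M.fluxJump η f x|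
        ≤ (‖β f‖ * ‖M.jump u f x‖) * ∑ σ ∈ M.sides f, ‖η σ.1 x‖ :=
          mul_le_mul (abs_real_inner_le_norm _ _) (abs_fluxJump_le η f x) (abs_nonneg _)
            (by positivity)
      _ ≤ b * (‖M.jump u f x‖ * ∑ σ ∈ M.sides f, ‖η σ.1 x‖) := by
          rw [mul_assoc]
          exact mul_le_mul_of_nonneg_right (hβ f)
            (mul_nonneg (norm_nonneg _) (Finset.sum_nonneg fun _ _ => norm_nonneg _))
      _ ≤ b * g f x := mul_le_mul_of_nonneg_left (norm_mul_sum_le ht0 η f x _) hb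
  have h3 : |M.liftForm β u η| ≤ (1 + b) * ∑ f ∈ M.faces, faceIntegral f (g f) := by
    rw [add_mul, one_mul, Finset.mul_sum]
    refine (abs_add_le _ _).trans (add_le_add ?_ ?_)
    · exact (Finset.abs_sum_le_sum_abs _ _).trans (Finset.sum_le_sum h1)
    · refine ((Finset.abs_sum_le_sum_abs _ _).trans (Finset.sum_le_sum h2)).trans ?_
      exact Finset.sum_le_sum_of_subset_of_nonneg interiorFaces_subset fun f _ _ =>
        mul_nonneg hb (faceIntegral_nonneg f (hg0 f))
  refine h3.trans (mul_le_mul_of_nonneg_left ?_ (by linarith))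
  have h4 : ∑ f ∈ M.faces, faceIntegral f (g f) =
      t / 2 * ∑ f ∈ M.faces, faceIntegral f (fun x => ‖M.jump u f x‖ ^ 2) +
      1 / t * ∑ f ∈ M.faces, faceIntegral f (fun x => ∑ σ ∈ M.sides f, ‖η σ.1 x‖ ^ 2) := by
    rw [Finset.mul_sum, Finset.mul_sum, ← Finset.sum_add_distrib]
    refine Finset.sum_congr rfl fun f hf => ?_
    rw [← faceIntegral_const_mul, ← faceIntegral_const_mul, ← faceIntegral_add hM hf (hj2 f) (hE2 f)]
  rw [h4]
  refine add_le_add ?_ ?_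
  · calc t / 2 * ∑ f ∈ M.faces, faceIntegral f (fun x => ‖M.jump u f x‖ ^ 2)
        ≤ t / 2 * (K * h / (α * p ^ 2) * M.jumpForm p α u u) :=
          mul_le_mul_of_nonneg_left (sum_faceIntegral_jump_sq_le hM hα hp u) (by positivity)
      _ = _ := by rw [ht]; field_simp
  · calc 1 / t * ∑ f ∈ M.faces, faceIntegral f (fun x => ∑ σ ∈ M.sides f, ‖η σ.1 x‖ ^ 2)
        ≤ 1 / t * (traceConst d K * (p ^ 2 / h) * M.fieldInner η η) :=
          mul_le_mul_of_nonneg_left (sum_faceIntegral_norm_sq_le hd hM hp hη) (by positivity)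
      _ = _ := by rw [ht]; field_simp

/-- The constant in the bound of the lifting by the penalty form. -/
def liftConst (d : ℕ) (K b : ℝ) : ℝ := 2 * (1 + b) ^ 2 * traceConst d K * K

lemma traceConst_pos (hd : 0 < d) (hK : 0 < K) : 0 < traceConst d K := by
  have : (0 : ℝ) < d := by exact_mod_cast hd
  unfold traceConst
  positivity

lemma liftConst_pos (hd : 0 < d) (hK : 0 < K) (hb : 0 ≤ b) : 0 < liftConst d K b := by
  have := traceConst_pos hd hK
  unfold liftConst
  positivity

/-- The `L²` norm of the lifting is bounded by the penalty form, by testing its defining equation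
with the lifting itself. The constant decays as `α` grows, which is what makes SIPG coercive. -/
lemma fieldInner_lifting_self_le (hd : 0 < d) (hM : M.Scaled K h) (hp : 1 < p) (hα : 0 < α)
    (hb : 0 ≤ b) (hβ : ∀ f, ‖β f‖ ≤ b) {u : M.BrokenFun} (hu : u ∈ M.dgSpace p) :
    M.fieldInner (M.lifting p β u) (M.lifting p β u) ≤
      liftConst d K b / α * M.jumpForm p α u u := by
  have hK := hM.K_pos
  have hT := traceConst_pos hd hK
  have hΛ := lifting_mem (β := β) hM hp hu
  set N := M.fieldInner (M.lifting p β u) (M.lifting p β u) with hN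
  have hs : 0 < 2 * (1 + b) * traceConst d K := by positivity
  have h1 := abs_liftForm_le hd hM hp hα hb hβ hs hu hΛ
  rw [← fieldInner_lifting hM hp hu hΛ, ← hN] at h1
  have h2 : (1 + b) * (2 * (1 + b) * traceConst d K * K / (2 * α) * M.jumpForm p α u u +
      traceConst d K / (2 * (1 + b) * traceConst d K) * N) =
      liftConst d K b / (2 * α) * M.jumpForm p α u u + N / 2 := by
    have hb1 : 1 + b ≠ 0 := by linarith
    rw [liftConst]
    field_simp
  rw [h2] at h1
  have h3 : liftConst d K b / α * M.jumpForm p α u u =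
      2 * (liftConst d K b / (2 * α) * M.jumpForm p α u u) := by field_simp
  rw [h3]
  linarith [le_abs_self N]

/-- The energy of the broken gradient together with the penalty form. -/
def energy (M : Mesh Ω) (p : ℕ) (α : ℝ) (v : M.BrokenFun) : ℝ :=
  M.fieldInner (M.grad v) (M.grad v) + M.jumpForm p α v v

/-- The bilinear form is equivalent to the energy, for LDG with any penalty parameter `α ≥ 1` and
for SIPG if `α` is large compared to the constant of the lifting. -/
lemma dgForm_equiv (hd : 0 < d) (hM : M.Scaled K h) (hp : 1 < p) (hα : 1 ≤ α)
    (hb : 0 ≤ b) (hβ : ∀ f, ‖β f‖ ≤ b) {θ : ℝ}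
    (hθ : θ = 1 ∨ θ = 0 ∧ 4 * liftConst d K b ≤ α) {v : M.BrokenFun} (hv : v ∈ M.dgSpace p) :
    M.energy p α v ≤ (2 * liftConst d K b + 2) * M.dgForm p θ α β v v ∧
      M.dgForm p θ α β v v ≤ (2 * liftConst d K b + 2) * M.energy p α v := by
  have hK := hM.K_pos
  have hD := liftConst_pos hd hK hb
  have hα0 : 0 < α := by linarith
  have hI := isSymmBilin_fieldInner (M := M) (p := p)
  have hg := grad_mem hv
  have hΛ := lifting_mem (β := β) hM hp hv
  have hJ := jumpForm_self_nonneg (p := p) hM hα0.le v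
  have hN := fieldInner_lifting_self_le hd hM hp hα0 hb hβ hv
  have hform : M.dgForm p θ α β v v = M.fieldInner (M.grad v) (M.grad v) +
      2 * M.fieldInner (M.grad v) (M.lifting p β v) + M.jumpForm p α v v +
      θ * M.fieldInner (M.lifting p β v) (M.lifting p β v) := by
    rw [dgForm, jumpForm, hI.symm _ hΛ _ hg]
    ring
  have hG := fieldInner_self_nonneg (M := M) (M.grad v)
  have hN0 := fieldInner_self_nonneg (M := M) (M.lifting p β v)
  have hy := fun c => hI.young (fun u _ => fieldInner_self_nonneg u) c hg hΛ
  rw [hform, energy]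
  set D := liftConst d K b with hDdef
  set G := M.fieldInner (M.grad v) (M.grad v)
  set N := M.fieldInner (M.lifting p β v) (M.lifting p β v)
  set J := M.jumpForm p α v v
  set I := M.fieldInner (M.grad v) (M.lifting p β v)
  have hDα : D / α ≤ D := div_le_self hD.le hα
  have hN1 : N ≤ D * J := hN.trans (mul_le_mul_of_nonneg_right hDα hJ)
  rcases hθ with rfl | ⟨rfl, hα4⟩
  · constructor
    · -- the weight `c = 2D/(2D+1)` leaves half of the penalty form
      have h1 := hy (2 * D / (2 * D + 1))
      have h2 : -(2 * I) ≤ (2 * D / (2 * D + 1)) * G + (1 + 1 / (2 * D)) * N := by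
        have h3 : 0 < (2 * D + 1) / (2 * D) := by positivity
        have h4 := mul_le_mul_of_nonneg_left h1 h3.le
        have e1 : (2 * D + 1) / (2 * D) * -(2 * (2 * D / (2 * D + 1)) * I) = -(2 * I) := by
          field_simp
        have e2 : (2 * D + 1) / (2 * D) * ((2 * D / (2 * D + 1)) ^ 2 * G + N) =
            (2 * D / (2 * D + 1)) * G + (1 + 1 / (2 * D)) * N := by
          field_simp
        rwa [e1, e2] at h4
      have h5 : 1 / (2 * D) * N ≤ J / 2 := by
        calc 1 / (2 * D) * N ≤ 1 / (2 * D) * (D * J) := by gcongr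
          _ = J / 2 := by field_simp
      have h6 : G / (2 * D + 1) + J / 2 ≤ G + 2 * I + J + 1 * N := by
        have e3 : (2 * D / (2 * D + 1)) * G = G - G / (2 * D + 1) := by field_simp; ring
        rw [e3] at h2
        linarith
      calc G + J ≤ (2 * D + 2) * (G / (2 * D + 1) + J / 2) := by
            have e4 : (2 * D + 2) * (G / (2 * D + 1) + J / 2) =
              G + J + (G / (2 * D + 1) + D * J) := by field_simp; ring
            rw [e4]
            have : 0 ≤ G / (2 * D + 1) + D * J := by positivity
            linarith
        _ ≤ _ := by gcongr
    · have h1 := hy (-1)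
      nlinarith
  · constructor
    · have h1 := hy (1 / 2)
      have h2 : N ≤ J / 4 := by
        refine hN.trans ?_
        calc D / α * J ≤ 1 / 4 * J := by
              refine mul_le_mul_of_nonneg_right ((div_le_iff₀ hα0).2 ?_) hJ
              linarith
          _ = J / 4 := by ring
      nlinarith
    · have h1 := hy (-1)
      nlinarith

end Mesh

namespace Mesh

variable {Ω : Set (Pt d)} {M : Mesh Ω} {K h α b θ : ℝ} {β : Set (Pt d) → Pt d}

/-! ### The nodal basis and the Jacobi solver -/

/-- The nodal basis function of the node `a` of the element `k`, zero on all other elements. -/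
def hat (M : Mesh Ω) (k : Fin M.N) (a : NodeIdx d p) : M.BrokenFun :=
  Pi.single k fun x => refBasis a ((M.map k).symm x)

lemma hat_self (k : Fin M.N) (a : NodeIdx d p) (x : Pt d) :
    M.hat k a k x = refBasis a ((M.map k).symm x) := by
  rw [hat, Pi.single_eq_same]

lemma hat_of_ne {k l : Fin M.N} (hl : l ≠ k) (a : NodeIdx d p) : M.hat k a l = 0 := by
  rw [hat, Pi.single_eq_of_ne hl]

lemma hat_node (k l : Fin M.N) (a b : NodeIdx d p) :
    M.hat k a l (M.node l b) = if (l, b) = (k, a) then 1 else 0 := by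
  by_cases hl : l = k
  · subst hl
    rw [hat_self, node, AffineEquiv.symm_apply_apply, refBasis_refNode]
    simp [eq_comm]
  · rw [hat_of_ne hl]
    simp [hl]

lemma isPolyOn_refBasis (hp : 1 < p) (k : Fin M.N) (a : NodeIdx d p) :
    M.IsPolyOn p k fun x => refBasis a ((M.map k).symm x) := by
  have := refBasis_mem_refQ hp a
  simpa [IsPolyOn] using this

lemma hat_mem_dgSpace (hp : 1 < p) (k : Fin M.N) (a : NodeIdx d p) : M.hat k a ∈ M.dgSpace p := by
  intro l
  by_cases hl : l = k
  · subst hl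
    simp only [hat_self]
    exact isPolyOn_refBasis hp l a
  · rw [hat_of_ne hl]
    exact (refQ d p).zero_mem

lemma hat_mem_bdrySpace (hp : 1 < p) (k : Fin M.N) {a : NodeIdx d p} (ha : IsBdryNode a) :
    M.hat k a ∈ M.bdrySpace p := by
  refine ⟨hat_mem_dgSpace hp k a, fun l b hb => ?_⟩
  rw [hat_node, if_neg]
  rintro ⟨⟩
  exact hb ha

lemma hat_mem_nodalSpace (hp : 1 < p) (k : Fin M.N) {a : NodeIdx d p} (ha : IsBdryNode a) :
    M.hat k a ∈ M.nodalSpace k a :=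
  ⟨hat_mem_bdrySpace hp k ha, fun l b _ hne => by rw [hat_node, if_neg hne]⟩

lemma bdrySpace_le : M.bdrySpace p ≤ M.dgSpace p := fun _ hv => hv.1

lemma nodalSpace_le (k : Fin M.N) (a : NodeIdx d p) : M.nodalSpace k a ≤ M.bdrySpace p :=
  fun _ hv => hv.1

lemma eq_of_node (hp : 1 < p) {u v : M.BrokenFun} (hu : u ∈ M.dgSpace p) (hv : v ∈ M.dgSpace p)
    (huv : ∀ k, ∀ a : NodeIdx d p, u k (M.node k a) = v k (M.node k a)) : u = v := by
  funext k x
  rw [IsPolyOn.eq_sum hp (hu k) x, IsPolyOn.eq_sum hp (hv k) x]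
  simp only [huv]

open Classical in
/-- The boundary nodes of all elements, each an element with an index: the degrees of freedom of
`V_hp^B`. -/
def bdryNodes (M : Mesh Ω) (p : ℕ) : Finset (Fin M.N × NodeIdx d p) :=
  Finset.univ.filter fun ξ => IsBdryNode ξ.2

lemma mem_bdryNodes {ξ : Fin M.N × NodeIdx d p} : ξ ∈ M.bdryNodes p ↔ IsBdryNode ξ.2 := by
  classical
  simp [bdryNodes]

lemma sum_smul_hat_node (c : Fin M.N × NodeIdx d p → ℝ) (s : Finset (Fin M.N × NodeIdx d p))
    (l : Fin M.N) (b : NodeIdx d p) [Decidable ((l, b) ∈ s)] :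
    (∑ ξ ∈ s, c ξ • M.hat ξ.1 ξ.2) l (M.node l b) = if (l, b) ∈ s then c (l, b) else 0 := by
  classical
  rw [Finset.sum_apply, Finset.sum_apply]
  simp only [Pi.smul_apply, hat_node, smul_eq_mul, mul_ite, mul_one, mul_zero, Prod.mk.eta]
  rw [Finset.sum_ite_eq]
  congr

lemma eq_sum_hat (hp : 1 < p) {v : M.BrokenFun} (hv : v ∈ M.bdrySpace p) :
    v = ∑ ξ ∈ M.bdryNodes p, v ξ.1 (M.node ξ.1 ξ.2) • M.hat ξ.1 ξ.2 := by
  classical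
  refine eq_of_node hp hv.1 ((M.dgSpace p).sum_mem fun ξ _ =>
    (M.dgSpace p).smul_mem _ (hat_mem_dgSpace hp _ _)) fun k a => ?_
  rw [sum_smul_hat_node (fun ξ => v ξ.1 (M.node ξ.1 ξ.2))]
  split_ifs with h1
  · rfl
  · exact hv.2 k a fun ha => h1 (mem_bdryNodes.2 ha)

lemma eq_smul_hat (hp : 1 < p) {k : Fin M.N} {a : NodeIdx d p} {v : M.BrokenFun}
    (hv : v ∈ M.nodalSpace k a) : v = v k (M.node k a) • M.hat k a := by
  refine eq_of_node hp hv.1.1 ((M.dgSpace p).smul_mem _ (hat_mem_dgSpace hp _ _)) fun l b => ?_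
  simp only [Pi.smul_apply, hat_node, smul_eq_mul, mul_ite, mul_one, mul_zero]
  split_ifs with h1
  · cases h1; rfl
  · by_cases hb : IsBdryNode b
    · exact hv.2 l b hb h1
    · exact hv.1.2 l b hb

lemma finiteDimensional_of_le (hp : 1 < p) {W : Submodule ℝ M.BrokenFun} (hW : W ≤ M.dgSpace p) :
    FiniteDimensional ℝ W := by
  have := finiteDimensional_dgSpace (M := M) hp
  exact Submodule.finiteDimensional_of_le hW

lemma ellipticProj_spec {V : Type*} [AddCommGroup V] [Module ℝ V] {A : V → V → ℝ}
    {U W : Submodule ℝ V} [FiniteDimensional ℝ W] (hA : IsSymmBilin A U)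
    (hW : W ≤ U) (hpos : ∀ u ∈ W, u ≠ 0 → 0 < A u u) {v : V} (hv : v ∈ U) :
    ellipticProj A W v ∈ W ∧ ∀ z ∈ W, A (ellipticProj A W v) z = A v z := by
  have hex : ∃ w ∈ W, ∀ z ∈ W, A w z = A v z :=
    (hA.mono hW).exists_repr hpos (A v) (fun x hx y hy => hA.add_right (hW hx) (hW hy) hv)
      fun c x hx => hA.smul_right c (hW hx) hv
  rw [ellipticProj, dif_pos hex]
  exact hex.choose_spec

lemma ellipticProj_of_mem {V : Type*} [AddCommGroup V] [Module ℝ V] {A : V → V → ℝ}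
    {W : Submodule ℝ V} [FiniteDimensional ℝ W] (hA : IsSymmBilin A W)
    (hpos : ∀ u ∈ W, u ≠ 0 → 0 < A u u) {v : V} (hv : v ∈ W) : ellipticProj A W v = v := by
  obtain ⟨h1, h2⟩ := ellipticProj_spec hA le_rfl hpos hv
  by_contra hne
  have h3 := hpos _ (W.sub_mem h1 hv) (sub_ne_zero.2 hne)
  rw [hA.sub_left h1 hv (W.sub_mem h1 hv), h2 _ (W.sub_mem h1 hv), sub_self] at h3
  exact lt_irrefl _ h3

lemma hat_ne_zero (k : Fin M.N) (a : NodeIdx d p) : M.hat k a ≠ 0 := by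
  intro h0
  have := hat_node (M := M) k k a a
  rw [h0] at this
  simp at this

/-- The Jacobi solver on `V_hp^B` is the diagonal scaling of the stiffness matrix. -/
lemma jacobi_eq (hp : 1 < p) (hA : IsSymmBilin (M.dgForm p θ α β) (M.bdrySpace p))
    (hpos : ∀ u ∈ M.bdrySpace p, u ≠ 0 → 0 < M.dgForm p θ α β u u) {v : M.BrokenFun}
    (hv : v ∈ M.bdrySpace p) :
    M.jacobi p θ α β v = ∑ ξ ∈ M.bdryNodes p,
      (M.dgForm p θ α β v (M.hat ξ.1 ξ.2) /
        M.dgForm p θ α β (M.hat ξ.1 ξ.2) (M.hat ξ.1 ξ.2)) • M.hat ξ.1 ξ.2 := by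
  classical
  have := finiteDimensional_of_le (M := M) hp bdrySpace_le
  have hsum : M.jacobi p θ α β v = ∑ ξ ∈ M.bdryNodes p,
      ellipticProj (M.dgForm p θ α β) (M.nodalSpace ξ.1 ξ.2) v := by
    rw [jacobi, ellipticProj_of_mem hA hpos hv, bdryNodes, Finset.sum_filter,
      Fintype.sum_prod_type]
    refine Finset.sum_congr rfl fun k _ => ?_
    rw [Finset.sum_filter]
  rw [hsum]
  refine Finset.sum_congr rfl fun ξ hξ => ?_
  have hb := mem_bdryNodes.1 hξ
  have := finiteDimensional_of_le (M := M) hp ((nodalSpace_le ξ.1 ξ.2).trans bdrySpace_le)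
  obtain ⟨h1, h2⟩ := ellipticProj_spec hA (nodalSpace_le ξ.1 ξ.2)
    (fun u hu => hpos u (nodalSpace_le _ _ hu)) hv
  set w := ellipticProj (M.dgForm p θ α β) (M.nodalSpace ξ.1 ξ.2) v with hw
  have hφ := hat_mem_bdrySpace (M := M) hp ξ.1 hb
  have h3 := h2 _ (hat_mem_nodalSpace hp ξ.1 hb)
  have h4 := hpos _ hφ (hat_ne_zero _ _)
  have h5 := eq_smul_hat hp h1
  rw [h5, hA.smul_left _ _ hφ _ hφ] at h3
  rw [h5, ← h3, mul_div_cancel_right₀ _ h4.ne']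

lemma jacobi_node (hp : 1 < p) (hA : IsSymmBilin (M.dgForm p θ α β) (M.bdrySpace p))
    (hpos : ∀ u ∈ M.bdrySpace p, u ≠ 0 → 0 < M.dgForm p θ α β u u) {v : M.BrokenFun}
    (hv : v ∈ M.bdrySpace p) {ξ : Fin M.N × NodeIdx d p} (hξ : ξ ∈ M.bdryNodes p) :
    M.dgForm p θ α β v (M.hat ξ.1 ξ.2) = M.jacobi p θ α β v ξ.1 (M.node ξ.1 ξ.2) *
      M.dgForm p θ α β (M.hat ξ.1 ξ.2) (M.hat ξ.1 ξ.2) := by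
  classical
  have h4 := hpos _ (hat_mem_bdrySpace (M := M) hp ξ.1 (mem_bdryNodes.1 hξ)) (hat_ne_zero _ _)
  rw [jacobi_eq hp hA hpos hv, sum_smul_hat_node (fun ξ => M.dgForm p θ α β v (M.hat ξ.1 ξ.2) /
        M.dgForm p θ α β (M.hat ξ.1 ξ.2) (M.hat ξ.1 ξ.2)), if_pos hξ]
  field_simp

lemma dgForm_eq_sum_hat (hp : 1 < p) (hA : IsSymmBilin (M.dgForm p θ α β) (M.bdrySpace p))
    {v w : M.BrokenFun} (hv : v ∈ M.bdrySpace p) (hw : w ∈ M.bdrySpace p) :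
    M.dgForm p θ α β w v = ∑ ξ ∈ M.bdryNodes p,
      v ξ.1 (M.node ξ.1 ξ.2) * M.dgForm p θ α β w (M.hat ξ.1 ξ.2) := by
  have hφ := fun (ξ : Fin M.N × NodeIdx d p) (hξ : ξ ∈ M.bdryNodes p) =>
    hat_mem_bdrySpace (M := M) hp ξ.1 (mem_bdryNodes.1 hξ)
  conv_lhs => rw [eq_sum_hat hp hv]
  rw [hA.symm _ hw _ ((M.bdrySpace p).sum_mem fun ξ hξ => (M.bdrySpace p).smul_mem _ (hφ ξ hξ)),
    hA.sum_left _ (fun ξ hξ => (M.bdrySpace p).smul_mem _ (hφ ξ hξ)) hw]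
  refine Finset.sum_congr rfl fun ξ hξ => ?_
  rw [hA.smul_left _ _ (hφ ξ hξ) _ hw, hA.symm _ hw _ (hφ ξ hξ)]

/-- A function annihilated by the solver is orthogonal to every nodal basis function, hence zero:
the solver divides the residuals by the positive diagonal entries of the stiffness matrix. -/
lemma bijOn_jacobi (hp : 1 < p) (hA : IsSymmBilin (M.dgForm p θ α β) (M.bdrySpace p))
    (hpos : ∀ u ∈ M.bdrySpace p, u ≠ 0 → 0 < M.dgForm p θ α β u u) :
    Set.BijOn (M.jacobi p θ α β) (M.bdrySpace p) (M.bdrySpace p) := by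
  have hφ := fun (ξ : Fin M.N × NodeIdx d p) (hξ : ξ ∈ M.bdryNodes p) =>
    hat_mem_bdrySpace (M := M) hp ξ.1 (mem_bdryNodes.1 hξ)
  have hmaps : Set.MapsTo (M.jacobi p θ α β) (M.bdrySpace p) (M.bdrySpace p) := by
    intro v hv
    rw [SetLike.mem_coe, jacobi_eq hp hA hpos hv]
    exact (M.bdrySpace p).sum_mem fun ξ hξ => (M.bdrySpace p).smul_mem _ (hφ ξ hξ)
  refine ⟨hmaps, fun u hu v hv huv => ?_, fun v hv => ?_⟩
  · have hw := (M.bdrySpace p).sub_mem hu hv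
    by_contra hne
    have h1 := hpos _ hw (sub_ne_zero.2 hne)
    rw [dgForm_eq_sum_hat hp hA hw hw, Finset.sum_eq_zero] at h1
    · exact lt_irrefl _ h1
    · intro ξ hξ
      rw [hA.sub_left hu hv (hφ ξ hξ), jacobi_node hp hA hpos hu hξ, jacobi_node hp hA hpos hv hξ,
        huv, sub_self, mul_zero]
  · have := finiteDimensional_of_le (M := M) hp bdrySpace_le
    obtain ⟨w, hw, hwz⟩ := hA.exists_repr hpos
      (fun z => ∑ ξ ∈ M.bdryNodes p, z ξ.1 (M.node ξ.1 ξ.2) * (v ξ.1 (M.node ξ.1 ξ.2) *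
        M.dgForm p θ α β (M.hat ξ.1 ξ.2) (M.hat ξ.1 ξ.2)))
      (fun x _ y _ => by simp [add_mul, Finset.sum_add_distrib])
      (fun c x _ => by simp [Finset.mul_sum, mul_assoc])
    refine ⟨w, hw, eq_of_node hp (hmaps hw).1 hv.1 fun k a => ?_⟩
    by_cases ha : IsBdryNode a
    · have hξ : (k, a) ∈ M.bdryNodes p := mem_bdryNodes.2 ha
      have h1 := jacobi_node hp hA hpos hw hξ
      have h4 := hpos _ (hφ _ hξ) (hat_ne_zero _ _)
      have h2 := hwz _ (hφ _ hξ)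
      rw [Finset.sum_eq_single (k, a)] at h2
      · rw [hat_node, if_pos rfl, one_mul, h1] at h2
        exact mul_right_cancel₀ h4.ne' h2
      · intro ξ _ hne
        rw [hat_node, if_neg hne, zero_mul]
      · exact fun hn => absurd hξ hn
    · exact ((hmaps hw).2 k a ha).trans (hv.2 k a ha).symm

/-- The form of the inverse solver is diagonal in the nodal basis, with the diagonal entries of the
stiffness matrix. -/
lemma dgForm_jacobiInv (hp : 1 < p) (hA : IsSymmBilin (M.dgForm p θ α β) (M.bdrySpace p))
    (hpos : ∀ u ∈ M.bdrySpace p, u ≠ 0 → 0 < M.dgForm p θ α β u u) {v : M.BrokenFun}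
    (hv : v ∈ M.bdrySpace p) :
    M.dgForm p θ α β (M.jacobiInv p θ α β v) v = ∑ ξ ∈ M.bdryNodes p,
      v ξ.1 (M.node ξ.1 ξ.2) ^ 2 * M.dgForm p θ α β (M.hat ξ.1 ξ.2) (M.hat ξ.1 ξ.2) := by
  obtain ⟨w, hw, hwv⟩ := (bijOn_jacobi hp hA hpos).surjOn hv
  have hex : ∃ w ∈ (M.bdrySpace p : Set M.BrokenFun), M.jacobi p θ α β w = v := ⟨w, hw, hwv⟩
  have h1 : M.jacobiInv p θ α β v ∈ M.bdrySpace p := Function.invFunOn_mem hex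
  have h2 : M.jacobi p θ α β (M.jacobiInv p θ α β v) = v := Function.invFunOn_eq hex
  rw [dgForm_eq_sum_hat hp hA hv h1]
  refine Finset.sum_congr rfl fun ξ hξ => ?_
  rw [jacobi_node hp hA hpos h1 hξ, h2]
  ring

/-- The broken gradient is positive definite on `V_hp^B`: a function that is constant on an element
and vanishes at an interior node is zero there. -/
lemma energy_pos (hM : M.Scaled K h) (hp : 1 < p) (hα : 0 ≤ α) {v : M.BrokenFun}
    (hv : v ∈ M.bdrySpace p) (hne : v ≠ 0) : 0 < M.energy p α v := by
  classical
  have hJ := jumpForm_self_nonneg (p := p) hM hα v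
  refine add_pos_of_pos_of_nonneg (fieldInner_self_pos hM hp (grad_mem hv.1) fun h0 => hne ?_) hJ
  obtain ⟨t, ht, ht1⟩ : ∃ t ∈ gllNodes p, t ∉ ({1, -1} : Finset ℝ) := by
    refine Finset.exists_mem_notMem_of_card_lt_card ?_
    rw [card_gllNodes hp]
    have := Finset.card_le_two (a := (1 : ℝ)) (b := -1)
    omega
  simp only [Finset.mem_insert, Finset.mem_singleton, not_or] at ht1
  have hb : ¬ IsBdryNode (fun _ => ⟨t, ht⟩ : NodeIdx d p) := by
    rintro ⟨i, hi | hi⟩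
    · exact ht1.1 hi
    · exact ht1.2 hi
  funext k x
  have h1 : ∀ y, fderiv ℝ (v k) y = 0 := by
    intro y
    have h2 : M.grad v k y = 0 := by rw [h0]; rfl
    simpa [grad, gradient] using h2
  rw [is_const_of_fderiv_eq_zero (differentiable_of_mem hv.1 k) h1 x (M.node k _)]
  exact hv.2 k _ hb

end Mesh

namespace Mesh

variable {Ω : Set (Pt d)} {M : Mesh Ω} {K h α : ℝ}

/-! ### The energy in terms of nodal values -/

lemma norm_jump_sq_le (v : M.BrokenFun) (f : Set (Pt d)) (x : Pt d) :
    ‖M.jump v f x‖ ^ 2 ≤ 2 * ∑ σ ∈ M.sides f, v σ.1 x ^ 2 := by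
  have h1 : ‖M.jump v f x‖ ≤ ∑ σ ∈ M.sides f, |v σ.1 x| := by
    refine (norm_sum_le _ _).trans (Finset.sum_le_sum fun σ _ => ?_)
    rw [norm_smul, norm_normal, mul_one, Real.norm_eq_abs]
  have h2 := sq_sum_le_card_mul_sum_sq (s := M.sides f) (f := fun σ => |v σ.1 x|)
  have h3 : ((M.sides f).card : ℝ) ≤ 2 := by exact_mod_cast card_sides_le f
  simp only [sq_abs] at h2
  calc ‖M.jump v f x‖ ^ 2 ≤ (∑ σ ∈ M.sides f, |v σ.1 x|) ^ 2 :=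
        pow_le_pow_left₀ (norm_nonneg _) h1 2
    _ ≤ _ := h2.trans (mul_le_mul_of_nonneg_right h3 (Finset.sum_nonneg fun _ _ => sq_nonneg _))

/-- The constant in the bound of the energy by nodal values. -/
def inverseConst (d : ℕ) (K : ℝ) : ℝ := 96 * d * K ^ (d + 2) + 4 * d * K ^ d

/-- The common scaling factor `p⁴ h^(d-2)` of the stiffness matrix, up to the penalty
parameter. -/
def stiffnessScale (d p : ℕ) (h : ℝ) : ℝ := p ^ 4 * (h ^ d / h ^ 2)

lemma stiffnessScale_pos (hh : 0 < h) (hp : 1 < p) : 0 < stiffnessScale d p h := by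
  have hp0 : (0 : ℝ) < p := by exact_mod_cast (by omega : 0 < p)
  unfold stiffnessScale
  positivity

/-- The inverse inequalities bound the energy by weighted nodal values. The gradient and the penalty
both contribute at most the order `p⁴ h^(d-2)`. -/
lemma energy_le (hd : 0 < d) (hM : M.Scaled K h) (hp : 1 < p) (hα : 1 ≤ α) {v : M.BrokenFun}
    (hv : v ∈ M.dgSpace p) :
    M.energy p α v ≤ inverseConst d K * (α * stiffnessScale d p h) * ∑ k, M.nodeSum p k (v k) := by
  have hK := hM.K_pos
  have hh := hM.h_pos
  have hα0 : 0 < α := by linarith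
  have hp1 : (1 : ℝ) ≤ p := by exact_mod_cast hp.le
  have hn := fun k => nodeSum_nonneg (M := M) hp k (v k)
  obtain ⟨e, rfl⟩ : ∃ e, d = e + 1 := ⟨d - 1, by omega⟩
  have hG : M.fieldInner (M.grad v) (M.grad v) ≤ 96 * (e + 1 : ℕ) * K ^ (e + 1 + 2) *
      (α * stiffnessScale (e + 1) p h) * ∑ k, M.nodeSum p k (v k) := by
    rw [fieldInner, Finset.mul_sum]
    refine Finset.sum_le_sum fun k _ => ?_
    have h1 := integral_elem_gradient_le hM hp (hv k)
    simp only [real_inner_self_eq_norm_sq, grad]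
    refine h1.trans ?_
    have h2 : (K * h) ^ (e + 1) * ((K / h) ^ 2 * ((e + 1 : ℕ) * (96 * p ^ 4 *
        M.nodeSum p k (v k)))) = 96 * (e + 1 : ℕ) * K ^ (e + 1 + 2) *
        (1 * stiffnessScale (e + 1) p h) * M.nodeSum p k (v k) := by
      rw [stiffnessScale, mul_pow, div_pow, pow_add K (e + 1) 2]
      field_simp
    rw [h2]
    have := hn k
    have := stiffnessScale_pos (d := e + 1) hh hp
    gcongr
  have hJ : M.jumpForm p α v v ≤ 4 * (e + 1 : ℕ) * K ^ (e + 1) *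
      (α * stiffnessScale (e + 1) p h) * ∑ k, M.nodeSum p k (v k) := by
    have hc := fun k => IsPolyOn.continuous (hv k)
    calc M.jumpForm p α v v
        ≤ ∑ f ∈ M.faces, ∑ σ ∈ M.sides f,
            α * p ^ 2 * (K / h) * 2 * faceIntegral f (fun x => v σ.1 x ^ 2) := by
          refine Finset.sum_le_sum fun f hf => ?_
          rw [← Finset.mul_sum, ← faceIntegral_sum hM hf (u := fun (σ : M.Side) x => v σ.1 x ^ 2) _
            fun σ _ => (hc σ.1).pow 2, ← faceIntegral_const_mul]
          have hsc : Continuous fun x => ∑ σ ∈ M.sides f, v σ.1 x ^ 2 :=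
            continuous_finsetSum _ fun σ _ => (hc σ.1).pow 2
          have hj := continuous_jump hv f
          refine faceIntegral_mono hM hf (continuous_const.mul (hj.inner hj))
            (continuous_const.mul hsc) fun x => ?_
          rw [real_inner_self_eq_norm_sq, mul_assoc _ (2 : ℝ)]
          exact mul_le_mul (penalty_bounds hM hα0.le hf).2 (norm_jump_sq_le v f x) (sq_nonneg _)
            (by positivity)
      _ = ∑ σ : M.Side, α * p ^ 2 * (K / h) * 2 *
            faceIntegral (M.facet σ) (fun x => v σ.1 x ^ 2) :=
          sum_faces_sum_sides fun f σ =>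
            α * p ^ 2 * (K / h) * 2 * faceIntegral f (fun x => v σ.1 x ^ 2)
      _ ≤ ∑ σ : M.Side, α * p ^ 2 * (K / h) * 2 *
            ((K * h) ^ e * (p ^ 2 * M.nodeSum p σ.1 (v σ.1))) := by
          refine Finset.sum_le_sum fun σ _ => mul_le_mul_of_nonneg_left ?_ (by positivity)
          refine (faceIntegral_sq_le hM hp σ (hv σ.1)).trans ?_
          have h1 : (p : ℝ) * (p + 1) / 2 ≤ p ^ 2 := by nlinarith
          have h2 := facetSum_le_nodeSum hp σ (v σ.1)
          have h3 : 0 ≤ facetSum p σ.2.1 σ.2.2 fun x => v σ.1 (M.map σ.1 x) :=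
            facetSum_nonneg hp _ _ _
          simp only [Nat.add_sub_cancel]
          gcongr
      _ = _ := by
          rw [Fintype.sum_prod_type, Finset.mul_sum]
          refine Finset.sum_congr rfl fun k _ => ?_
          simp only [Finset.sum_const, Finset.card_univ, Fintype.card_prod, Fintype.card_fin,
            Fintype.card_bool, nsmul_eq_mul, stiffnessScale]
          push_cast
          rw [mul_pow, pow_succ K e, pow_succ h e]
          field_simp
          ring
  rw [energy, inverseConst, add_mul, add_mul]
  exact add_le_add hG hJ

lemma jump_of_sides_eq {σ : M.Side} (h1 : M.sides (M.facet σ) = {σ}) (v : M.BrokenFun)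
    (x : Pt d) : M.jump v (M.facet σ) x = v σ.1 x • M.normal σ := by
  rw [jump, h1, Finset.sum_singleton]

lemma jump_of_common {σ τ : M.Side} (hne : σ.1 ≠ τ.1) (hf : M.facet σ = M.facet τ)
    (v : M.BrokenFun) (x : Pt d) :
    M.jump v (M.facet σ) x = (v σ.1 x - v τ.1 x) • M.normal σ := by
  classical
  have hστ : τ ≠ σ := fun h => hne (congrArg Prod.fst h.symm)
  have hτ : τ ∈ M.sides (M.facet σ) := mem_sides.2 hf.symm
  rcases sides_facet σ with h1 | ⟨ρ, -, -, h1⟩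
  · rw [h1, Finset.mem_singleton] at hτ
    exact absurd hτ hστ
  · rw [h1, Finset.mem_insert, Finset.mem_singleton] at hτ
    obtain rfl := hτ.resolve_left hστ
    rw [jump, h1, Finset.sum_pair hστ.symm, normal_eq_neg hf hne, smul_neg, ← sub_eq_add_neg,
      ← sub_smul]

/-- On a face, the jump is a polynomial multiple of the normal. -/
lemma exists_jump_eq (σ : M.Side) {v : M.BrokenFun} (hv : v ∈ M.dgSpace p) :
    ∃ u, M.IsPolyOn p σ.1 u ∧ ∀ x ∈ M.facet σ, M.jump v (M.facet σ) x = u x • M.normal σ := by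
  rcases sides_facet σ with h1 | ⟨τ, hne, hf, -⟩
  · exact ⟨v σ.1, hv σ.1, fun x _ => jump_of_sides_eq h1 v x⟩
  · obtain ⟨w, hw, hwx⟩ := exists_isPolyOn_eq_on_facet hf (hv τ.1)
    refine ⟨fun x => v σ.1 x - w x, (refQ d p).sub_mem (hv σ.1) hw, fun x hx => ?_⟩
    simp only [jump_of_common hne hf, hwx x hx]

lemma jump_hat (σ : M.Side) (a : NodeIdx d p) (x : Pt d) :
    M.jump (M.hat σ.1 a) (M.facet σ) x = M.hat σ.1 a σ.1 x • M.normal σ := by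
  rcases sides_facet σ with h1 | ⟨τ, hne, hf, -⟩
  · exact jump_of_sides_eq h1 _ x
  · rw [jump_of_common hne hf, hat_of_ne hne.symm, Pi.zero_apply, sub_zero]

/-- The constant that compares nodal sums over a facet with integrals. -/
def facetConst (d : ℕ) (K : ℝ) : ℝ := 2 * 3 ^ d * K ^ d

lemma facetConst_pos (hK : 0 < K) : 0 < facetConst d K := by
  unfold facetConst
  positivity

/-- The weighted nodal values on a facet are bounded by the penalty there: the factor `p²` of the
penalty and the factor `p²` of the weight of an end point combine to the order `p⁴`. -/
lemma stiffnessScale_mul_facetSum_le (hd : 0 < d) (hM : M.Scaled K h) (hp : 1 < p) (hα : 0 < α)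
    (σ : M.Side) {u : Pt d → ℝ} (hu : M.IsPolyOn p σ.1 u) :
    α * stiffnessScale d p h * facetSum p σ.2.1 σ.2.2 (fun x => u (M.map σ.1 x)) ≤
      facetConst d K * (α * p ^ 2 / (K * h) * faceIntegral (M.facet σ) (fun x => u x ^ 2)) := by
  have hK := hM.K_pos
  have hh := hM.h_pos
  have hp0 : (0 : ℝ) < p := by exact_mod_cast (by omega : 0 < p)
  have h1 := facetSum_le_faceIntegral hM hp σ hu
  have h3 : 0 ≤ facetSum p σ.2.1 σ.2.2 fun x => u (M.map σ.1 x) := facetSum_nonneg hp _ _ _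
  set F := facetSum p σ.2.1 σ.2.2 fun x => u (M.map σ.1 x)
  set I := faceIntegral (M.facet σ) fun x => u x ^ 2
  obtain ⟨e, rfl⟩ : ∃ e, d = e + 1 := ⟨d - 1, by omega⟩
  simp only [Nat.add_sub_cancel] at h1
  have h2 : (p : ℝ) ^ 2 / 2 * F ≤ 3 ^ (e + 1) * (K / h) ^ e * I := by
    refine le_trans (mul_le_mul_of_nonneg_right ?_ h3) h1
    nlinarith
  calc α * stiffnessScale (e + 1) p h * F
      = 2 * α * p ^ 2 * (h ^ e / h) * (p ^ 2 / 2 * F) := by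
        rw [stiffnessScale, pow_succ h e]
        field_simp
    _ ≤ 2 * α * p ^ 2 * (h ^ e / h) * (3 ^ (e + 1) * (K / h) ^ e * I) := by gcongr
    _ = _ := by
        rw [facetConst, div_pow, pow_succ K e]
        field_simp

lemma le_jumpForm (hM : M.Scaled K h) (hα : 0 < α) (v : M.BrokenFun) :
    ∑ f ∈ M.faces, α * p ^ 2 / (K * h) * faceIntegral f (fun x => ‖M.jump v f x‖ ^ 2) ≤
      M.jumpForm p α v v := by
  refine Finset.sum_le_sum fun f hf => ?_
  rw [faceIntegral_const_mul]
  simp only [real_inner_self_eq_norm_sq]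
  exact mul_le_mul_of_nonneg_right (penalty_bounds hM hα.le hf).1
    (faceIntegral_nonneg f fun x => sq_nonneg _)

/-- A diagonal entry of the stiffness matrix is bounded below by the penalty on a facet that
contains the node. -/
lemma le_energy_hat (hd : 0 < d) (hM : M.Scaled K h) (hp : 1 < p) (hα : 1 ≤ α)
    (k : Fin M.N) {a : NodeIdx d p} (ha : IsBdryNode a) :
    α * stiffnessScale d p h * nodeWeight a ≤ facetConst d K * M.energy p α (M.hat k a) := by
  classical
  have hα0 : 0 < α := by linarith
  have hK := hM.K_pos
  have hh := hM.h_pos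
  obtain ⟨i, b, hib⟩ : ∃ i b, (a i : ℝ) = sgn b := by
    obtain ⟨i, hi | hi⟩ := ha
    · exact ⟨i, true, by simp [sgn, hi]⟩
    · exact ⟨i, false, by simp [sgn, hi]⟩
  set σ : M.Side := (k, i, b)
  have hu : M.IsPolyOn p σ.1 (M.hat k a k) := hat_mem_dgSpace hp k a k
  have h1 := stiffnessScale_mul_facetSum_le hd hM hp hα0 σ hu
  have h2 : nodeWeight a ≤ facetSum p σ.2.1 σ.2.2 fun x => M.hat k a k (M.map σ.1 x) := by
    have h3 := Finset.single_le_sum (f := fun c : NodeIdx d p =>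
      nodeWeight c * M.hat k a k (M.map σ.1 (refNode c)) ^ 2)
      (s := Finset.univ.filter fun c : NodeIdx d p => (c i : ℝ) = sgn b)
      (fun c _ => mul_nonneg (nodeWeight_pos hp c).le (sq_nonneg _))
      (Finset.mem_filter.2 ⟨Finset.mem_univ a, hib⟩)
    have h4 : M.hat k a k (M.map k (refNode a)) = 1 := by
      have := hat_node (M := M) k k a a
      simpa [node] using this
    change nodeWeight a * M.hat k a k (M.map k (refNode a)) ^ 2 ≤ _ at h3
    rw [h4, one_pow, mul_one] at h3
    exact h3
  have hS := stiffnessScale_pos (d := d) hh hp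
  refine (mul_le_mul_of_nonneg_left h2 (by positivity)).trans (h1.trans
    (mul_le_mul_of_nonneg_left ?_ (facetConst_pos hK).le))
  have h5 : faceIntegral (M.facet σ) (fun x => M.hat k a k x ^ 2) =
      faceIntegral (M.facet σ) (fun x => ‖M.jump (M.hat k a) (M.facet σ) x‖ ^ 2) := by
    congr 1
    funext x
    rw [jump_hat σ a x, norm_smul, norm_normal, mul_one, Real.norm_eq_abs, sq_abs]
  rw [h5]
  have h6 := (Finset.single_le_sum (f := fun f => α * p ^ 2 / (K * h) *
    faceIntegral f (fun x => ‖M.jump (M.hat k a) f x‖ ^ 2))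
    (fun f _ => mul_nonneg (by positivity) (faceIntegral_nonneg f fun x => sq_nonneg _))
    (facet_mem_faces σ)).trans (le_jumpForm hM hα0 (M.hat k a))
  exact h6.trans (le_add_of_nonneg_left (fieldInner_self_nonneg _))

end Mesh

namespace Mesh

variable {Ω : Set (Pt d)} {M : Mesh Ω} {K h α : ℝ}

/-! ### Nodal values controlled by jumps -/

open Classical in
/-- The sum of the norms of the jumps at a point, over all faces that contain the point. -/
def jumpsAt (M : Mesh Ω) (v : M.BrokenFun) (ξ : Pt d) : ℝ :=
  ∑ f ∈ M.faces.filter fun f => ξ ∈ f, ‖M.jump v f ξ‖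

lemma norm_jump_le_jumpsAt (v : M.BrokenFun) {σ : M.Side} {ξ : Pt d} (hξ : ξ ∈ M.facet σ) :
    ‖M.jump v (M.facet σ) ξ‖ ≤ M.jumpsAt v ξ := by
  classical
  exact Finset.single_le_sum (f := fun f => ‖M.jump v f ξ‖) (fun _ _ => norm_nonneg _)
    (Finset.mem_filter.2 ⟨facet_mem_faces σ, hξ⟩)

lemma jumpsAt_nonneg (v : M.BrokenFun) (ξ : Pt d) : 0 ≤ M.jumpsAt v ξ := by
  classical
  exact Finset.sum_nonneg fun _ _ => norm_nonneg _

/-- The values at a point from two elements differ by at most a multiple of the jumps there: the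
elements that contain the point can be exhausted by crossing one face at a time. -/
lemma abs_sub_le_jumpsAt (hM : M.Scaled K h) (hΩ : IsOpen Ω) (hc : Convex ℝ Ω) (v : M.BrokenFun)
    {ξ : Pt d} {k l : Fin M.N} (hk : k ∈ M.elemsAt ξ) (hl : l ∈ M.elemsAt ξ) :
    |v k ξ - v l ξ| ≤ K * M.jumpsAt v ξ := by
  classical
  have hT := jumpsAt_nonneg v ξ
  have key : ∀ m : ℕ, m < (M.elemsAt ξ).card → ∃ S ⊆ M.elemsAt ξ, k ∈ S ∧ S.card = m + 1 ∧
      ∀ j ∈ S, |v k ξ - v j ξ| ≤ m * M.jumpsAt v ξ := by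
    intro m
    induction m with
    | zero =>
      intro _
      refine ⟨{k}, by simpa using hk, by simp, by simp, fun j hj => ?_⟩
      rw [Finset.mem_singleton.1 hj]
      simp
    | succ m ih =>
      intro hm
      obtain ⟨S, hS, hkS, hcard, hSv⟩ := ih (by omega)
      obtain ⟨l₀, hl₀, hl₀S⟩ := Finset.exists_mem_notMem_of_card_lt_card
        (show S.card < (M.elemsAt ξ).card by omega)
      obtain ⟨σ, τ, hσ, hτ, hτξ, hf, hξ⟩ := exists_common_facet (S := (S : Set (Fin M.N))) hΩ hc
        hk hl₀ hkS hl₀S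
      refine ⟨insert τ.1 S, Finset.insert_subset hτξ hS, Finset.mem_insert_of_mem hkS, ?_, ?_⟩
      · rw [Finset.card_insert_of_notMem hτ, hcard]
      · have hmono : (m : ℝ) * M.jumpsAt v ξ ≤ (m + 1 : ℕ) * M.jumpsAt v ξ := by
          gcongr
          omega
        intro j hj
        rcases Finset.mem_insert.1 hj with rfl | hj
        · have hne : σ.1 ≠ τ.1 := fun h => hτ (h ▸ hσ)
          have h1 := norm_jump_le_jumpsAt v hξ
          rw [jump_of_common hne hf, norm_smul, norm_normal, mul_one, Real.norm_eq_abs] at h1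
          have h2 := hSv _ hσ
          have h3 := abs_sub_le (v k ξ) (v σ.1 ξ) (v τ.1 ξ)
          push_cast
          linarith
        · exact (hSv j hj).trans hmono
  have hpos : 0 < (M.elemsAt ξ).card := Finset.card_pos.2 ⟨k, hk⟩
  obtain ⟨S, hS, -, hcard, hSv⟩ := key ((M.elemsAt ξ).card - 1) (by omega)
  have hSeq : S = M.elemsAt ξ := Finset.eq_of_subset_of_card_le hS (by omega)
  refine (hSv l (hSeq ▸ hl)).trans (mul_le_mul_of_nonneg_right ?_ hT)
  refine le_trans ?_ (hM.card_le ξ)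
  exact_mod_cast Nat.sub_le _ _

open Classical in
/-- Boundedly many faces meet at a point. -/
lemma card_faces_le (hM : M.Scaled K h) (ξ : Pt d) :
    ((M.faces.filter fun f => ξ ∈ f).card : ℝ) ≤ 2 * d * K := by
  have hsub : (M.faces.filter fun f => ξ ∈ f) ⊆
      (M.elemsAt ξ ×ˢ (Finset.univ : Finset (Fin d × Bool))).image M.facet := by
    intro f hf
    obtain ⟨hf1, hf2⟩ := Finset.mem_filter.1 hf
    obtain ⟨σ, rfl⟩ := mem_faces.1 hf1
    exact Finset.mem_image.2 ⟨σ, Finset.mem_product.2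
      ⟨mem_elemsAt.2 (facet_subset_closure σ hf2), Finset.mem_univ _⟩, rfl⟩
  have h1 := (Finset.card_le_card hsub).trans Finset.card_image_le
  rw [Finset.card_product, Finset.card_univ, Fintype.card_prod, Fintype.card_fin,
    Fintype.card_bool] at h1
  have h2 : ((M.faces.filter fun f => ξ ∈ f).card : ℝ) ≤ (M.elemsAt ξ).card * (d * 2) := by
    exact_mod_cast h1
  have h3 := hM.card_le ξ
  refine h2.trans ?_
  calc ((M.elemsAt ξ).card : ℝ) * (d * 2) ≤ K * (d * 2) := by gcongr
    _ = _ := by ring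

/-- The constant in the bound of nodal values by jumps. -/
def vertexConst (d : ℕ) (K : ℝ) : ℝ := (K + 1) ^ 2 * (2 * d * K)

open Classical in
/-- The values at a point of a function whose values there from the different elements have mean
zero are bounded by the jumps at that point. On the boundary of the domain no assumption is needed,
because the jump over a boundary face is the trace. -/
lemma sq_le_sum_jump_sq (hM : M.Scaled K h) (hΩ : IsOpen Ω) (hc : Convex ℝ Ω) (v : M.BrokenFun)
    {ξ : Pt d} {k : Fin M.N} (hk : k ∈ M.elemsAt ξ)
    (hmean : ξ ∉ frontier Ω → ∑ l ∈ M.elemsAt ξ, v l ξ = 0) :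
    v k ξ ^ 2 ≤ vertexConst d K *
      ∑ f ∈ M.faces.filter fun f => ξ ∈ f, ‖M.jump v f ξ‖ ^ 2 := by
  have hK := hM.K_pos
  have hT := jumpsAt_nonneg v ξ
  have hdiff := fun {l : Fin M.N} (hl : l ∈ M.elemsAt ξ) =>
    abs_sub_le_jumpsAt hM hΩ hc v hk hl
  have h1 : |v k ξ| ≤ (K + 1) * M.jumpsAt v ξ := by
    by_cases hξ : ξ ∈ frontier Ω
    · obtain ⟨σ, hσξ, hσ⟩ := exists_boundary_facet (M := M) hΩ hc hξ
      have h2 := norm_jump_le_jumpsAt v hσξ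
      rw [jump_of_sides_eq hσ, norm_smul, norm_normal, mul_one, Real.norm_eq_abs] at h2
      have h3 := hdiff (mem_elemsAt.2 (facet_subset_closure σ hσξ))
      have h4 := abs_sub_abs_le_abs_sub (v k ξ) (v σ.1 ξ)
      linarith
    · have hpos : 0 < ((M.elemsAt ξ).card : ℝ) := by exact_mod_cast Finset.card_pos.2 ⟨k, hk⟩
      have h2 : ((M.elemsAt ξ).card : ℝ) * v k ξ = ∑ l ∈ M.elemsAt ξ, (v k ξ - v l ξ) := by
        rw [Finset.sum_sub_distrib, hmean hξ, sub_zero, Finset.sum_const, nsmul_eq_mul]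
      have h3 : ((M.elemsAt ξ).card : ℝ) * |v k ξ| ≤
          (M.elemsAt ξ).card * (K * M.jumpsAt v ξ) := by
        calc ((M.elemsAt ξ).card : ℝ) * |v k ξ| = |((M.elemsAt ξ).card : ℝ) * v k ξ| := by
              rw [abs_mul, abs_of_pos hpos]
          _ ≤ ∑ l ∈ M.elemsAt ξ, |v k ξ - v l ξ| := by
              rw [h2]; exact Finset.abs_sum_le_sum_abs _ _
          _ ≤ ∑ l ∈ M.elemsAt ξ, K * M.jumpsAt v ξ := Finset.sum_le_sum fun l hl => hdiff hl
          _ = _ := by rw [Finset.sum_const, nsmul_eq_mul]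
      have h4 := le_of_mul_le_mul_left h3 hpos
      linarith
  have h5 := sq_sum_le_card_mul_sum_sq (s := M.faces.filter fun f => ξ ∈ f)
    (f := fun f => ‖M.jump v f ξ‖)
  have h6 : 0 ≤ ∑ f ∈ M.faces.filter fun f => ξ ∈ f, ‖M.jump v f ξ‖ ^ 2 :=
    Finset.sum_nonneg fun _ _ => sq_nonneg _
  have h7 : M.jumpsAt v ξ ^ 2 ≤
      2 * d * K * ∑ f ∈ M.faces.filter fun f => ξ ∈ f, ‖M.jump v f ξ‖ ^ 2 :=
    h5.trans (mul_le_mul_of_nonneg_right (card_faces_le hM ξ) h6)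
  calc v k ξ ^ 2 = |v k ξ| ^ 2 := (sq_abs _).symm
    _ ≤ ((K + 1) * M.jumpsAt v ξ) ^ 2 := pow_le_pow_left₀ (abs_nonneg _) h1 2
    _ = (K + 1) ^ 2 * M.jumpsAt v ξ ^ 2 := mul_pow _ _ _
    _ ≤ (K + 1) ^ 2 * (2 * d * K *
          ∑ f ∈ M.faces.filter fun f => ξ ∈ f, ‖M.jump v f ξ‖ ^ 2) := by gcongr
    _ = _ := by rw [vertexConst]; ring

lemma node_injective (k : Fin M.N) : Function.Injective (M.node (p := p) k) := by
  intro a b hab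
  have h1 := (M.map k).injective hab
  funext i
  exact Subtype.ext (congrArg (fun y : Pt d => y i) h1)

lemma node_mem_closure (hp : 1 < p) (k : Fin M.N) (a : NodeIdx d p) :
    M.node k a ∈ closure (M.elem k) := by
  rw [mem_closure_elem]
  intro i
  rw [node, AffineEquiv.symm_apply_apply]
  exact gllNodes_subset_Icc hp (a i).2

open Classical in
/-- The nodes of all elements that lie on a face are nodes of any fixed side of the face, with the
same weights, and each node is counted boundedly often. -/
lemma sum_nodes_on_facet_le (hM : M.Scaled K h) (hp : 1 < p) (σ : M.Side) {g : Pt d → ℝ}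
    (hg : ∀ x, 0 ≤ g x) :
    ∑ ξ : Fin M.N × NodeIdx d p with M.node ξ.1 ξ.2 ∈ M.facet σ,
        nodeWeight ξ.2 * g (M.node ξ.1 ξ.2) ≤
      K * ∑ a : NodeIdx d p with (a σ.2.1 : ℝ) = sgn σ.2.2,
        nodeWeight a * g (M.node σ.1 a) := by
  have hex : ∀ ξ : Fin M.N × NodeIdx d p, ∃ a' : NodeIdx d p, M.node ξ.1 ξ.2 ∈ M.facet σ →
      M.node σ.1 a' = M.node ξ.1 ξ.2 ∧ nodeWeight a' = nodeWeight ξ.2 := by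
    intro ξ
    by_cases hξ : M.node ξ.1 ξ.2 ∈ M.facet σ
    · obtain ⟨a', ha'⟩ := exists_node_eq hp (facet_subset_closure σ hξ)
      exact ⟨a', fun _ => ha'⟩
    · exact ⟨ξ.2, fun hn => absurd hn hξ⟩
  choose φ hφ using hex
  set S := Finset.univ.filter fun ξ : Fin M.N × NodeIdx d p => M.node ξ.1 ξ.2 ∈ M.facet σ
  set T := Finset.univ.filter fun a : NodeIdx d p => (a σ.2.1 : ℝ) = sgn σ.2.2
  have hS : ∀ ξ ∈ S, M.node ξ.1 ξ.2 ∈ M.facet σ := fun ξ hξ => (Finset.mem_filter.1 hξ).2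
  have hmaps : ∀ ξ ∈ S, φ ξ ∈ T := by
    intro ξ hξ
    have h1 := (hφ ξ (hS ξ hξ)).1
    have h2 := hS ξ hξ
    rw [← h1, mem_facet, node, AffineEquiv.symm_apply_apply] at h2
    exact Finset.mem_filter.2 ⟨Finset.mem_univ _, h2.2⟩
  rw [← Finset.sum_fiberwise_of_maps_to hmaps, Finset.mul_sum]
  refine Finset.sum_le_sum fun a _ => ?_
  have hfib : ∀ ξ ∈ S.filter fun ξ => φ ξ = a,
      nodeWeight ξ.2 * g (M.node ξ.1 ξ.2) = nodeWeight a * g (M.node σ.1 a) := by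
    intro ξ hξ
    obtain ⟨h1, rfl⟩ := Finset.mem_filter.1 hξ
    obtain ⟨h2, h3⟩ := hφ ξ (hS ξ h1)
    rw [h2, h3]
  rw [Finset.sum_congr rfl hfib, Finset.sum_const, nsmul_eq_mul]
  refine mul_le_mul_of_nonneg_right ?_ (mul_nonneg (nodeWeight_pos hp a).le (hg _))
  refine le_trans ?_ (hM.card_le (M.node σ.1 a))
  -- an element has at most one node at a given point
  have hcard : (S.filter fun ξ => φ ξ = a).card ≤ (M.elemsAt (M.node σ.1 a)).card := by
    refine Finset.card_le_card_of_injOn Prod.fst ?_ ?_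
    · intro ξ hξ
      obtain ⟨h1, rfl⟩ := Finset.mem_filter.1 hξ
      rw [Finset.mem_coe, mem_elemsAt, (hφ ξ (hS ξ h1)).1]
      exact node_mem_closure hp _ _
    · rintro ⟨k, c⟩ hξ ⟨l, e⟩ hζ (rfl : k = l)
      obtain ⟨h1, h1a⟩ := Finset.mem_filter.1 hξ
      obtain ⟨h2, h2a⟩ := Finset.mem_filter.1 hζ
      have h3 := (hφ _ (hS _ h1)).1
      have h4 := (hφ _ (hS _ h2)).1
      rw [h1a] at h3
      rw [h2a] at h4
      have h5 : c = e := node_injective k (h3.symm.trans h4)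
      rw [h5]
  exact_mod_cast hcard

/-- The weighted nodal values of a function whose values at every node have mean zero, or which has
arbitrary values if the node lies on the boundary, are controlled by the penalty form. -/
lemma sum_bdryNodes_le (hd : 0 < d) (hM : M.Scaled K h) (hp : 1 < p) (hα : 1 ≤ α)
    (hΩ : IsOpen Ω) (hc : Convex ℝ Ω) {v : M.BrokenFun} (hv : v ∈ M.dgSpace p)
    (hmean : ∀ k, ∀ a : NodeIdx d p, M.node k a ∉ frontier Ω →
      ∑ l ∈ M.elemsAt (M.node k a), v l (M.node k a) = 0) :
    α * stiffnessScale d p h *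
        ∑ ξ ∈ M.bdryNodes p, nodeWeight ξ.2 * v ξ.1 (M.node ξ.1 ξ.2) ^ 2 ≤
      vertexConst d K * K * facetConst d K * M.jumpForm p α v v := by
  classical
  have hα0 : 0 < α := by linarith
  have hK := hM.K_pos
  have hh := hM.h_pos
  have hS := stiffnessScale_pos (d := d) hh hp
  have hV : 0 ≤ vertexConst d K := by unfold vertexConst; positivity
  have hF := (facetConst_pos (d := d) hK).le
  have hnn : ∀ f x, 0 ≤ ‖M.jump v f x‖ ^ 2 := fun f x => sq_nonneg _
  have h1 : ∑ ξ ∈ M.bdryNodes p, nodeWeight ξ.2 * v ξ.1 (M.node ξ.1 ξ.2) ^ 2 ≤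
      vertexConst d K * ∑ f ∈ M.faces, ∑ ξ : Fin M.N × NodeIdx d p with M.node ξ.1 ξ.2 ∈ f,
        nodeWeight ξ.2 * ‖M.jump v f (M.node ξ.1 ξ.2)‖ ^ 2 := by
    calc ∑ ξ ∈ M.bdryNodes p, nodeWeight ξ.2 * v ξ.1 (M.node ξ.1 ξ.2) ^ 2
        ≤ ∑ ξ : Fin M.N × NodeIdx d p, nodeWeight ξ.2 * v ξ.1 (M.node ξ.1 ξ.2) ^ 2 :=
          Finset.sum_le_sum_of_subset_of_nonneg (Finset.subset_univ _) fun ξ _ _ =>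
            mul_nonneg (nodeWeight_pos hp _).le (sq_nonneg _)
      _ ≤ ∑ ξ : Fin M.N × NodeIdx d p, nodeWeight ξ.2 * (vertexConst d K *
            ∑ f ∈ M.faces.filter fun f => M.node ξ.1 ξ.2 ∈ f,
              ‖M.jump v f (M.node ξ.1 ξ.2)‖ ^ 2) :=
          Finset.sum_le_sum fun ξ _ => mul_le_mul_of_nonneg_left
            (sq_le_sum_jump_sq hM hΩ hc v (mem_elemsAt.2 (node_mem_closure hp ξ.1 ξ.2))
              (hmean ξ.1 ξ.2)) (nodeWeight_pos hp _).le
      _ = _ := by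
          simp only [Finset.mul_sum, Finset.sum_filter]
          rw [Finset.sum_comm]
          refine Finset.sum_congr rfl fun f _ => Finset.sum_congr rfl fun ξ _ => ?_
          split_ifs <;> ring
  have h2 : ∀ f ∈ M.faces, α * stiffnessScale d p h *
      ∑ ξ : Fin M.N × NodeIdx d p with M.node ξ.1 ξ.2 ∈ f,
        nodeWeight ξ.2 * ‖M.jump v f (M.node ξ.1 ξ.2)‖ ^ 2 ≤
      K * facetConst d K *
        (α * p ^ 2 / (K * h) * faceIntegral f (fun x => ‖M.jump v f x‖ ^ 2)) := by
    intro f hf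
    obtain ⟨σ, rfl⟩ := mem_faces.1 hf
    obtain ⟨u, hu, hux⟩ := exists_jump_eq σ hv
    have hnorm : ∀ x ∈ M.facet σ, ‖M.jump v (M.facet σ) x‖ ^ 2 = u x ^ 2 := by
      intro x hx
      rw [hux x hx, norm_smul, norm_normal, mul_one, Real.norm_eq_abs, sq_abs]
    have h3 : faceIntegral (M.facet σ) (fun x => ‖M.jump v (M.facet σ) x‖ ^ 2) =
        faceIntegral (M.facet σ) (fun x => u x ^ 2) :=
      setIntegral_congr_fun (isClosed_facet σ).measurableSet hnorm
    have h4 : ∑ a : NodeIdx d p with (a σ.2.1 : ℝ) = sgn σ.2.2,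
        nodeWeight a * ‖M.jump v (M.facet σ) (M.node σ.1 a)‖ ^ 2 =
        facetSum p σ.2.1 σ.2.2 fun x => u (M.map σ.1 x) := by
      refine Finset.sum_congr rfl fun a ha => ?_
      rw [hnorm]
      · rfl
      · rw [mem_facet, node, AffineEquiv.symm_apply_apply]
        exact ⟨fun i => gllNodes_subset_Icc hp (a i).2, (Finset.mem_filter.1 ha).2⟩
    have h5 := sum_nodes_on_facet_le hM hp σ (g := fun x => ‖M.jump v (M.facet σ) x‖ ^ 2)
      (hnn _)
    rw [h4] at h5
    rw [h3]
    calc _ ≤ α * stiffnessScale d p h * (K * facetSum p σ.2.1 σ.2.2 fun x => u (M.map σ.1 x)) :=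
          mul_le_mul_of_nonneg_left h5 (by positivity)
      _ = K * (α * stiffnessScale d p h * facetSum p σ.2.1 σ.2.2 fun x => u (M.map σ.1 x)) := by
          ring
      _ ≤ K * (facetConst d K *
            (α * p ^ 2 / (K * h) * faceIntegral (M.facet σ) (fun x => u x ^ 2))) :=
          mul_le_mul_of_nonneg_left (stiffnessScale_mul_facetSum_le hd hM hp hα0 σ hu) hK.le
      _ = _ := by ring
  calc α * stiffnessScale d p h *
        ∑ ξ ∈ M.bdryNodes p, nodeWeight ξ.2 * v ξ.1 (M.node ξ.1 ξ.2) ^ 2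
      ≤ α * stiffnessScale d p h * (vertexConst d K * ∑ f ∈ M.faces,
          ∑ ξ : Fin M.N × NodeIdx d p with M.node ξ.1 ξ.2 ∈ f,
            nodeWeight ξ.2 * ‖M.jump v f (M.node ξ.1 ξ.2)‖ ^ 2) :=
        mul_le_mul_of_nonneg_left h1 (by positivity)
    _ = vertexConst d K * ∑ f ∈ M.faces, α * stiffnessScale d p h *
          ∑ ξ : Fin M.N × NodeIdx d p with M.node ξ.1 ξ.2 ∈ f,
            nodeWeight ξ.2 * ‖M.jump v f (M.node ξ.1 ξ.2)‖ ^ 2 := by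
        rw [← Finset.mul_sum]; ring
    _ ≤ vertexConst d K * ∑ f ∈ M.faces, K * facetConst d K *
          (α * p ^ 2 / (K * h) * faceIntegral f (fun x => ‖M.jump v f x‖ ^ 2)) :=
        mul_le_mul_of_nonneg_left (Finset.sum_le_sum h2) hV
    _ = vertexConst d K * K * facetConst d K * ∑ f ∈ M.faces,
          α * p ^ 2 / (K * h) * faceIntegral f (fun x => ‖M.jump v f x‖ ^ 2) := by
        rw [← Finset.mul_sum]; ring
    _ ≤ _ := mul_le_mul_of_nonneg_left (le_jumpForm hM hα0 v) (by positivity)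

/-! ### The Oswald operator -/

lemma oswald_mem (hp : 1 < p) (v : M.BrokenFun) : M.oswald p v ∈ M.dgSpace p := by
  intro k
  have h1 : (fun x => M.oswald p v k (M.map k x)) =
      ∑ a : NodeIdx d p, M.oswaldValue v (M.node k a) • refBasis a := by
    funext x
    simp [oswald, Finset.sum_apply]
  rw [h1]
  exact (refQ d p).sum_mem fun a _ => (refQ d p).smul_mem _ (refBasis_mem_refQ hp a)

lemma oswald_node (v : M.BrokenFun) (k : Fin M.N) (a : NodeIdx d p) :
    M.oswald p v k (M.node k a) = M.oswaldValue v (M.node k a) := by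
  rw [oswald, Finset.sum_eq_single a]
  · rw [node, AffineEquiv.symm_apply_apply, refBasis_refNode, if_pos rfl, mul_one]
  · intro b _ hb
    rw [node, node, AffineEquiv.symm_apply_apply, refBasis_refNode, if_neg hb, mul_zero]
  · exact fun hn => absurd (Finset.mem_univ a) hn

lemma sub_oswald_mem (hp : 1 < p) (hΩ : IsOpen Ω) (hc : Convex ℝ Ω) {v : M.BrokenFun}
    (hv : v ∈ M.dgSpace p) : v - M.oswald p v ∈ M.bdrySpace p := by
  classical
  refine ⟨(M.dgSpace p).sub_mem hv (oswald_mem hp v), fun k a ha => ?_⟩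
  have hmem : M.node k a ∈ M.elem k := by
    rw [mem_elem]
    intro i
    rw [node, AffineEquiv.symm_apply_apply]
    have h1 := gllNodes_subset_Icc hp (a i).2
    exact ⟨lt_of_le_of_ne h1.1 fun h2 => ha ⟨i, Or.inr h2.symm⟩,
      lt_of_le_of_ne h1.2 fun h2 => ha ⟨i, Or.inl h2⟩⟩
  have hfr : M.node k a ∉ frontier Ω := fun hn => by
    rw [hΩ.frontier_eq] at hn
    exact hn.2 (elem_subset hΩ hc k hmem)
  have hat : M.elemsAt (M.node k a) = {k} := by
    ext l
    rw [mem_elemsAt, Finset.mem_singleton]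
    constructor
    · intro hl
      by_contra hne
      exact Set.disjoint_left.1 (disjoint_elem_closure (Ne.symm hne)) hmem hl
    · rintro rfl
      exact subset_closure hmem
  rw [Pi.sub_apply, Pi.sub_apply, oswald_node, oswaldValue, if_neg hfr, hat]
  simp

/-- Off the boundary of the domain, subtracting the mean of the nodal values leaves mean zero. -/
lemma sum_sub_oswald (hp : 1 < p) (v : M.BrokenFun) (k : Fin M.N) (a : NodeIdx d p)
    (hξ : M.node k a ∉ frontier Ω) :
    ∑ l ∈ M.elemsAt (M.node k a), (v - M.oswald p v) l (M.node k a) = 0 := by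
  have hpos : ((M.elemsAt (M.node k a)).card : ℝ) ≠ 0 := by
    have := Finset.card_pos.2 ⟨k, mem_elemsAt.2 (node_mem_closure hp k a)⟩
    exact_mod_cast this.ne'
  have h1 : ∀ l ∈ M.elemsAt (M.node k a),
      M.oswald p v l (M.node k a) = M.oswaldValue v (M.node k a) := by
    intro l hl
    obtain ⟨a', ha', -⟩ := exists_node_eq hp (mem_elemsAt.1 hl)
    rw [← ha', oswald_node]
  simp only [Pi.sub_apply]
  rw [Finset.sum_sub_distrib, Finset.sum_congr rfl h1, Finset.sum_const, nsmul_eq_mul,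
    oswaldValue, if_neg hξ, mul_inv_cancel_left₀ hpos, sub_self]

end Mesh

namespace Mesh

variable {Ω : Set (Pt d)} {M : Mesh Ω} {K h α b θ : ℝ} {β : Set (Pt d) → Pt d}

/-! ### Spectral bounds for the Jacobi solver -/

lemma sum_nodeSum_eq {v : M.BrokenFun} (hv : v ∈ M.bdrySpace p) :
    ∑ k, M.nodeSum p k (v k) =
      ∑ ξ ∈ M.bdryNodes p, nodeWeight ξ.2 * v ξ.1 (M.node ξ.1 ξ.2) ^ 2 := by
  classical
  rw [bdryNodes, Finset.sum_filter, Fintype.sum_prod_type]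
  refine Finset.sum_congr rfl fun k _ => Finset.sum_congr rfl fun a _ => ?_
  split_ifs with ha
  · rfl
  · rw [hv.2 k a ha]
    ring

lemma sum_nodeSum_hat (k : Fin M.N) (a : NodeIdx d p) :
    ∑ l, M.nodeSum p l (M.hat k a l) = nodeWeight a := by
  classical
  have h1 : ∑ l, M.nodeSum p l (M.hat k a l) =
      ∑ ξ : Fin M.N × NodeIdx d p, nodeWeight ξ.2 * M.hat k a ξ.1 (M.node ξ.1 ξ.2) ^ 2 :=
    (Fintype.sum_prod_type fun ξ : Fin M.N × NodeIdx d p =>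
      nodeWeight ξ.2 * M.hat k a ξ.1 (M.node ξ.1 ξ.2) ^ 2).symm
  rw [h1, Finset.sum_eq_single (k, a)]
  · rw [hat_node, if_pos rfl, one_pow, mul_one]
  · intro ξ _ hne
    rw [hat_node, if_neg hne]
    ring
  · exact fun hn => absurd (Finset.mem_univ _) hn

lemma inverseConst_pos (hd : 0 < d) (hK : 0 < K) : 0 < inverseConst d K := by
  have : (0 : ℝ) < d := by exact_mod_cast hd
  unfold inverseConst
  positivity

lemma vertexConst_pos (hd : 0 < d) (hK : 0 < K) : 0 < vertexConst d K := by
  have : (0 : ℝ) < d := by exact_mod_cast hd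
  unfold vertexConst
  positivity

/-- The constant in the equivalence of the bilinear form and the energy. -/
def equivConst (d : ℕ) (K b : ℝ) : ℝ := 2 * liftConst d K b + 2

lemma equivConst_pos (hd : 0 < d) (hK : 0 < K) (hb : 0 ≤ b) : 0 < equivConst d K b := by
  have := liftConst_pos hd hK hb
  unfold equivConst
  positivity

lemma dgForm_pos (hd : 0 < d) (hM : M.Scaled K h) (hp : 1 < p) (hα : 1 ≤ α) (hb : 0 ≤ b)
    (hβ : ∀ f, ‖β f‖ ≤ b) (hθ : θ = 1 ∨ θ = 0 ∧ 4 * liftConst d K b ≤ α)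
    {u : M.BrokenFun} (hu : u ∈ M.bdrySpace p) (hne : u ≠ 0) : 0 < M.dgForm p θ α β u u := by
  have h1 := (dgForm_equiv hd hM hp hα hb hβ hθ hu.1).1
  have h2 := energy_pos hM hp (by linarith : (0 : ℝ) ≤ α) hu hne
  exact pos_of_mul_pos_right (h2.trans_le h1) (equivConst_pos hd hM.K_pos hb).le

/-- The energy is at most the stiffness scale times the weighted nodal values, and each of these is
at most a diagonal entry. -/
lemma jacobi_lower_bound (hd : 0 < d) (hM : M.Scaled K h) (hp : 1 < p) (hα : 1 ≤ α) (hb : 0 ≤ b)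
    (hβ : ∀ f, ‖β f‖ ≤ b) (hθ : θ = 1 ∨ θ = 0 ∧ 4 * liftConst d K b ≤ α)
    {v : M.BrokenFun} (hv : v ∈ M.bdrySpace p) :
    M.dgForm p θ α β v v ≤ equivConst d K b ^ 2 * inverseConst d K * facetConst d K *
      M.dgForm p θ α β (M.jacobiInv p θ α β v) v := by
  have hK := hM.K_pos
  have hE := equivConst_pos hd hK hb
  have hI := inverseConst_pos hd hK
  have hF := facetConst_pos (d := d) hK
  have hA := (isSymmBilin_dgForm (α := α) (β := β) hM hp θ).mono bdrySpace_le
  rw [dgForm_jacobiInv hp hA (fun u hu hne => dgForm_pos hd hM hp hα hb hβ hθ hu hne) hv]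
  set E := equivConst d K b with hEdef
  set I := inverseConst d K
  set F := facetConst d K
  calc M.dgForm p θ α β v v ≤ E * M.energy p α v :=
        (dgForm_equiv hd hM hp hα hb hβ hθ hv.1).2
    _ ≤ E * (I * (α * stiffnessScale d p h) * ∑ k, M.nodeSum p k (v k)) :=
        mul_le_mul_of_nonneg_left (energy_le hd hM hp hα hv.1) hE.le
    _ = E * I * ∑ ξ ∈ M.bdryNodes p, v ξ.1 (M.node ξ.1 ξ.2) ^ 2 *
          (α * stiffnessScale d p h * nodeWeight ξ.2) := by
        rw [sum_nodeSum_eq hv, mul_assoc I, ← mul_assoc E, Finset.mul_sum]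
        congr 1
        exact Finset.sum_congr rfl fun ξ _ => by ring
    _ ≤ E * I * ∑ ξ ∈ M.bdryNodes p, v ξ.1 (M.node ξ.1 ξ.2) ^ 2 *
          (F * (E * M.dgForm p θ α β (M.hat ξ.1 ξ.2) (M.hat ξ.1 ξ.2))) := by
        refine mul_le_mul_of_nonneg_left (Finset.sum_le_sum fun ξ hξ =>
          mul_le_mul_of_nonneg_left ?_ (sq_nonneg _)) (by positivity)
        refine (le_energy_hat hd hM hp hα ξ.1 (mem_bdryNodes.1 hξ)).trans
          (mul_le_mul_of_nonneg_left ?_ hF.le)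
        exact (dgForm_equiv hd hM hp hα hb hβ hθ (hat_mem_dgSpace hp _ _)).1
    _ = _ := by
        rw [Finset.mul_sum, Finset.mul_sum]
        exact Finset.sum_congr rfl fun ξ _ => by ring

/-- The diagonal entries are at most the stiffness scale times the weights, and the weighted nodal
values of a function with nodal means zero are bounded by the penalty form. -/
lemma jacobi_upper_bound (hd : 0 < d) (hM : M.Scaled K h) (hp : 1 < p) (hα : 1 ≤ α) (hb : 0 ≤ b)
    (hβ : ∀ f, ‖β f‖ ≤ b) (hθ : θ = 1 ∨ θ = 0 ∧ 4 * liftConst d K b ≤ α)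
    (hΩ : IsOpen Ω) (hc : Convex ℝ Ω) {v : M.BrokenFun} (hv : v ∈ M.bdrySpace p)
    (hmean : ∀ k, ∀ a : NodeIdx d p, M.node k a ∉ frontier Ω →
      ∑ l ∈ M.elemsAt (M.node k a), v l (M.node k a) = 0) :
    M.dgForm p θ α β (M.jacobiInv p θ α β v) v ≤
      equivConst d K b ^ 2 * inverseConst d K * (vertexConst d K * K * facetConst d K) *
        M.dgForm p θ α β v v := by
  have hK := hM.K_pos
  have hE := equivConst_pos hd hK hb
  have hI := inverseConst_pos hd hK
  have hF := facetConst_pos (d := d) hK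
  have hV := vertexConst_pos hd hK
  have hA := (isSymmBilin_dgForm (α := α) (β := β) hM hp θ).mono bdrySpace_le
  rw [dgForm_jacobiInv hp hA (fun u hu hne => dgForm_pos hd hM hp hα hb hβ hθ hu hne) hv]
  set E := equivConst d K b with hEdef
  set I := inverseConst d K
  set C := vertexConst d K * K * facetConst d K with hC
  have hC0 : 0 < C := by positivity
  calc ∑ ξ ∈ M.bdryNodes p,
        v ξ.1 (M.node ξ.1 ξ.2) ^ 2 * M.dgForm p θ α β (M.hat ξ.1 ξ.2) (M.hat ξ.1 ξ.2)
      ≤ ∑ ξ ∈ M.bdryNodes p, v ξ.1 (M.node ξ.1 ξ.2) ^ 2 *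
          (E * (I * (α * stiffnessScale d p h) * nodeWeight ξ.2)) := by
        refine Finset.sum_le_sum fun ξ _ => mul_le_mul_of_nonneg_left ?_ (sq_nonneg _)
        have hφ := hat_mem_dgSpace (M := M) hp ξ.1 ξ.2
        have h1 := energy_le hd hM hp hα hφ
        rw [sum_nodeSum_hat] at h1
        exact (dgForm_equiv hd hM hp hα hb hβ hθ hφ).2.trans (mul_le_mul_of_nonneg_left h1 hE.le)
    _ = E * I * (α * stiffnessScale d p h *
          ∑ ξ ∈ M.bdryNodes p, nodeWeight ξ.2 * v ξ.1 (M.node ξ.1 ξ.2) ^ 2) := by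
        rw [Finset.mul_sum, Finset.mul_sum]
        exact Finset.sum_congr rfl fun ξ _ => by ring
    _ ≤ E * I * (C * M.jumpForm p α v v) :=
        mul_le_mul_of_nonneg_left (sum_bdryNodes_le hd hM hp hα hΩ hc hv.1 hmean) (by positivity)
    _ ≤ E * I * (C * (E * M.dgForm p θ α β v v)) := by
        refine mul_le_mul_of_nonneg_left (mul_le_mul_of_nonneg_left ?_ hC0.le) (by positivity)
        exact (le_add_of_nonneg_left (fieldInner_self_nonneg _)).trans
          (dgForm_equiv hd hM hp hα hb hβ hθ hv.1).1
    _ = _ := by ring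

end Mesh

end HpDG

end

theorem lemma5p3 (d : ℕ) (hd : d = 2 ∨ d = 3) (Ω : Set (HpDG.Pt d))
    (hΩ : HpDG.IsConvexPolytopalDomain Ω) (γ q b : ℝ) :
    ∃ α₀ : ℝ, 1 ≤ α₀ ∧ ∃ C₁ : ℝ, 0 < C₁ ∧ ∃ C₂ : ℝ, 0 < C₂ ∧
      ∀ M : HpDG.Mesh Ω, M.ShapeRegular γ → M.QuasiUniform q →
      ∀ p : ℕ, 1 < p → ∀ α : ℝ, 1 ≤ α →
      ∀ (θ : ℝ) (β : Set (HpDG.Pt d) → HpDG.Pt d),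
        -- SIPG with a large enough penalization, or LDG
        ((θ = 0 ∧ (∀ f, β f = 0) ∧ α₀ ≤ α) ∨ (θ = 1 ∧ ∀ f, ‖β f‖ ≤ b)) →
        Set.BijOn (M.jacobi p θ α β) (M.bdrySpace p) (M.bdrySpace p) ∧
        (∀ v ∈ M.bdrySpace p,
          C₁ * M.dgForm p θ α β v v ≤ M.dgForm p θ α β (M.jacobiInv p θ α β v) v) ∧
        (∀ v ∈ M.dgSpace p, v - M.oswald p v ∈ M.bdrySpace p ∧
          M.dgForm p θ α β (M.jacobiInv p θ α β (v - M.oswald p v)) (v - M.oswald p v) ≤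
            C₂ * M.dgForm p θ α β (v - M.oswald p v) (v - M.oswald p v)) := by
  have hd0 : 0 < d := by omega
  obtain ⟨K, hK1, hK⟩ := HpDG.Mesh.exists_scaled hd0 γ q
  have hK0 : 0 < K := lt_of_lt_of_le one_pos hK1
  have hb := abs_nonneg b
  have hE := HpDG.Mesh.equivConst_pos hd0 hK0 hb
  have hI := HpDG.Mesh.inverseConst_pos hd0 hK0
  have hF := HpDG.Mesh.facetConst_pos (d := d) hK0
  have hV := HpDG.Mesh.vertexConst_pos hd0 hK0
  set E := HpDG.Mesh.equivConst d K |b|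
  set I := HpDG.Mesh.inverseConst d K
  set F := HpDG.Mesh.facetConst d K
  set V := HpDG.Mesh.vertexConst d K
  refine ⟨max 1 (4 * HpDG.Mesh.liftConst d K |b|), le_max_left _ _, (E ^ 2 * I * F)⁻¹,
    by positivity, E ^ 2 * I * (V * K * F), by positivity, ?_⟩
  intro M hγ hq p hp α hα θ β hmethod
  obtain ⟨hΩo, ⟨x, hx⟩, hΩc, -⟩ := hΩ
  obtain ⟨k, -⟩ := HpDG.Mesh.exists_mem_closure_elem (M := M) (subset_closure hx)
  obtain ⟨h, hM⟩ := hK M k.pos hγ hq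
  have hβ : ∀ f, ‖β f‖ ≤ |b| := by
    rcases hmethod with ⟨-, h0, -⟩ | ⟨-, hle⟩
    · intro f
      rw [h0, norm_zero]
      exact hb
    · exact fun f => (hle f).trans (le_abs_self b)
  have hθ : θ = 1 ∨ θ = 0 ∧ 4 * HpDG.Mesh.liftConst d K |b| ≤ α := by
    rcases hmethod with ⟨h0, -, hle⟩ | ⟨h1, -⟩
    · exact Or.inr ⟨h0, (le_max_right _ _).trans hle⟩
    · exact Or.inl h1
  have hA := (HpDG.Mesh.isSymmBilin_dgForm (α := α) (β := β) hM hp θ).mono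
    HpDG.Mesh.bdrySpace_le
  refine ⟨HpDG.Mesh.bijOn_jacobi hp hA fun u hu hne =>
    HpDG.Mesh.dgForm_pos hd0 hM hp hα hb hβ hθ hu hne, fun v hv => ?_, fun v hv => ?_⟩
  · rw [inv_mul_le_iff₀ (by positivity)]
    exact HpDG.Mesh.jacobi_lower_bound hd0 hM hp hα hb hβ hθ hv
  · have hmem := HpDG.Mesh.sub_oswald_mem hp hΩo hΩc hv
    exact ⟨hmem, HpDG.Mesh.jacobi_upper_bound hd0 hM hp hα hb hβ hθ hΩo hΩc hmem
      fun k a hξ => HpDG.Mesh.sum_sub_oswald hp v k a hξ⟩
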